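/- Let $d>1/2$ and $\psi(x)=e^{|x|/2}(1+|x|)^{1/2}\left(\log(e+|x|)\right)^d$ for $x\in\mathbb R$. Let $s>3$, let $H^r=H^r(\mathbb R)$ denote the $L^2$-based Sobolev space of order $r$ (whose elements, for $r>1/2$, are identified with their continuous representatives), and let $z_0=(u_0,\rho_0)\in H^s\times H^{s-1}$ be real-valued and nonzero. Let $0<T<\infty$ and let $z=(u,\rho)\in C([0,T),H^s\times H^{s-1})\cap C^1([0,T),H^{s-1}\times H^{s-2})$ be a strong solution of the two-component Camassa–Holm system $$u_t+uu_x=-\partial_x(1-\partial_x^2)^{-1}\left(u^2+\tfrac12u_x^2+\tfrac12\rho^2\right),\qquad \rho_t+u\rho_x=-\rho u_x$$ with $z(0)=z_0$; here $(1-\partial_x^2)^{-1}f=G*f$ with $G(x)=\tfrac12e^{-|x|}$. Assume that $$\sup_{x\in\mathbb R}\psi(x)\left(|u_0(x)|+|u_{0x}(x)|+|u_{0xx}(x)|+|\rho_0(x)|+|\rho_{0x}(x)|\right)<\infty.$$ Then this condition is conserved by the solution: for every $\tau\in[0,T)$, $$\sup_{t\in[0,\tau]}\sup_{x\in\mathbb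 R}\psi(x)\left(|u(x,t)|+|u_x(x,t)|+|u_{xx}(x,t)|+|\rho(x,t)|+|\rho_x(x,t)|\right)<\infty.$$ Moreover, there are functions $\Phi^\pm\colon[0,T)\to\mathbb R$ and $\varepsilon_1^\pm,\varepsilon_2^\pm\colon\mathbb R\times[0,T)\to\mathbb R$ such that, for all $t\in[0,T)$ and $x\in\mathbb R$, $$z(x,t)=z_0(x)+e^{-x}t\begin{pmatrix}\Phi^+(t)+\varepsilon_1^+(x,t)\\ \varepsilon_2^+(x,t)\end{pmatrix},\qquad z(x,t)=z_0(x)-e^{x}t\begin{pmatrix}\Phi^-(t)+\varepsilon_1^-(x,t)\\ \varepsilon_2^-(x,t)\end{pmatrix},$$ where, for every $\tau\in[0,T)$, $\varepsilon_{1}^+(x,t),\varepsilon_2^+(x,t)\to0$ as $x\to\infty$ and $\varepsilon_{1}^-(x,t),\varepsilon_2^-(x,t)\to0$ as $x\to-\infty$, in each case uniformly for $t\in[0,\tau]$, and there are constants $c_1,c_2>0$ with $c_1\leq\Phi^{\pm}(t)\leq c_2$ for all $t\in[0,T)$. -/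

import Mathlib

open Set Filter Topology MeasureTheory
open scoped ENNReal

noncomputable section

namespace TwoCH

/-- The norm of the Sobolev space `H^s(ℝ)`, i.e. the square root of
`∫ (1 + (2πξ)²)^s |f̂(ξ)|² dξ`, where `f̂` is the `L²` Fourier transform; it is `∞` if `f ∉ L²` or
if the integral diverges. (Mathlib's Fourier transform has the kernel `e^{-2πixξ}`, so that
`∂ₓ` has the symbol `2πiξ`.) -/
def sobolevENorm (s : ℝ) (f : ℝ → ℝ) : ℝ≥0∞ :=
  open Classical in
  if h : MemLp (fun x => (f x : ℂ)) 2 (volume : Measure ℝ) then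
    (∫⁻ ξ : ℝ, ENNReal.ofReal ((1 + (2 * Real.pi * ξ) ^ 2) ^ s) *
      ‖(FourierTransform.fourier (h.toLp (fun x => (f x : ℂ))) : Lp ℂ 2 (volume : Measure ℝ)) ξ‖ₑ ^ 2)
        ^ (1 / 2 : ℝ)
  else ⊤

/-- `f` is the continuous representative of an element of `H^s(ℝ)`. It is used for `s > 1/2` only,
where every class in `H^s(ℝ)` has exactly one continuous representative. -/
def MemH (s : ℝ) (f : ℝ → ℝ) : Prop :=
  Continuous f ∧ sobolevENorm s f < ⊤

/-- `f ∈ C([0,T), H^s)`; the value of `f` at time `t` is the function `f t` of the space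
variable. -/
def ContinuousInH (s T : ℝ) (f : ℝ → ℝ → ℝ) : Prop :=
  (∀ t ∈ Ico 0 T, MemH s (f t)) ∧
  ∀ t ∈ Ico 0 T, Tendsto (fun τ => sobolevENorm s (f τ - f t)) (𝓝[Ico 0 T] t) (𝓝 0)

/-- On `[0,T)`, `g` is the derivative of `f` with respect to time in the norm of `H^s`
(one-sided at time `0`). -/
def HasTimeDerivInH (s T : ℝ) (f g : ℝ → ℝ → ℝ) : Prop :=
  ∀ t ∈ Ico 0 T, Tendsto (fun τ => sobolevENorm s ((τ - t)⁻¹ • (f τ - f t) - g t))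
    (𝓝[Ico 0 T \ {t}] t) (𝓝 0)

/-- The Green's function `G(x) = e^{-|x|}/2` of `1 - ∂ₓ²`. -/
def green (x : ℝ) : ℝ := Real.exp (-|x|) / 2

/-- The operator `P(D) = -∂ₓ(1 - ∂ₓ²)⁻¹`, where `(1 - ∂ₓ²)⁻¹ f = G * f`. -/
def opP (f : ℝ → ℝ) (x : ℝ) : ℝ := -deriv (fun z => ∫ y, green (z - y) * f y) x

/-- `F(u,ρ) = u² + uₓ²/2 + ρ²/2`. -/
def nonlin (u ρ : ℝ → ℝ) (x : ℝ) : ℝ := u x ^ 2 + (deriv u x) ^ 2 / 2 + ρ x ^ 2 / 2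

/-- `(u,ρ) ∈ C([0,T), H^s × H^{s-1}) ∩ C¹([0,T), H^{s-1} × H^{s-2})` is a strong solution of the
two-component Camassa–Holm system
`uₜ + u uₓ = P(D)(u² + uₓ²/2 + ρ²/2)`, `ρₜ + u ρₓ = -ρ uₓ`,
with initial value `(u₀,ρ₀)` at time `0`. -/
structure IsStrongSolution (s T : ℝ) (u₀ ρ₀ : ℝ → ℝ) (u ρ : ℝ → ℝ → ℝ) : Prop where
  init_u : u 0 = u₀
  init_ρ : ρ 0 = ρ₀
  cont_u : ContinuousInH s T u
  cont_ρ : ContinuousInH (s - 1) T ρ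
  exists_deriv : ∃ ut ρt : ℝ → ℝ → ℝ,
    ContinuousInH (s - 1) T ut ∧ ContinuousInH (s - 2) T ρt ∧
    HasTimeDerivInH (s - 1) T u ut ∧ HasTimeDerivInH (s - 2) T ρ ρt ∧
    ∀ t ∈ Ico 0 T, ∀ x : ℝ,
      ut t x + u t x * deriv (u t) x = opP (nonlin (u t) (ρ t)) x ∧
      ρt t x + u t x * deriv (ρ t) x = -(ρ t x * deriv (u t) x)

/-- The weight `ψ(x) = e^{|x|/2} (1+|x|)^{1/2} (log(e+|x|))^d`. -/
def psi (d x : ℝ) : ℝ :=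
  Real.exp (|x| / 2) * (1 + |x|) ^ (1 / 2 : ℝ) * Real.log (Real.exp 1 + |x|) ^ d

/-- `ψ(x) (|u(x)| + |uₓ(x)| + |uₓₓ(x)| + |ρ(x)| + |ρₓ(x)|)`. -/
def weightedSize (d : ℝ) (u ρ : ℝ → ℝ) (x : ℝ) : ℝ :=
  psi d x * (|u x| + |deriv u x| + |deriv (deriv u) x| + |ρ x| + |deriv ρ x|)

end TwoCH

end

/-! Write F = u² + uₓ²/2 + ρ²/2 and P = -∂ₓ(1 - ∂ₓ²)⁻¹. The proof combines persistence of the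
weighted decay, a weighted energy estimate, and a pointwise expansion of P F.

Persistence. By Sobolev embedding the solution is classical, and u, uₓ, ρ satisfy transport
equations with velocity u. Their sources consist of products of jet entries and of P F or G * F. The
weight ψ varies by at most C e^{3|x-y|/4}, so convolution with G = e^{-|x|}/2 preserves the class
O(1/ψ), and characteristics, which move a bounded distance, preserve it too. An a priori sup bound
turns the quadratic sources into linear ones. With a factor e^{lt}, l large, a weighted bound then
improves itself by a factor 1/2 up to a fixed constant. Iteration yields a bound for bounded weights
that does not see their size, and truncation of ψ gives the claim
(`ClassicalSolution.exists_jetSize_bound`, `ClassicalSolution.exists_jetSize_bound_of_isModerate`).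

Expansion. Since e^{|x|}/ψ² = 1/((1+|x|) log^{2d}(e+|x|)) and 2d > 1, decay like 1/ψ makes e^{|y|}
F(y) integrable. Hence P F(x) = e^{-x}(m + o(1)) at +∞ with m = ½ ∫ e^y F(y) dy, whereas u uₓ, ρ uₓ
and u ρₓ are O(ψ⁻²) = o(e^{-x}). Integration in time gives the expansion, with Φ⁺(t) the mean of m
over [0,t] (`DecaysLike.abs_opP_sub_le`, `ClassicalSolution.abs_sub_sub_le`). The expansion at -∞
follows from the symmetry (u,ρ)(x) ↦ (-u,ρ)(-x).

Bounds on Φ. The lower one uses m ≥ 0 and m(0) > 0 with continuity at time 0. The upper one must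
hold up to T, where uₓ may blow up, so the persistence constants are useless for it. It comes from
the conservation law for u² + uₓ² + ρ², integrated against 1, e^{x/2} and e^x in turn. Each weight
yields the coefficients of a linear Gronwall inequality for the next
(`ClassicalSolution.exists_integral_exp_mul_energyDensity_le`). -/

noncomputable section

namespace TwoCH

/-! ### Fourier inversion and the Sobolev embedding. -/

open FourierTransform in
/-- `L²` functions whose Fourier transform is integrable are given by the inversion formula. -/
theorem ae_eq_fourierInv_of_integrable (F : Lp ℂ 2 (volume : Measure ℝ))
    (hg : Integrable (𝓕 F : Lp ℂ 2 (volume : Measure ℝ))) :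
    ∀ᵐ x : ℝ, F x = 𝓕⁻ (⇑(𝓕 F : Lp ℂ 2 (volume : Measure ℝ))) x := by
  set g : Lp ℂ 2 (volume : Measure ℝ) := 𝓕 F with hgdef
  have hcont : Continuous (𝓕⁻ (⇑g)) := by
    rw [Real.fourierInv_eq_fourier_comp_neg]
    exact VectorFourier.fourierIntegral_continuous Real.continuous_fourierChar
      (by fun_prop) hg.comp_neg
  -- Both sides are tested against smooth compactly supported functions. The transform is moved onto
  -- the test function twice: for F as a tempered distribution, and for the integrable g by Fubini.
  apply ae_eq_of_integral_contDiff_smul_eq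
  · exact (Lp.memLp F).locallyIntegrable (by norm_num)
  · exact hcont.locallyIntegrable
  · intro p hp hpc
    have hg₁ : HasCompactSupport (Complex.ofRealCLM ∘ p) := hpc.comp_left rfl
    have hg₂ : ContDiff ℝ (⊤ : ℕ∞) (Complex.ofRealCLM ∘ p) := by fun_prop
    set φ : SchwartzMap ℝ ℂ := hg₁.toSchwartzMap hg₂ with hφ
    have e1 : ∫ x, p x • F x = Lp.toTemperedDistribution F φ := by
      rw [Lp.toTemperedDistribution_apply]
      rfl
    have e2 : Lp.toTemperedDistribution F φ = Lp.toTemperedDistribution g (𝓕⁻ φ) := by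
      have h1 : F = 𝓕⁻ g := by simp [hgdef]
      conv_lhs => rw [h1, ← Lp.fourierInv_toTemperedDistribution_eq]
      rfl
    rw [e1, e2, Lp.toTemperedDistribution_apply]
    have h3 := VectorFourier.integral_fourierIntegral_smul_eq_flip (μ := volume) (ν := volume)
      (L := -innerₗ ℝ) (f := ⇑φ) (g := ⇑g) Real.continuous_fourierChar
      (by simpa using! (continuous_fst.inner continuous_snd).neg) φ.integrable hg
    have h4 : ∀ ξ, (𝓕⁻ φ) ξ = VectorFourier.fourierIntegral Real.fourierChar volume
        (-innerₗ ℝ) φ ξ := by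
      intro ξ
      rw [SchwartzMap.fourierInv_coe, Real.fourierInv_eq]
      simp [VectorFourier.fourierIntegral]
    have h5 : ∀ x, 𝓕⁻ (⇑g) x = VectorFourier.fourierIntegral Real.fourierChar volume
        (-innerₗ ℝ).flip g x := by
      intro x
      rw [Real.fourierInv_eq]
      simp [VectorFourier.fourierIntegral, mul_comm]
    simp_rw [h4, h3, h5]
    rfl

/-- The Cauchy–Schwarz bound for the moments of a function in a weighted `L²` space. -/
theorem lintegral_pow_mul_le (k : ℕ) {r : ℝ} (hr : k ≤ r) (g : ℝ → ℂ) (hg : AEMeasurable g)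
    (n : ℕ) (hn : n ≤ k) :
    ∫⁻ ξ : ℝ, ‖ξ ^ n • g ξ‖ₑ ≤
      (∫⁻ ξ : ℝ, ENNReal.ofReal ((1 + ‖ξ‖ ^ 2) ^ (-(2 * (r - k)) / 2))) ^ (1 / 2 : ℝ) *
      (∫⁻ ξ : ℝ, ENNReal.ofReal ((1 + (2 * Real.pi * ξ) ^ 2) ^ r) * ‖g ξ‖ₑ ^ 2) ^ (1 / 2 : ℝ) := by
  have hpos : ∀ ξ : ℝ, 0 < 1 + (2 * Real.pi * ξ) ^ 2 := fun ξ => by positivity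
  -- |ξ|ⁿ is split as a · b, where b is the square root of the Sobolev weight. The square of a is at
  -- most (1+ξ²)^{-(r-k)}.
  set a : ℝ → ℝ := fun ξ => |ξ| ^ n * (1 + (2 * Real.pi * ξ) ^ 2) ^ (-(r / 2))
  set b : ℝ → ℝ := fun ξ => (1 + (2 * Real.pi * ξ) ^ 2) ^ (r / 2)
  have ha0 : ∀ ξ, 0 ≤ a ξ := fun ξ => by positivity
  have hb0 : ∀ ξ, 0 ≤ b ξ := fun ξ => by positivity
  have hac : Continuous a := by
    refine Continuous.mul (by fun_prop) (Continuous.rpow_const (by fun_prop) fun ξ => ?_)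
    exact Or.inl (hpos ξ).ne'
  have hbc : Continuous b := Continuous.rpow_const (by fun_prop) fun ξ => Or.inl (hpos ξ).ne'
  have hab : ∀ ξ, a ξ * b ξ = |ξ| ^ n := fun ξ => by
    simp only [a, b]
    rw [mul_assoc, ← Real.rpow_add (hpos ξ)]
    simp
  have h1 : ∀ ξ, ‖ξ ^ n • g ξ‖ₑ
      = ((fun ξ => ENNReal.ofReal (a ξ)) * fun ξ => ENNReal.ofReal (b ξ) * ‖g ξ‖ₑ) ξ := by
    intro ξ
    simp only [Pi.mul_apply]
    rw [← mul_assoc, ← ENNReal.ofReal_mul (ha0 ξ), hab, enorm_smul]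
    congr 1
    rw [← ofReal_norm]
    simp
  simp_rw [h1]
  refine (ENNReal.lintegral_mul_le_Lp_mul_Lq volume
    (Real.HolderConjugate.two_two) (hac.measurable.ennreal_ofReal.aemeasurable)
    (hbc.measurable.ennreal_ofReal.aemeasurable.mul hg.enorm)).trans ?_
  gcongr ?_ ^ _ * ?_ ^ _
  · refine lintegral_mono fun ξ => ?_
    rw [show (2 : ℝ) = ((2 : ℕ) : ℝ) by norm_num, ENNReal.rpow_natCast,
      ← ENNReal.ofReal_pow (ha0 ξ)]
    refine ENNReal.ofReal_le_ofReal ?_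
    simp only [a]
    have hξ : 0 < 1 + ‖ξ‖ ^ 2 := by positivity
    have h2 : 1 + ‖ξ‖ ^ 2 ≤ 1 + (2 * Real.pi * ξ) ^ 2 := by
      have : 1 ≤ (2 * Real.pi) ^ 2 := by nlinarith [Real.pi_gt_three]
      rw [Real.norm_eq_abs, sq_abs, mul_pow]
      nlinarith [sq_nonneg ξ]
    have h3 : 1 ≤ 1 + (2 * Real.pi * ξ) ^ 2 := by nlinarith [sq_nonneg (2 * Real.pi * ξ)]
    calc (|ξ| ^ n * (1 + (2 * Real.pi * ξ) ^ 2) ^ (-(r / 2))) ^ 2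
        = (|ξ| ^ 2) ^ n * (1 + (2 * Real.pi * ξ) ^ 2) ^ (-r) := by
          rw [mul_pow, ← Real.rpow_natCast (_ ^ (-(r / 2))), ← Real.rpow_mul (hpos ξ).le,
            ← pow_mul, ← pow_mul, mul_comm n]
          congr 2
          push_cast; ring
      _ ≤ (1 + (2 * Real.pi * ξ) ^ 2) ^ k * (1 + (2 * Real.pi * ξ) ^ 2) ^ (-r) := by
          gcongr
          refine le_trans ?_ (pow_le_pow_right₀ h3 hn)
          gcongr
          rw [Real.norm_eq_abs] at h2
          linarith
      _ = (1 + (2 * Real.pi * ξ) ^ 2) ^ (-(r - k)) := by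
          rw [← Real.rpow_natCast, ← Real.rpow_add (hpos ξ)]
          congr 1; ring
      _ ≤ (1 + ‖ξ‖ ^ 2) ^ (-(r - k)) :=
          Real.rpow_le_rpow_of_nonpos hξ h2 (by linarith)
      _ = _ := by congr 1; ring
  · refine le_of_eq (lintegral_congr fun ξ => ?_)
    rw [ENNReal.rpow_ofNat]
    change (ENNReal.ofReal (b ξ) * ‖g ξ‖ₑ) ^ 2 = _
    rw [mul_pow, ← ENNReal.ofReal_pow (hb0 ξ)]
    congr 2
    simp only [b]
    rw [← Real.rpow_natCast, ← Real.rpow_mul (hpos ξ).le]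
    congr 1
    push_cast; ring

open FourierTransform in
/-- The Sobolev embedding `H^r(ℝ) ⊂ C_b^k(ℝ)` for `r > k + 1/2`. -/
theorem exists_sobolev_embedding (k : ℕ) {r : ℝ} (hr : k + 1 / 2 < r) :
    ∃ C : ℝ, 0 ≤ C ∧ ∀ f : ℝ → ℝ, MemH r f → ContDiff ℝ k f ∧
      ∀ j ≤ k, ∀ x, |iteratedDeriv j f x| ≤ C * (sobolevENorm r f).toReal := by
  set A : ℝ≥0∞ := ∫⁻ ξ : ℝ, ENNReal.ofReal ((1 + ‖ξ‖ ^ 2) ^ (-(2 * (r - k)) / 2)) with hA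
  have hAfin : A < ⊤ := by
    have h := integrable_rpow_neg_one_add_norm_sq (E := ℝ) (μ := volume) (r := 2 * (r - k))
      (by simp; linarith)
    refine lt_of_eq_of_lt ?_ h.2
    refine lintegral_congr fun ξ => ?_
    rw [Real.enorm_of_nonneg (by positivity)]
  refine ⟨(2 * Real.pi + 1) ^ k * (A ^ (1 / 2 : ℝ)).toReal, by positivity, fun f hf => ?_⟩
  obtain ⟨hfc, hfn⟩ := hf
  have h : MemLp (fun x => (f x : ℂ)) 2 (volume : Measure ℝ) := by
    by_contra h
    simp [sobolevENorm, h] at hfn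
  set F : Lp ℂ 2 (volume : Measure ℝ) := h.toLp (fun x => (f x : ℂ)) with hF
  set g : Lp ℂ 2 (volume : Measure ℝ) := 𝓕 F with hg
  have hN : sobolevENorm r f = (∫⁻ ξ : ℝ, ENNReal.ofReal ((1 + (2 * Real.pi * ξ) ^ 2) ^ r) *
      ‖g ξ‖ₑ ^ 2) ^ (1 / 2 : ℝ) := by
    simp only [sobolevENorm, h, dif_pos]
    rfl
  have hgm : AEStronglyMeasurable g volume := Lp.aestronglyMeasurable g
  have hmom : ∀ n ≤ k, ∫⁻ ξ : ℝ, ‖ξ ^ n • g ξ‖ₑ ≤ A ^ (1 / 2 : ℝ) * sobolevENorm r f := by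
    intro n hn
    rw [hN]
    exact lintegral_pow_mul_le k (by linarith) g hgm.aemeasurable n hn
  have hfin : A ^ (1 / 2 : ℝ) * sobolevENorm r f < ⊤ :=
    ENNReal.mul_lt_top (ENNReal.rpow_lt_top_of_nonneg (by norm_num) hAfin.ne) hfn
  have hint : ∀ n ≤ k, Integrable fun ξ : ℝ => ξ ^ n • g ξ := fun n hn =>
    ⟨(continuous_pow n).aestronglyMeasurable.smul hgm, (hmom n hn).trans_lt hfin⟩
  have hg1 : Integrable g := by simpa using hint 0 (Nat.zero_le _)
  -- Reflecting g turns the inverse transform into a forward one, to which the differentiation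
  -- formulas for `𝓕` apply.
  set G : ℝ → ℂ := fun ξ => g (-ξ) with hG
  have hGint : ∀ n : ℕ, (n : ℕ∞) ≤ (k : ℕ∞) → Integrable fun ξ : ℝ => ξ ^ n • G ξ := by
    intro n hn
    have := ((hint n (by exact_mod_cast hn)).comp_neg).smul ((-1 : ℝ) ^ n)
    refine this.congr (Eventually.of_forall fun ξ => ?_)
    simp only [Pi.smul_apply, smul_smul, hG, ← mul_pow]
    norm_num
  have hGnorm : ∀ n : ℕ, (n : ℕ∞) ≤ (k : ℕ∞) → Integrable fun ξ : ℝ => ‖ξ‖ ^ n * ‖G ξ‖ := by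
    intro n hn
    refine (hGint n hn).norm.congr (Eventually.of_forall fun ξ => ?_)
    simp
  have hfeq : f = Complex.reCLM ∘ 𝓕 G := by
    have h1 : (fun x => (f x : ℂ)) =ᵐ[volume] 𝓕 G := by
      filter_upwards [ae_eq_fourierInv_of_integrable F hg1, h.coeFn_toLp] with x hx1 hx2
      rw [← hx2, ← hF, hx1, Real.fourierInv_eq_fourier_comp_neg]
    have hc : Continuous (𝓕 G) :=
      VectorFourier.fourierIntegral_continuous Real.continuous_fourierChar
        (by fun_prop) hg1.comp_neg
    have h2 := (Continuous.ae_eq_iff_eq volume (by fun_prop) hc).1 h1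
    rw [← h2]
    ext x; simp
  have hCD : ContDiff ℝ k (𝓕 G) := Real.contDiff_fourier hGnorm
  refine ⟨hfeq ▸ Complex.reCLM.contDiff.comp hCD, fun j hj x => ?_⟩
  have hjk : (j : ℕ∞) ≤ (k : ℕ∞) := by exact_mod_cast hj
  have hre : |iteratedDeriv j f x| ≤ ‖iteratedDeriv j (𝓕 G) x‖ := by
    rw [← Real.norm_eq_abs, ← norm_iteratedFDeriv_eq_norm_iteratedDeriv,
      ← norm_iteratedFDeriv_eq_norm_iteratedDeriv, hfeq]
    have := Complex.reCLM.norm_iteratedFDeriv_comp_left (f := 𝓕 G) (x := x) (n := j)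
      (hCD.of_le (by exact_mod_cast hj)).contDiffAt le_rfl
    simpa using this
  refine hre.trans ?_
  rw [Real.iteratedDeriv_fourier hGint hjk]
  refine (VectorFourier.norm_fourierIntegral_le_integral_norm _ _ _ _ _).trans ?_
  have h1 : ∀ ξ : ℝ, ‖(-2 * Real.pi * Complex.I * ξ) ^ j • G ξ‖
      = (2 * Real.pi) ^ j * ‖ξ ^ j • G ξ‖ := by
    intro ξ
    simp [mul_pow, abs_of_pos Real.pi_pos]
    ring
  simp_rw [h1]
  rw [integral_const_mul]
  have h2 : ∫ ξ, ‖ξ ^ j • G ξ‖ ≤ (A ^ (1 / 2 : ℝ)).toReal * (sobolevENorm r f).toReal := by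
    have h3 : ∫ ξ, ‖ξ ^ j • G ξ‖ = ∫ ξ, ‖ξ ^ j • g ξ‖ := by
      rw [← integral_neg_eq_self]
      simp [hG]
    rw [h3, integral_norm_eq_lintegral_enorm (hint j hj).1, ← ENNReal.toReal_mul]
    exact ENNReal.toReal_mono hfin.ne (hmom j hj)
  calc (2 * Real.pi) ^ j * ∫ ξ, ‖ξ ^ j • G ξ‖
      ≤ (2 * Real.pi + 1) ^ k * ((A ^ (1 / 2 : ℝ)).toReal * (sobolevENorm r f).toReal) := by
        refine mul_le_mul ?_ h2 (integral_nonneg fun _ => norm_nonneg _) (by positivity)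
        exact (pow_le_pow_left₀ (by positivity) (by linarith) j).trans
          (pow_le_pow_right₀ (by linarith [Real.pi_pos]) hj)
    _ = _ := by ring

/-! ### The Green operator and its action on weighted spaces. -/

/-- The operator `(1 - ∂ₓ²)⁻¹`, that is, `f ↦ G * f`. -/
def greenConv (f : ℝ → ℝ) (x : ℝ) : ℝ := ∫ y, green (x - y) * f y

/-- `∫_{-∞}^x e^{y-x} f(y) dy`. -/
def leftExpMean (f : ℝ → ℝ) (x : ℝ) : ℝ := ∫ y in Iic x, Real.exp (y - x) * f y

/-- `∫_x^∞ e^{x-y} f(y) dy`. -/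
def rightExpMean (f : ℝ → ℝ) (x : ℝ) : ℝ := ∫ y in Ioi x, Real.exp (x - y) * f y

theorem integrableOn_exp_mul_Iic {f : ℝ → ℝ} (hf : Continuous f) {L : ℝ} (hL : ∀ x, |f x| ≤ L)
    (x : ℝ) : IntegrableOn (fun y => Real.exp y * f y) (Iic x) :=
  (integrableOn_exp_Iic x).mul_bdd (c := L) hf.aestronglyMeasurable
    (Eventually.of_forall hL)

theorem integrableOn_exp_neg_mul_Ioi {f : ℝ → ℝ} (hf : Continuous f) {L : ℝ}
    (hL : ∀ x, |f x| ≤ L) (x : ℝ) : IntegrableOn (fun y => Real.exp (-y) * f y) (Ioi x) :=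
  (integrableOn_exp_neg_Ioi x).mul_bdd (c := L) hf.aestronglyMeasurable
    (Eventually.of_forall hL)

theorem leftExpMean_eq (f : ℝ → ℝ) (x : ℝ) :
    leftExpMean f x = Real.exp (-x) * ∫ y in Iic x, Real.exp y * f y := by
  rw [leftExpMean, ← integral_const_mul]
  congr 1; ext y
  rw [sub_eq_add_neg, Real.exp_add]; ring

theorem rightExpMean_eq (f : ℝ → ℝ) (x : ℝ) :
    rightExpMean f x = Real.exp x * ∫ y in Ioi x, Real.exp (-y) * f y := by
  rw [rightExpMean, ← integral_const_mul]
  congr 1; ext y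
  rw [sub_eq_add_neg, Real.exp_add]; ring

/-- `leftExpMean` and `rightExpMean` are the bounded solutions of y' + y = f and y - y' = f, the two
first-order factors of 1 - ∂ₓ². Their half sum is G * f, and their half difference is P f. -/
theorem hasDerivAt_leftExpMean {f : ℝ → ℝ} (hf : Continuous f) {L : ℝ} (hL : ∀ x, |f x| ≤ L)
    (x : ℝ) : HasDerivAt (leftExpMean f) (f x - leftExpMean f x) x := by
  have h1 : leftExpMean f = fun x => Real.exp (-x) *
      ((∫ y in Iic 0, Real.exp y * f y) + ∫ y in (0 : ℝ)..x, Real.exp y * f y) := by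
    ext x
    rw [leftExpMean_eq, ← intervalIntegral.integral_Iic_sub_Iic
      (integrableOn_exp_mul_Iic hf hL 0) (integrableOn_exp_mul_Iic hf hL x)]
    ring
  have hc : Continuous fun y => Real.exp y * f y := by fun_prop
  have h2 := ((hasDerivAt_neg x).exp).mul
    ((hc.integral_hasStrictDerivAt 0 x).hasDerivAt.const_add (∫ y in Iic 0, Real.exp y * f y))
  have h3 : leftExpMean f x = Real.exp (-x) *
      ((∫ y in Iic 0, Real.exp y * f y) + ∫ y in (0 : ℝ)..x, Real.exp y * f y) := congrFun h1 x
  rw [h3, h1]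
  refine h2.congr_deriv ?_
  rw [← mul_assoc (Real.exp (-x)) (Real.exp x), ← Real.exp_add]
  simp
  ring

theorem hasDerivAt_rightExpMean {f : ℝ → ℝ} (hf : Continuous f) {L : ℝ} (hL : ∀ x, |f x| ≤ L)
    (x : ℝ) : HasDerivAt (rightExpMean f) (rightExpMean f x - f x) x := by
  have h1 : rightExpMean f = fun x => Real.exp x *
      ((∫ y in Ioi 0, Real.exp (-y) * f y) - ∫ y in (0 : ℝ)..x, Real.exp (-y) * f y) := by
    ext x
    rw [rightExpMean_eq, ← intervalIntegral.integral_Ioi_sub_Ioi'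
      (integrableOn_exp_neg_mul_Ioi hf hL 0) (integrableOn_exp_neg_mul_Ioi hf hL x)]
    ring
  have hc : Continuous fun y => Real.exp (-y) * f y := by fun_prop
  have h2 := (Real.hasDerivAt_exp x).mul
    ((hc.integral_hasStrictDerivAt 0 x).hasDerivAt.const_sub (∫ y in Ioi 0, Real.exp (-y) * f y))
  have h3 : rightExpMean f x = Real.exp x *
      ((∫ y in Ioi 0, Real.exp (-y) * f y) - ∫ y in (0 : ℝ)..x, Real.exp (-y) * f y) :=
    congrFun h1 x
  rw [h3, h1]
  refine h2.congr_deriv ?_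
  rw [mul_neg, ← mul_assoc (Real.exp x) (Real.exp (-x)), ← Real.exp_add]
  simp
  ring

theorem integral_exp_neg_mul_abs {a : ℝ} (ha : 0 < a) :
    ∫ y : ℝ, Real.exp (-(a * |y|)) = 2 / a := by
  rw [integral_comp_abs (f := fun y => Real.exp (-(a * y)))]
  have := integral_exp_mul_Ioi (a := -a) (by linarith) 0
  simp only [neg_mul] at this
  rw [this]
  simp
  ring

/-- A non-integrable function has integral 0 by convention, so the nonzero value just computed
proves integrability. -/
theorem integrable_exp_neg_mul_abs {a : ℝ} (ha : 0 < a) :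
    Integrable fun y : ℝ => Real.exp (-(a * |y|)) :=
  Integrable.of_integral_ne_zero (by rw [integral_exp_neg_mul_abs ha]; positivity)

theorem integrable_green_mul {f : ℝ → ℝ} (hf : Continuous f) {L : ℝ} (hL : ∀ x, |f x| ≤ L)
    (x : ℝ) : Integrable fun y => green (x - y) * f y := by
  refine Integrable.mul_bdd (c := L) ?_ hf.aestronglyMeasurable (Eventually.of_forall hL)
  have h1 : Integrable fun y : ℝ => green (y - x) := by
    refine Integrable.comp_sub_right (f := green) ?_ x
    have := (integrable_exp_neg_mul_abs one_pos).div_const 2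
    simpa only [one_mul] using! this
  refine h1.congr (Eventually.of_forall fun y => ?_)
  simp [green, abs_sub_comm]

theorem greenConv_eq {f : ℝ → ℝ} (hf : Continuous f) {L : ℝ} (hL : ∀ x, |f x| ≤ L) (x : ℝ) :
    greenConv f x = (leftExpMean f x + rightExpMean f x) / 2 := by
  rw [greenConv, ← integral_add_compl (measurableSet_Iic (a := x)) (integrable_green_mul hf hL x),
    compl_Iic, leftExpMean, rightExpMean, add_div, ← integral_div, ← integral_div]
  congr 1
  · refine setIntegral_congr_fun measurableSet_Iic fun y hy => ?_
    simp only [mem_Iic] at hy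
    simp only [green]
    rw [abs_of_nonneg (by linarith), neg_sub]
    ring
  · refine setIntegral_congr_fun measurableSet_Ioi fun y hy => ?_
    simp only [mem_Ioi] at hy
    simp only [green]
    rw [abs_of_neg (by linarith), neg_neg]
    ring

theorem hasDerivAt_greenConv {f : ℝ → ℝ} (hf : Continuous f) {L : ℝ} (hL : ∀ x, |f x| ≤ L)
    (x : ℝ) : HasDerivAt (greenConv f) ((rightExpMean f x - leftExpMean f x) / 2) x := by
  rw [show greenConv f = fun x => (leftExpMean f x + rightExpMean f x) / 2 from
    funext (greenConv_eq hf hL)]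
  refine (((hasDerivAt_leftExpMean hf hL x).add
    (hasDerivAt_rightExpMean hf hL x)).div_const 2).congr_deriv ?_
  ring

theorem opP_eq {f : ℝ → ℝ} (hf : Continuous f) {L : ℝ} (hL : ∀ x, |f x| ≤ L) (x : ℝ) :
    opP f x = (leftExpMean f x - rightExpMean f x) / 2 := by
  have := (hasDerivAt_greenConv hf hL x).deriv
  change -deriv (greenConv f) x = _
  rw [this]; ring

/-- This is -∂ₓ²(1 - ∂ₓ²)⁻¹ = 1 - (1 - ∂ₓ²)⁻¹. No derivative falls on f, so f need only be
continuous and bounded. -/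
theorem hasDerivAt_opP {f : ℝ → ℝ} (hf : Continuous f) {L : ℝ} (hL : ∀ x, |f x| ≤ L) (x : ℝ) :
    HasDerivAt (opP f) (f x - greenConv f x) x := by
  rw [show opP f = fun x => (leftExpMean f x - rightExpMean f x) / 2 from funext (opP_eq hf hL)]
  refine (((hasDerivAt_leftExpMean hf hL x).sub
    (hasDerivAt_rightExpMean hf hL x)).div_const 2).congr_deriv ?_
  rw [greenConv_eq hf hL]
  ring

theorem hasDerivAt_greenConv' {f : ℝ → ℝ} (hf : Continuous f) {L : ℝ} (hL : ∀ x, |f x| ≤ L)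
    (x : ℝ) : HasDerivAt (greenConv f) (-opP f x) x := by
  refine (hasDerivAt_greenConv hf hL x).congr_deriv ?_
  rw [opP_eq hf hL]; ring

/-- The kernel of P is ½ sgn(x) e^{-|x|}, whose absolute value is G. -/
theorem abs_opP_le {f : ℝ → ℝ} (hf : Continuous f) {L : ℝ} (hL : ∀ x, |f x| ≤ L) (x : ℝ) :
    |opP f x| ≤ greenConv (fun y => |f y|) x := by
  have h1 : |leftExpMean f x| ≤ leftExpMean (fun y => |f y|) x := by
    refine (abs_integral_le_integral_abs).trans_eq ?_
    simp [leftExpMean, abs_mul]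
  have h2 : |rightExpMean f x| ≤ rightExpMean (fun y => |f y|) x := by
    refine (abs_integral_le_integral_abs).trans_eq ?_
    simp [rightExpMean, abs_mul]
  rw [opP_eq hf hL, greenConv_eq hf.abs (L := L) (by simpa using hL), abs_div, abs_two]
  gcongr
  exact (abs_sub _ _).trans (add_le_add h1 h2)

theorem abs_greenConv_le (f : ℝ → ℝ) (x : ℝ) :
    |greenConv f x| ≤ greenConv (fun y => |f y|) x := by
  refine (abs_integral_le_integral_abs).trans_eq ?_
  simp_rw [greenConv, abs_mul, green]
  congr 1; ext y
  rw [abs_of_nonneg (by positivity)]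

theorem green_nonneg (x : ℝ) : 0 ≤ green x := by unfold green; positivity

theorem greenConv_nonneg {f : ℝ → ℝ} (hf : ∀ x, 0 ≤ f x) (x : ℝ) : 0 ≤ greenConv f x :=
  integral_nonneg fun y => mul_nonneg (green_nonneg _) (hf y)

/-- `G *` acts boundedly on functions which are `O(1/φ)`, for every weight `φ` that varies by a
factor of at most `C e^{3|x-y|/4}` between `x` and `y`. -/
theorem greenConv_le_div {f φ : ℝ → ℝ} (hφ : ∀ x, 0 < φ x) {C M : ℝ} (hM : 0 ≤ M)
    (hmod : ∀ x y, φ x ≤ C * Real.exp (3 / 4 * |x - y|) * φ y)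
    (hf : ∀ y, |f y| ≤ M / φ y) (x : ℝ) :
    greenConv (fun y => |f y|) x ≤ 4 * C * M / φ x := by
  have hC : 0 < C := by
    have h1 := hmod 0 0
    simp only [sub_self, abs_zero, mul_zero, Real.exp_zero, mul_one] at h1
    nlinarith [hφ 0]
  have hint : Integrable fun y : ℝ => Real.exp (-(1 / 4 * |x - y|)) := by
    have := (integrable_exp_neg_mul_abs (a := 1 / 4) (by norm_num)).comp_sub_right x
    refine this.congr (Eventually.of_forall fun y => ?_)
    simp [abs_sub_comm]
  have hval : ∫ y : ℝ, Real.exp (-(1 / 4 * |x - y|)) = 8 := by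
    rw [integral_sub_left_eq_self (fun y => Real.exp (-(1 / 4 * |y|))) volume x,
      integral_exp_neg_mul_abs (by norm_num)]
    norm_num
  calc greenConv (fun y => |f y|) x
      ≤ ∫ y, C * M / φ x / 2 * Real.exp (-(1 / 4 * |x - y|)) := by
        refine integral_mono_of_nonneg
          (Eventually.of_forall fun y => mul_nonneg (green_nonneg _) (abs_nonneg _))
          (hint.const_mul _) (Eventually.of_forall fun y => ?_)
        -- The kernel absorbs the variation e^{3|x-y|/4} of the weight and leaves e^{-|x-y|/4}, of
        -- integral 8. The factor ½ in G turns this into the 4 of the statement.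
        have h1 : |f y| ≤ C * M / φ x * Real.exp (3 / 4 * |x - y|) := by
          refine (hf y).trans ?_
          rw [div_mul_eq_mul_div, div_le_div_iff₀ (hφ y) (hφ x)]
          nlinarith [mul_le_mul_of_nonneg_left (hmod x y) hM]
        have h2 : green (x - y) = Real.exp (-(1 / 4 * |x - y|)) *
            Real.exp (-(3 / 4 * |x - y|)) / 2 := by
          rw [green, ← Real.exp_add]; congr 2; ring
        change green (x - y) * |f y| ≤ _
        refine (mul_le_mul_of_nonneg_left h1 (green_nonneg _)).trans_eq ?_
        rw [h2, Real.exp_neg (3 / 4 * |x - y|)]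
        field_simp
    _ = 4 * C * M / φ x := by
        rw [integral_const_mul, hval]; ring

/-! ### Characteristics and transport equations. -/

/-- On `[0,T)`, `g` is the derivative of `f` with respect to time, uniformly in space. -/
def HasUnifTimeDeriv (T : ℝ) (f g : ℝ → ℝ → ℝ) : Prop :=
  ∀ t ∈ Ico 0 T, ∀ ε > 0, ∀ᶠ τ in 𝓝[Ico 0 T \ {t}] t,
    ∀ x, |(τ - t)⁻¹ * (f τ x - f t x) - g t x| ≤ ε

/-- A velocity field on `[0,τ] × ℝ` which is continuous in time, bounded by `L`, and Lipschitz in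
space with constant `L`. -/
structure IsVelocity (L τ : ℝ) (v : ℝ → ℝ → ℝ) : Prop where
  nonneg : 0 ≤ L
  bound : ∀ t ∈ Icc 0 τ, ∀ x, |v t x| ≤ L
  lip : ∀ t ∈ Icc 0 τ, ∀ x y, |v t x - v t y| ≤ L * |x - y|
  cont : ∀ x, ContinuousOn (fun t => v t x) (Icc 0 τ)

/-- `q` is a characteristic of the velocity field `v` on `[0,τ]`. -/
def IsCharacteristic (τ : ℝ) (v : ℝ → ℝ → ℝ) (q : ℝ → ℝ) : Prop :=
  ∀ s ∈ Icc 0 τ, HasDerivWithinAt q (v s (q s)) (Icc 0 τ) s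

theorem IsVelocity.continuous {L τ : ℝ} {v : ℝ → ℝ → ℝ} (hv : IsVelocity L τ v) {t : ℝ}
    (ht : t ∈ Icc 0 τ) : Continuous (v t) := by
  lift L to NNReal using hv.nonneg
  exact (LipschitzWith.of_dist_le_mul (K := L)
    (fun a b => by simpa [Real.dist_eq] using hv.lip t ht a b)).continuous

theorem IsVelocity.exists_characteristic {L τ : ℝ} {v : ℝ → ℝ → ℝ} (hv : IsVelocity L τ v)
    (hτ : 0 ≤ τ) (x : ℝ) : ∃ q, q τ = x ∧ IsCharacteristic τ v q := by
  lift L to NNReal using hv.nonneg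
  -- The condition is imposed at the final time τ. As v is bounded by L everywhere, a ball of radius
  -- Lτ contains the curve over all of [0,τ], and the time interval need not be shortened.
  have hpl : IsPicardLindelof v (⟨τ, right_mem_Icc.2 hτ⟩ : Icc 0 τ) x (L * ⟨τ, hτ⟩) 0 L L := by
    refine ⟨fun t ht => ?_, fun y _ => hv.cont y, fun t ht y _ => ?_, ?_⟩
    · refine LipschitzOnWith.of_dist_le_mul fun a _ b _ => ?_
      simpa [Real.dist_eq] using hv.lip t ht a b
    · simpa using hv.bound t ht y
    · simp only [sub_zero, sub_self, NNReal.coe_zero]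
      rw [max_eq_right hτ]
      exact (NNReal.coe_mul L ⟨τ, hτ⟩).ge
  obtain ⟨q, hq, hq'⟩ := hpl.exists_eq_forall_mem_Icc_hasDerivWithinAt₀
  exact ⟨q, hq, hq'⟩

theorem IsCharacteristic.abs_sub_le {L τ : ℝ} {v : ℝ → ℝ → ℝ} {q : ℝ → ℝ}
    (hq : IsCharacteristic τ v q) (hv : IsVelocity L τ v) {s : ℝ} (hs : s ∈ Icc 0 τ) :
    |q τ - q s| ≤ L * τ := by
  have hτ : 0 ≤ τ := hs.1.trans hs.2
  have := (convex_Icc 0 τ).norm_image_sub_le_of_norm_hasDerivWithin_le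
    (fun x hx => hq x hx) (fun x hx => hv.bound x hx (q x)) hs (right_mem_Icc.2 hτ)
  refine this.trans ?_
  rw [Real.norm_eq_abs, abs_of_nonneg (by linarith [hs.2])]
  exact mul_le_mul_of_nonneg_left (by linarith [hs.1]) hv.nonneg

/-- Characteristics depend on their final position in a Lipschitz way. -/
theorem IsCharacteristic.abs_sub_le_exp {L τ : ℝ} {v : ℝ → ℝ → ℝ} {p q : ℝ → ℝ}
    (hp : IsCharacteristic τ v p) (hq : IsCharacteristic τ v q) (hv : IsVelocity L τ v)
    {s : ℝ} (hs : s ∈ Icc 0 τ) :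
    |p s - q s| ≤ Real.exp (L * τ) * |p τ - q τ| := by
  have hτ : 0 ≤ τ := hs.1.trans hs.2
  -- The derivative of (p - q)² is at least -2L (p - q)², so the factor e^{2Ls} makes D
  -- nondecreasing. Comparing s with τ is Gronwall's estimate backwards in time.
  set D : ℝ → ℝ := fun s => Real.exp (2 * L * s) * (p s - q s) ^ 2 with hD
  have hder : ∀ s ∈ Icc 0 τ, HasDerivWithinAt D
      (2 * Real.exp (2 * L * s) * (L * (p s - q s) ^ 2
        + (p s - q s) * (v s (p s) - v s (q s)))) (Icc 0 τ) s := by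
    intro s hs
    have h1 : HasDerivWithinAt (fun s => Real.exp (2 * L * s))
        (Real.exp (2 * L * s) * (2 * L)) (Icc 0 τ) s := by
      have := ((hasDerivAt_id s).const_mul (2 * L)).exp
      simpa using this.hasDerivWithinAt
    refine (h1.mul (((hp s hs).sub (hq s hs)).pow 2)).congr_deriv ?_
    simp
    ring
  have hmono : MonotoneOn D (Icc 0 τ) := by
    refine monotoneOn_of_hasDerivWithinAt_nonneg (convex_Icc 0 τ)
      (fun s hs => (hder s hs).continuousWithinAt)
      (fun s hs => (hder s (interior_subset hs)).mono interior_subset) (fun s hs => ?_)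
    have hs := interior_subset hs
    have h1 := hv.lip s hs (p s) (q s)
    have h2 : -((p s - q s) * (v s (p s) - v s (q s))) ≤ L * (p s - q s) ^ 2 := by
      refine (neg_le_abs _).trans ?_
      rw [abs_mul, ← sq_abs]
      nlinarith [abs_nonneg (p s - q s)]
    have := Real.exp_pos (2 * L * s)
    apply mul_nonneg <;> linarith
  have h1 := hmono hs (right_mem_Icc.2 hτ) hs.2
  refine abs_le_of_sq_le_sq' ?_ (by positivity) |> abs_le.2
  rw [mul_pow, sq_abs]
  have h2 : (p s - q s) ^ 2 ≤ D s := by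
    have : 1 ≤ Real.exp (2 * L * s) := Real.one_le_exp (by
      have := hv.nonneg; have := hs.1; positivity)
    simp only [hD]
    nlinarith [sq_nonneg (p s - q s)]
  refine (h2.trans h1).trans_eq ?_
  simp only [hD]
  rw [← Real.exp_nat_mul]
  congr 2
  push_cast; ring

/-- The chain rule along a curve. -/
theorem HasUnifTimeDeriv.hasDerivWithinAt_comp {T τ : ℝ} {f g : ℝ → ℝ → ℝ}
    (hfg : HasUnifTimeDeriv T f g) (hτ : τ < T) {q : ℝ → ℝ} {q' s : ℝ} (hs : s ∈ Icc 0 τ)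
    (hq : HasDerivWithinAt q q' (Icc 0 τ) s) (hf : DifferentiableAt ℝ (f s) (q s))
    (hg : ContinuousAt (g s) (q s)) :
    HasDerivWithinAt (fun r => f r (q r)) (g s (q s) + deriv (f s) (q s) * q') (Icc 0 τ) s := by
  have hsub : Icc 0 τ \ {s} ⊆ Ico 0 T \ {s} :=
    sdiff_subset_sdiff_left (fun r hr => ⟨hr.1, hr.2.trans_lt hτ⟩)
  have h1 := hf.hasDerivAt.comp_hasDerivWithinAt s hq
  rw [hasDerivWithinAt_iff_tendsto_slope] at h1 ⊢
  -- The increment is split at (s, q r). Uniformity in space lets the time quotient be taken at the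
  -- moving point `q r`, and continuity of `g s` brings its limit back to `q s`.
  have h2 : Tendsto (fun r => (r - s)⁻¹ * (f r (q r) - f s (q r))) (𝓝[Icc 0 τ \ {s}] s)
      (𝓝 (g s (q s))) := by
    have h3 : Tendsto (fun r => g s (q r)) (𝓝[Icc 0 τ \ {s}] s) (𝓝 (g s (q s))) :=
      (hg.tendsto.comp (hq.continuousWithinAt.mono sdiff_subset))
    have h4 : Tendsto (fun r => (r - s)⁻¹ * (f r (q r) - f s (q r)) - g s (q r))
        (𝓝[Icc 0 τ \ {s}] s) (𝓝 0) := by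
      rw [Metric.tendsto_nhds]
      intro ε hε
      filter_upwards [nhdsWithin_mono _ hsub
        (hfg s ⟨hs.1, hs.2.trans_lt hτ⟩ (ε / 2) (by linarith))] with r hr
      rw [Real.dist_eq, sub_zero]
      linarith [hr (q r)]
    simpa using h4.add h3
  refine (h2.add h1).congr fun r => ?_
  simp only [slope, vsub_eq_sub, smul_eq_mul, Function.comp]
  ring

theorem HasUnifTimeDeriv.hasDerivWithinAt {T : ℝ} {f g : ℝ → ℝ → ℝ}
    (hfg : HasUnifTimeDeriv T f g) {s : ℝ} (hs : s ∈ Ico 0 T) (x : ℝ) :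
    HasDerivWithinAt (fun r => f r x) (g s x) (Ico 0 T) s := by
  rw [hasDerivWithinAt_iff_tendsto_slope, Metric.tendsto_nhds]
  intro ε hε
  filter_upwards [hfg s hs (ε / 2) (by linarith)] with r hr
  rw [Real.dist_eq]
  simp only [slope, vsub_eq_sub, smul_eq_mul]
  linarith [hr x]

/-- The gain is the division by l: relative to e^{lτ}, the contribution of the source becomes small
when l is large. -/
theorem abs_le_of_abs_deriv_le_exp {F F' : ℝ → ℝ} {τ H l : ℝ} (hτ : 0 ≤ τ) (hl : 0 < l)
    (hF : ∀ s ∈ Icc 0 τ, HasDerivWithinAt F (F' s) (Icc 0 τ) s)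
    (hb : ∀ s ∈ Icc 0 τ, |F' s| ≤ H * Real.exp (l * s)) :
    |F τ| ≤ |F 0| + H * Real.exp (l * τ) / l := by
  have hH : 0 ≤ H := by
    have := (abs_nonneg _).trans (hb 0 ⟨le_rfl, hτ⟩)
    simpa using this
  have hB : ∀ s, HasDerivAt (fun s => |F 0| + H * (Real.exp (l * s) - 1) / l)
      (H * Real.exp (l * s)) s := by
    intro s
    have := (((((hasDerivAt_id s).const_mul l).exp.sub_const 1).const_mul H).div_const l).const_add
      |F 0|
    refine this.congr_deriv ?_
    simp
    field_simp
  have h := image_norm_le_of_norm_deriv_right_le_deriv_boundary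
    (fun s hs => (hF s hs).continuousWithinAt)
    (fun s hs => (hF s ⟨hs.1, hs.2.le⟩).mono_of_mem_nhdsWithin (Icc_mem_nhdsGE_of_mem hs))
    (by simp) hB (fun s hs => hb s ⟨hs.1, hs.2.le⟩) (right_mem_Icc.2 hτ)
  refine h.trans ?_
  have : 0 ≤ H / l := by positivity
  have h2 : H * (Real.exp (l * τ) - 1) / l = H * Real.exp (l * τ) / l - H / l := by ring
  simp only [h2]
  linarith

/-- A weight which varies by a factor of at most `C e^{3|x-y|/4}` between `x` and `y`. -/
structure IsModerate (C : ℝ) (φ : ℝ → ℝ) : Prop where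
  pos : ∀ x, 0 < φ x
  le_mul : ∀ x y, φ x ≤ C * Real.exp (3 / 4 * |x - y|) * φ y

theorem IsModerate.one_le {C : ℝ} {φ : ℝ → ℝ} (hφ : IsModerate C φ) : 1 ≤ C := by
  have h1 := hφ.le_mul 0 0
  simp only [sub_self, abs_zero, mul_zero, Real.exp_zero, mul_one] at h1
  nlinarith [hφ.pos 0]

theorem IsModerate.inv_le {C : ℝ} {φ : ℝ → ℝ} (hφ : IsModerate C φ) {x y r : ℝ}
    (hxy : |x - y| ≤ r) : (φ y)⁻¹ ≤ C * Real.exp (3 / 4 * r) / φ x := by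
  rw [inv_eq_one_div, div_le_div_iff₀ (hφ.pos y) (hφ.pos x), one_mul]
  refine (hφ.le_mul x y).trans ?_
  have := hφ.one_le
  have := hφ.pos y
  gcongr

/-- Transport by `v` with source `g` keeps the bound `O(1/φ)`. -/
theorem abs_le_of_transport {T τ L C M H l : ℝ} {v f g : ℝ → ℝ → ℝ} {φ : ℝ → ℝ}
    (hv : IsVelocity L τ v) (hφ : IsModerate C φ) (hτ : 0 ≤ τ) (hτT : τ < T) (hl : 0 < l)
    (hM : 0 ≤ M) (hH : 0 ≤ H)
    (hfg : HasUnifTimeDeriv T f fun t x => g t x - v t x * deriv (f t) x)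
    (hf : ∀ t ∈ Icc 0 τ, ContDiff ℝ 1 (f t)) (hg : ∀ t ∈ Icc 0 τ, Continuous (g t))
    (hf0 : ∀ x, |f 0 x| ≤ M / φ x)
    (hgb : ∀ t ∈ Icc 0 τ, ∀ x, |g t x| ≤ H * Real.exp (l * t) / φ x) (x : ℝ) :
    |f τ x| ≤ C * Real.exp (3 / 4 * (L * τ)) * (M + H * Real.exp (l * τ) / l) / φ x := by
  obtain ⟨q, hqx, hq⟩ := hv.exists_characteristic hτ x
  -- A characteristic ending at x stays within Lτ of x, so D bounds 1/φ along it.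
  set D := C * Real.exp (3 / 4 * (L * τ)) / φ x with hD
  have hφq : ∀ s ∈ Icc 0 τ, (φ (q s))⁻¹ ≤ D := fun s hs =>
    hφ.inv_le (hqx ▸ hq.abs_sub_le hv hs)
  have hF : ∀ s ∈ Icc 0 τ, HasDerivWithinAt (fun r => f r (q r)) (g s (q s)) (Icc 0 τ) s := by
    intro s hs
    have hd : Continuous (deriv (f s)) := (hf s hs).continuous_deriv le_rfl
    refine (hfg.hasDerivWithinAt_comp hτT hs (hq s hs)
      ((hf s hs).differentiable one_ne_zero _) ?_).congr_deriv ?_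
    · exact ((hg s hs).sub ((hv.continuous hs).mul hd)).continuousAt
    · ring
  have h := abs_le_of_abs_deriv_le_exp (H := H * D) hτ hl hF (fun s hs => by
    refine (hgb s hs _).trans ?_
    rw [div_eq_mul_inv]
    calc H * Real.exp (l * s) * (φ (q s))⁻¹ ≤ H * Real.exp (l * s) * D := by
          gcongr; exact hφq s hs
      _ = _ := by ring)
  simp only [hqx] at h
  have h0 : |f 0 (q 0)| ≤ M * D := (hf0 _).trans (by
    rw [div_eq_mul_inv]; gcongr; exact hφq 0 ⟨le_rfl, hτ⟩)
  calc |f τ x| ≤ M * D + H * D * Real.exp (l * τ) / l := h.trans (by gcongr)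
    _ = _ := by rw [hD]; ring

/-- Transport by `v` with a differentiable source `g` keeps the bound `O(1/φ)` of the space
derivative. -/
theorem abs_deriv_le_of_transport {T τ L C M H l : ℝ} {v f g : ℝ → ℝ → ℝ} {φ : ℝ → ℝ}
    (hv : IsVelocity L τ v) (hφ : IsModerate C φ) (hτ : 0 ≤ τ) (hτT : τ < T) (hl : 0 < l)
    (hM : 0 ≤ M) (hH : 0 ≤ H)
    (hfg : HasUnifTimeDeriv T f fun t x => g t x - v t x * deriv (f t) x)
    (hf : ∀ t ∈ Icc 0 τ, ContDiff ℝ 1 (f t)) (hg : ∀ t ∈ Icc 0 τ, Differentiable ℝ (g t))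
    (hf0 : ∀ x, |deriv (f 0) x| ≤ M / φ x)
    (hgb : ∀ t ∈ Icc 0 τ, ∀ x, |deriv (g t) x| ≤ H * Real.exp (l * t) / φ x) (x : ℝ) :
    |deriv (f τ) x| ≤ C * Real.exp (3 / 4 * (L * τ + Real.exp (L * τ))) * Real.exp (L * τ) *
      (M + H * Real.exp (l * τ) / l) / φ x := by
  obtain ⟨q, hqx, hq⟩ := hv.exists_characteristic hτ x
  have hC := hφ.one_le
  have hφx := hφ.pos x
  have hL := hv.nonneg
  -- The endpoints y considered below satisfy |y - x| ≤ 1, so the two characteristics stay within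
  -- e^{Lτ} of each other. Every point between them is within Lτ + e^{Lτ} of x.
  set D := C * Real.exp (3 / 4 * (L * τ + Real.exp (L * τ))) / φ x with hD
  have hD0 : 0 ≤ D := by positivity
  have hF : ∀ p, IsCharacteristic τ v p → ∀ s ∈ Icc 0 τ,
      HasDerivWithinAt (fun r => f r (p r)) (g s (p s)) (Icc 0 τ) s := by
    intro p hp s hs
    have hd : Continuous (deriv (f s)) := (hf s hs).continuous_deriv le_rfl
    refine (hfg.hasDerivWithinAt_comp hτT hs (hp s hs)
      ((hf s hs).differentiable one_ne_zero _) ?_).congr_deriv ?_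
    · exact ((hg s hs).continuous.sub ((hv.continuous hs).mul hd)).continuousAt
    · ring
  -- The space derivative is bounded as a local Lipschitz constant, by comparing f along two nearby
  -- characteristics. This uses only the derivative of g and requires no evolution equation for the
  -- derivative of f.
  refine (hasDerivAt_deriv_iff.2 ((hf τ (right_mem_Icc.2 hτ)).differentiable
    one_ne_zero x)).le_of_lip' (by positivity) ?_
  filter_upwards [Metric.closedBall_mem_nhds x one_pos] with y hy
  rw [Metric.mem_closedBall, Real.dist_eq] at hy
  obtain ⟨p, hpy, hp⟩ := hv.exists_characteristic hτ y
  have hpq : ∀ s ∈ Icc 0 τ, |p s - q s| ≤ Real.exp (L * τ) * |y - x| := fun s hs => by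
    simpa [hqx, hpy] using hp.abs_sub_le_exp hq hv hs
  have hmid : ∀ s ∈ Icc 0 τ, ∀ z ∈ uIcc (q s) (p s), (φ z)⁻¹ ≤ D := by
    intro s hs z hz
    refine hφ.inv_le ?_
    have h1 : |z - q s| ≤ |p s - q s| := abs_sub_left_of_mem_uIcc hz
    have h2 := hqx ▸ hq.abs_sub_le hv hs
    have h3 : |p s - q s| ≤ Real.exp (L * τ) :=
      (hpq s hs).trans (mul_le_of_le_one_right (Real.exp_pos _).le hy)
    have h4 : |x - z| ≤ |x - q s| + |z - q s| := by
      rw [abs_sub_comm z]; exact abs_sub_le _ _ _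
    linarith
  have hmvt : ∀ (h : ℝ → ℝ) (K : ℝ) (s : ℝ), s ∈ Icc 0 τ → Differentiable ℝ h → 0 ≤ K →
      (∀ z, |deriv h z| ≤ K / φ z) →
      |h (p s) - h (q s)| ≤ K * D * (Real.exp (L * τ) * |y - x|) := by
    intro h K s hs hh hK hb
    have := (convex_uIcc (q s) (p s)).norm_image_sub_le_of_norm_deriv_le (f := h) (C := K * D)
      (fun z _ => hh z) (fun z hz => (hb z).trans (by
        rw [div_eq_mul_inv]; gcongr; exact hmid s hs z hz)) left_mem_uIcc right_mem_uIcc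
    refine this.trans ?_
    gcongr
    exact hpq s hs
  have h := abs_le_of_abs_deriv_le_exp (H := H * D * (Real.exp (L * τ) * |y - x|)) hτ hl
    (fun s hs => (hF p hp s hs).sub (hF q hq s hs)) (fun s hs => by
      refine (hmvt (g s) (H * Real.exp (l * s)) s hs (hg s hs) (by positivity)
        (hgb s hs)).trans_eq (by ring))
  have h0 := hmvt (f 0) M 0 ⟨le_rfl, hτ⟩ ((hf 0 ⟨le_rfl, hτ⟩).differentiable one_ne_zero) hM hf0
  simp only [Pi.sub_apply, hqx, hpy] at h
  simp only [Real.norm_eq_abs]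
  calc |f τ y - f τ x| ≤ M * D * (Real.exp (L * τ) * |y - x|)
        + H * D * (Real.exp (L * τ) * |y - x|) * Real.exp (l * τ) / l := h.trans (by gcongr)
    _ = _ := by rw [hD]; ring

/-! ### From strong solutions in Sobolev spaces to classical solutions. -/

theorem eventually_abs_iteratedDeriv_le (k : ℕ) {r : ℝ} (hr : k + 1 / 2 < r) {l : Filter ℝ}
    {F : ℝ → ℝ → ℝ} (hc : ∀ᶠ τ in l, Continuous (F τ))
    (h : Tendsto (fun τ => sobolevENorm r (F τ)) l (𝓝 0)) {ε : ℝ} (hε : 0 < ε) :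
    ∀ᶠ τ in l, ∀ j ≤ k, ∀ x, |iteratedDeriv j (F τ) x| ≤ ε := by
  obtain ⟨C, hC, hCf⟩ := exists_sobolev_embedding k hr
  have h0 : (0 : ℝ≥0∞) < ENNReal.ofReal (ε / (C + 1)) := by
    rw [ENNReal.ofReal_pos]; positivity
  filter_upwards [hc, h.eventually (gt_mem_nhds h0)] with τ hτ hτ' j hj x
  refine ((hCf (F τ) ⟨hτ, hτ'.trans ENNReal.ofReal_lt_top⟩).2 j hj x).trans ?_
  have h1 : (sobolevENorm r (F τ)).toReal ≤ ε / (C + 1) :=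
    ENNReal.toReal_le_of_le_ofReal (by positivity) hτ'.le
  calc C * (sobolevENorm r (F τ)).toReal ≤ C * (ε / (C + 1)) := by gcongr
    _ ≤ ε := by
      rw [mul_div_assoc', div_le_iff₀ (by positivity)]
      nlinarith

theorem MemH.contDiff (k : ℕ) {r : ℝ} (hr : k + 1 / 2 < r) {f : ℝ → ℝ} (hf : MemH r f) :
    ContDiff ℝ k f := by
  obtain ⟨C, hC, hCf⟩ := exists_sobolev_embedding k hr
  exact (hCf f hf).1

theorem ContinuousInH.exists_bound (k : ℕ) {r T : ℝ} (hr : k + 1 / 2 < r) {f : ℝ → ℝ → ℝ}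
    (hf : ContinuousInH r T f) {τ : ℝ} (hτ : τ < T) :
    ∃ L, ∀ t ∈ Icc 0 τ, ∀ j ≤ k, ∀ x, |iteratedDeriv j (f t) x| ≤ L := by
  have hsub : Icc 0 τ ⊆ Ico 0 T := fun r hr => ⟨hr.1, hr.2.trans_lt hτ⟩
  obtain ⟨C, hC, hCf⟩ := exists_sobolev_embedding k hr
  suffices ∃ L, ∀ t ∈ Icc 0 τ, t ∈ Ico 0 T → ∀ j ≤ k, ∀ x, |iteratedDeriv j (f t) x| ≤ L from
    this.imp fun L hL t ht => hL t ht (hsub ht)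
  -- Continuity in H^r gives a bound near each time, and compactness of [0,τ] patches these bounds
  -- together. Membership in [0,T) is part of the property because the induction runs over arbitrary
  -- sets of times.
  refine isCompact_Icc.induction_on (p := fun S => ∃ L, ∀ t ∈ S, t ∈ Ico 0 T → ∀ j ≤ k, ∀ x,
    |iteratedDeriv j (f t) x| ≤ L) ⟨0, by simp⟩ ?_ ?_ ?_
  · exact fun S S' hS ⟨L, hL⟩ => ⟨L, fun t ht => hL t (hS ht)⟩
  · rintro S S' ⟨L, hL⟩ ⟨L', hL'⟩
    refine ⟨max L L', fun t ht h0 j hj x => ?_⟩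
    rcases ht with ht | ht
    · exact (hL t ht h0 j hj x).trans (le_max_left _ _)
    · exact (hL' t ht h0 j hj x).trans (le_max_right _ _)
  · intro t ht
    have ht' := hsub ht
    have hcd : ∀ t ∈ Ico 0 T, ContDiff ℝ k (f t) := fun t ht => (hf.1 t ht).contDiff k hr
    have h1 := eventually_abs_iteratedDeriv_le k hr (l := 𝓝[Ico 0 T] t)
      (F := fun τ => f τ - f t) (by
        filter_upwards [self_mem_nhdsWithin] with r hr
        exact (hf.1 r hr).1.sub (hf.1 t ht').1) (hf.2 t ht') one_pos
    refine ⟨{r | r ∈ Ico 0 T → ∀ j ≤ k, ∀ x, |iteratedDeriv j (f r - f t) x| ≤ 1}, ?_,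
      1 + C * (sobolevENorm r (f t)).toReal, fun r hr h0 j hj x => ?_⟩
    · have h2 : {r | ∀ j ≤ k, ∀ x, |iteratedDeriv j (f r - f t) x| ≤ 1} ∈ 𝓝[Icc 0 τ] t :=
        nhdsWithin_mono _ hsub h1
      filter_upwards [h2] with r hr _ using hr
    · have h2 := hr h0 j hj x
      have hjk : ((j : ℕ) : WithTop ℕ∞) ≤ k := by exact_mod_cast hj
      rw [iteratedDeriv_sub ((hcd r h0).of_le hjk).contDiffAt
        ((hcd t ht').of_le hjk).contDiffAt] at h2
      have h3 := (hCf (f t) (hf.1 t ht')).2 j hj x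
      have h4 := abs_sub_abs_le_abs_sub (iteratedDeriv j (f r) x) (iteratedDeriv j (f t) x)
      linarith

/-- A solution of the two-component Camassa–Holm system on `[0,T)` which is classical, locally
bounded in `C² × C¹`, and along which `u`, `uₓ` and `ρ` have time derivatives that are uniform in
space. -/
structure ClassicalSolution (T : ℝ) (u ρ : ℝ → ℝ → ℝ) : Prop where
  contDiff_u : ∀ t ∈ Ico 0 T, ContDiff ℝ 2 (u t)
  contDiff_ρ : ∀ t ∈ Ico 0 T, ContDiff ℝ 1 (ρ t)
  exists_bound : ∀ τ < T, ∃ L, 0 ≤ L ∧ ∀ t ∈ Icc 0 τ, ∀ x, |u t x| ≤ L ∧ |deriv (u t) x| ≤ L ∧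
    |deriv (deriv (u t)) x| ≤ L ∧ |ρ t x| ≤ L ∧ |deriv (ρ t) x| ≤ L
  time_deriv_u : HasUnifTimeDeriv T u
    fun t x => opP (nonlin (u t) (ρ t)) x - u t x * deriv (u t) x
  time_deriv_ux : HasUnifTimeDeriv T (fun t => deriv (u t))
    fun t x => (u t x ^ 2 - deriv (u t) x ^ 2 / 2 + ρ t x ^ 2 / 2
      - greenConv (nonlin (u t) (ρ t)) x) - u t x * deriv (deriv (u t)) x
  time_deriv_ρ : HasUnifTimeDeriv T ρ
    fun t x => -(ρ t x * deriv (u t) x) - u t x * deriv (ρ t) x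

theorem contDiff_deriv {f : ℝ → ℝ} (hf : ContDiff ℝ 2 f) : ContDiff ℝ 1 (deriv f) := by
  rw [← one_add_one_eq_two] at hf
  exact hf.deriv'

theorem continuous_nonlin {u ρ : ℝ → ℝ} (hu : ContDiff ℝ 1 u) (hρ : Continuous ρ) :
    Continuous (nonlin u ρ) := by
  have h1 := hu.continuous
  have h2 := hu.continuous_deriv le_rfl
  unfold nonlin
  fun_prop

theorem nonlin_nonneg (u ρ : ℝ → ℝ) (x : ℝ) : 0 ≤ nonlin u ρ x := by
  unfold nonlin; positivity

theorem nonlin_le {u ρ : ℝ → ℝ} {L x : ℝ} (hu : |u x| ≤ L) (hux : |deriv u x| ≤ L)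
    (hρ : |ρ x| ≤ L) : nonlin u ρ x ≤ 2 * L ^ 2 := by
  have h1 := sq_le_sq' (abs_le.1 hu).1 (abs_le.1 hu).2
  have h2 := sq_le_sq' (abs_le.1 hux).1 (abs_le.1 hux).2
  have h3 := sq_le_sq' (abs_le.1 hρ).1 (abs_le.1 hρ).2
  unfold nonlin
  linarith

theorem abs_nonlin_le {u ρ : ℝ → ℝ} {L x : ℝ} (hu : |u x| ≤ L) (hux : |deriv u x| ≤ L)
    (hρ : |ρ x| ≤ L) : |nonlin u ρ x| ≤ 2 * L ^ 2 := by
  rw [abs_of_nonneg (nonlin_nonneg u ρ x)]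
  exact nonlin_le hu hux hρ

/-- The embedding puts u in C², ρ and uₜ in C¹, and makes the time quotients of u converge in C¹ and
those of ρ uniformly. The equation for uₓ therefore results from differentiating uₜ = P F - u uₓ in
space. -/
theorem IsStrongSolution.classicalSolution {s T : ℝ} (hs : 3 < s) {u₀ ρ₀ : ℝ → ℝ}
    {u ρ : ℝ → ℝ → ℝ} (h : IsStrongSolution s T u₀ ρ₀ u ρ) : ClassicalSolution T u ρ := by
  obtain ⟨ut, ρt, hut, hρt, hdu, hdρ, heq⟩ := h.exists_deriv
  have hcu : ∀ t ∈ Ico 0 T, ContDiff ℝ 2 (u t) := fun t ht =>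
    (h.cont_u.1 t ht).contDiff 2 (by push_cast; linarith)
  have hcρ : ∀ t ∈ Ico 0 T, ContDiff ℝ 1 (ρ t) := fun t ht =>
    (h.cont_ρ.1 t ht).contDiff 1 (by push_cast; linarith)
  have hcut : ∀ t ∈ Ico 0 T, ContDiff ℝ 1 (ut t) := fun t ht =>
    (hut.1 t ht).contDiff 1 (by push_cast; linarith)
  have hbound : ∀ τ < T, ∃ L, 0 ≤ L ∧ ∀ t ∈ Icc 0 τ, ∀ x, |u t x| ≤ L ∧ |deriv (u t) x| ≤ L ∧
      |deriv (deriv (u t)) x| ≤ L ∧ |ρ t x| ≤ L ∧ |deriv (ρ t) x| ≤ L := by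
    intro τ hτ
    obtain ⟨L, hL⟩ := h.cont_u.exists_bound 2 (by push_cast; linarith) hτ
    obtain ⟨L', hL'⟩ := h.cont_ρ.exists_bound 1 (by push_cast; linarith) hτ
    refine ⟨max 0 (max L L'), le_max_left _ _, fun t ht x => ?_⟩
    have e0 := hL t ht 0 (by norm_num) x
    have e1 := hL t ht 1 (by norm_num) x
    have e2 := hL t ht 2 (by norm_num) x
    have e3 := hL' t ht 0 (by norm_num) x
    have e4 := hL' t ht 1 (by norm_num) x
    rw [iteratedDeriv_succ, iteratedDeriv_one] at e2
    rw [iteratedDeriv_zero] at e0 e3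
    rw [iteratedDeriv_one] at e1 e4
    simp only [le_max_iff]
    tauto
  have hut_eq : ∀ t ∈ Ico 0 T,
      ut t = fun x => opP (nonlin (u t) (ρ t)) x - u t x * deriv (u t) x := fun t ht => by
    ext x
    linarith [(heq t ht x).1]
  have hdut : ∀ t ∈ Ico 0 T, ∀ x, deriv (ut t) x =
      (u t x ^ 2 - deriv (u t) x ^ 2 / 2 + ρ t x ^ 2 / 2
        - greenConv (nonlin (u t) (ρ t)) x) - u t x * deriv (deriv (u t)) x := by
    intro t ht x
    obtain ⟨L, -, hL⟩ := hbound t ht.2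
    have hL := hL t ⟨ht.1, le_rfl⟩
    have h1 := hasDerivAt_opP (continuous_nonlin ((hcu t ht).of_le one_le_two)
      (hcρ t ht).continuous)
      (fun x => abs_nonlin_le (hL x).1 (hL x).2.1 (hL x).2.2.2.1) x
    have h2 : HasDerivAt (u t) (deriv (u t) x) x :=
      ((hcu t ht).differentiable two_ne_zero x).hasDerivAt
    have h3 : HasDerivAt (deriv (u t)) (deriv (deriv (u t)) x) x :=
      ((contDiff_deriv (hcu t ht)).differentiable one_ne_zero x).hasDerivAt
    rw [hut_eq t ht]
    refine (h1.sub (h2.mul h3)).deriv.trans ?_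
    unfold nonlin
    ring
  have key : ∀ t ∈ Ico 0 T, ∀ ε > 0, ∀ᶠ τ in 𝓝[Ico 0 T \ {t}] t, ∀ j ≤ 1, ∀ x,
      |iteratedDeriv j ((τ - t)⁻¹ • (u τ - u t) - ut t) x| ≤ ε := fun t ht ε hε => by
    refine eventually_abs_iteratedDeriv_le 1 (by push_cast; linarith) ?_ (hdu t ht) hε
    filter_upwards [self_mem_nhdsWithin] with r hr
    exact ((((hcu r hr.1).continuous).sub (hcu t ht).continuous).const_smul _).sub
      (hcut t ht).continuous
  refine ⟨hcu, hcρ, hbound, fun t ht ε hε => ?_, fun t ht ε hε => ?_, fun t ht ε hε => ?_⟩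
  · filter_upwards [key t ht ε hε] with r hr x
    have := hr 0 (by norm_num) x
    rw [iteratedDeriv_zero] at this
    simpa [hut_eq t ht] using this
  · filter_upwards [key t ht ε hε, self_mem_nhdsWithin] with r hr hrT x
    have := hr 1 le_rfl x
    have d1 : HasDerivAt (u t) (deriv (u t) x) x :=
      ((hcu t ht).differentiable two_ne_zero x).hasDerivAt
    have d2 : HasDerivAt (u r) (deriv (u r) x) x :=
      ((hcu r hrT.1).differentiable two_ne_zero x).hasDerivAt
    have d3 : HasDerivAt (ut t) (deriv (ut t) x) x :=
      ((hcut t ht).differentiable one_ne_zero x).hasDerivAt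
    rw [iteratedDeriv_one, (((d2.sub d1).const_smul (r - t)⁻¹).sub d3).deriv, hdut t ht x] at this
    simpa using this
  · have hρt_eq : ρt t = fun x => -(ρ t x * deriv (u t) x) - u t x * deriv (ρ t) x := by
      ext x
      linarith [(heq t ht x).2]
    filter_upwards [eventually_abs_iteratedDeriv_le 0 (by push_cast; linarith)
      (by
        filter_upwards [self_mem_nhdsWithin] with r hr
        exact ((((hcρ r hr.1).continuous).sub (hcρ t ht).continuous).const_smul _).sub
          (hρt.1 t ht).1) (hdρ t ht) hε] with r hr x
    have := hr 0 le_rfl x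
    rw [iteratedDeriv_zero] at this
    simpa [hρt_eq] using this

/-! ### Propagation of weighted bounds. -/

/-- `|u| + |uₓ| + |uₓₓ| + |ρ| + |ρₓ|` at the point `x`. -/
def jetSize (u ρ : ℝ → ℝ) (x : ℝ) : ℝ :=
  |u x| + |deriv u x| + |deriv (deriv u) x| + |ρ x| + |deriv ρ x|

theorem jetSize_nonneg (u ρ : ℝ → ℝ) (x : ℝ) : 0 ≤ jetSize u ρ x := by
  unfold jetSize; positivity

/-- One factor of each square is absorbed into the a priori bound L. This makes the quadratic source
linear in the quantity to be estimated. -/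
theorem nonlin_le_jetSize {u ρ : ℝ → ℝ} {L x : ℝ} (hu : |u x| ≤ L) (hux : |deriv u x| ≤ L)
    (hρ : |ρ x| ≤ L) : nonlin u ρ x ≤ L * jetSize u ρ x := by
  unfold nonlin jetSize
  rw [← sq_abs (u x), ← sq_abs (deriv u x), ← sq_abs (ρ x)]
  have hL : 0 ≤ L := (abs_nonneg _).trans hu
  nlinarith [abs_nonneg (u x), abs_nonneg (deriv u x), abs_nonneg (ρ x),
    mul_nonneg hL (abs_nonneg (deriv (deriv u) x)), mul_nonneg hL (abs_nonneg (deriv ρ x))]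

theorem ClassicalSolution.hasDerivAt_u {T : ℝ} {u ρ : ℝ → ℝ → ℝ} (h : ClassicalSolution T u ρ)
    {t : ℝ} (ht : t ∈ Ico 0 T) (x : ℝ) : HasDerivAt (u t) (deriv (u t) x) x :=
  ((h.contDiff_u t ht).differentiable two_ne_zero x).hasDerivAt

theorem ClassicalSolution.hasDerivAt_ux {T : ℝ} {u ρ : ℝ → ℝ → ℝ} (h : ClassicalSolution T u ρ)
    {t : ℝ} (ht : t ∈ Ico 0 T) (x : ℝ) :
    HasDerivAt (deriv (u t)) (deriv (deriv (u t)) x) x :=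
  ((contDiff_deriv (h.contDiff_u t ht)).differentiable one_ne_zero x).hasDerivAt

theorem ClassicalSolution.hasDerivAt_ρ {T : ℝ} {u ρ : ℝ → ℝ → ℝ} (h : ClassicalSolution T u ρ)
    {t : ℝ} (ht : t ∈ Ico 0 T) (x : ℝ) : HasDerivAt (ρ t) (deriv (ρ t) x) x :=
  ((h.contDiff_ρ t ht).differentiable one_ne_zero x).hasDerivAt

theorem ClassicalSolution.continuous_nonlin {T : ℝ} {u ρ : ℝ → ℝ → ℝ}
    (h : ClassicalSolution T u ρ) {t : ℝ} (ht : t ∈ Ico 0 T) :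
    Continuous (nonlin (u t) (ρ t)) :=
  TwoCH.continuous_nonlin ((h.contDiff_u t ht).of_le one_le_two) (h.contDiff_ρ t ht).continuous

theorem ClassicalSolution.isVelocity {T τ L : ℝ} {u ρ : ℝ → ℝ → ℝ}
    (h : ClassicalSolution T u ρ) (hτ : τ < T) (hL0 : 0 ≤ L)
    (hL : ∀ t ∈ Icc 0 τ, ∀ x, |u t x| ≤ L ∧ |deriv (u t) x| ≤ L) : IsVelocity L τ u where
  nonneg := hL0
  bound t ht x := (hL t ht x).1
  lip t ht x y := by
    have ht' : t ∈ Ico 0 T := ⟨ht.1, ht.2.trans_lt hτ⟩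
    exact convex_univ.norm_image_sub_le_of_norm_deriv_le (f := u t)
      (fun x _ => (h.hasDerivAt_u ht' x).differentiableAt) (fun x _ => (hL t ht x).2)
      (mem_univ y) (mem_univ x)
  cont x := fun t ht =>
    ((h.time_deriv_u.hasDerivWithinAt ⟨ht.1, ht.2.trans_lt hτ⟩ x).continuousWithinAt).mono
      fun r hr => ⟨hr.1, hr.2.trans_lt hτ⟩

/-- A weighted bound of the solution which is exponential in time improves itself. -/
theorem ClassicalSolution.jetSize_le_of_jetSize_le {T τ L C K M l : ℝ} {u ρ : ℝ → ℝ → ℝ}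
    {φ : ℝ → ℝ} (h : ClassicalSolution T u ρ) (hτ0 : 0 ≤ τ) (hτ : τ < T) (hL0 : 0 ≤ L)
    (hL : ∀ t ∈ Icc 0 τ, ∀ x, |u t x| ≤ L ∧ |deriv (u t) x| ≤ L ∧
      |deriv (deriv (u t)) x| ≤ L ∧ |ρ t x| ≤ L ∧ |deriv (ρ t) x| ≤ L)
    (hφ : IsModerate C φ) (hl : 0 < l) (hK : 0 ≤ K) (hM : 0 ≤ M)
    (h0 : ∀ x, jetSize (u 0) (ρ 0) x ≤ K / φ x)
    (hb : ∀ t ∈ Icc 0 τ, ∀ x, jetSize (u t) (ρ t) x ≤ M * Real.exp (l * t) / φ x) (x : ℝ) :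
    jetSize (u τ) (ρ τ) x ≤ 5 * (C * Real.exp (3 / 4 * (L * τ + Real.exp (L * τ))) *
      Real.exp (L * τ) * (K + (2 * L + 4 * C * L) * M * Real.exp (l * τ) / l) / φ x) := by
  have hT : ∀ t ∈ Icc 0 τ, t ∈ Ico 0 T := fun t ht => ⟨ht.1, ht.2.trans_lt hτ⟩
  have hv : IsVelocity L τ u := h.isVelocity hτ hL0 fun t ht x => ⟨(hL t ht x).1, (hL t ht x).2.1⟩
  have hC := hφ.one_le
  -- 2L accounts for the products of jet entries, and 4CL for the terms G * F and P F, through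
  -- `greenConv_le_div`.
  set B := 2 * L + 4 * C * L with hB
  have hB0 : 0 ≤ B := by positivity
  have hH : 0 ≤ B * M := by positivity
  have hφ0 := hφ.pos
  -- bounds for the source terms
  have hFc : ∀ t ∈ Icc 0 τ, Continuous (nonlin (u t) (ρ t)) := fun t ht =>
    h.continuous_nonlin (hT t ht)
  have hFL : ∀ t ∈ Icc 0 τ, ∀ x, |nonlin (u t) (ρ t) x| ≤ 2 * L ^ 2 := fun t ht x =>
    abs_nonlin_le (hL t ht x).1 (hL t ht x).2.1 (hL t ht x).2.2.2.1
  have hFb : ∀ t ∈ Icc 0 τ, ∀ x,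
      |nonlin (u t) (ρ t) x| ≤ (L * (M * Real.exp (l * t))) / φ x := fun t ht x => by
    rw [abs_of_nonneg (nonlin_nonneg _ _ _), mul_div_assoc]
    exact (nonlin_le_jetSize (hL t ht x).1 (hL t ht x).2.1 (hL t ht x).2.2.2.1).trans
      (mul_le_mul_of_nonneg_left (hb t ht x) hL0)
  have hGb : ∀ t ∈ Icc 0 τ, ∀ x, greenConv (fun y => |nonlin (u t) (ρ t) y|) x ≤
      4 * C * L * (M * Real.exp (l * t) / φ x) := fun t ht x => by
    refine (greenConv_le_div hφ.pos (by positivity) hφ.le_mul (hFb t ht) x).trans_eq ?_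
    ring
  have hPb : ∀ t ∈ Icc 0 τ, ∀ x, |opP (nonlin (u t) (ρ t)) x| ≤
      4 * C * L * (M * Real.exp (l * t) / φ x) := fun t ht x =>
    (abs_opP_le (hFc t ht) (hFL t ht) x).trans (hGb t ht x)
  have hQb : ∀ t ∈ Icc 0 τ, ∀ x, |greenConv (nonlin (u t) (ρ t)) x| ≤
      4 * C * L * (M * Real.exp (l * t) / φ x) := fun t ht x =>
    (abs_greenConv_le _ x).trans (hGb t ht x)
  have hsum : ∀ t ∈ Icc 0 τ, ∀ x a, |a| ≤ 2 * L * jetSize (u t) (ρ t) x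
      + 4 * C * L * (M * Real.exp (l * t) / φ x) →
      |a| ≤ B * M * Real.exp (l * t) / φ x := fun t ht x a ha => by
    refine ha.trans ?_
    have := mul_le_mul_of_nonneg_left (hb t ht x) (by positivity : 0 ≤ 2 * L)
    calc _ ≤ 2 * L * (M * Real.exp (l * t) / φ x) + 4 * C * L * (M * Real.exp (l * t) / φ x) := by
          linarith
      _ = _ := by rw [hB]; ring
  have hpos4 : ∀ t x, 0 ≤ 4 * C * L * (M * Real.exp (l * t) / φ x) := fun t x => by
    have := hφ0 x; positivity
  have hprod : ∀ a b : ℝ, |a| ≤ L → |a * b| ≤ L * |b| := fun a b ha => by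
    rw [abs_mul]; exact mul_le_mul_of_nonneg_right ha (abs_nonneg b)
  have hS : ∀ t x, L * jetSize (u t) (ρ t) x = L * |u t x| + L * |deriv (u t) x|
      + L * |deriv (deriv (u t)) x| + L * |ρ t x| + L * |deriv (ρ t) x| := fun t x => by
    unfold jetSize; ring
  have hLn : ∀ a : ℝ, 0 ≤ L * |a| := fun a => by positivity
  -- the derivatives of the source terms
  have hd2 : ∀ t ∈ Icc 0 τ, ∀ x, HasDerivAt
      (fun x => u t x ^ 2 - deriv (u t) x ^ 2 / 2 + ρ t x ^ 2 / 2
        - greenConv (nonlin (u t) (ρ t)) x)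
      (2 * (u t x * deriv (u t) x) - deriv (u t) x * deriv (deriv (u t)) x
        + ρ t x * deriv (ρ t) x + opP (nonlin (u t) (ρ t)) x) x := fun t ht x => by
    refine (((((h.hasDerivAt_u (hT t ht) x).pow 2).sub
      (((h.hasDerivAt_ux (hT t ht) x).pow 2).div_const 2)).add
      (((h.hasDerivAt_ρ (hT t ht) x).pow 2).div_const 2)).sub
      (hasDerivAt_greenConv' (hFc t ht) (hFL t ht) x)).congr_deriv ?_
    simp
    ring
  have hd3 : ∀ t ∈ Icc 0 τ, ∀ x, HasDerivAt (fun x => -(ρ t x * deriv (u t) x))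
      (-(deriv (ρ t) x * deriv (u t) x + ρ t x * deriv (deriv (u t)) x)) x := fun t ht x =>
    ((h.hasDerivAt_ρ (hT t ht) x).mul (h.hasDerivAt_ux (hT t ht) x)).neg
  -- the five bounds
  have hcu : ∀ t ∈ Icc 0 τ, ContDiff ℝ 1 (u t) := fun t ht =>
    (h.contDiff_u t (hT t ht)).of_le one_le_two
  have hcux : ∀ t ∈ Icc 0 τ, ContDiff ℝ 1 (deriv (u t)) := fun t ht =>
    contDiff_deriv (h.contDiff_u t (hT t ht))
  have hcρ : ∀ t ∈ Icc 0 τ, ContDiff ℝ 1 (ρ t) := fun t ht => h.contDiff_ρ t (hT t ht)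
  have hj : ∀ x, |u 0 x| ≤ K / φ x ∧ |deriv (u 0) x| ≤ K / φ x ∧
      |deriv (deriv (u 0)) x| ≤ K / φ x ∧ |ρ 0 x| ≤ K / φ x ∧ |deriv (ρ 0) x| ≤ K / φ x := by
    intro x
    have := h0 x
    unfold jetSize at this
    refine ⟨?_, ?_, ?_, ?_, ?_⟩ <;>
    linarith [abs_nonneg (u 0 x), abs_nonneg (deriv (u 0) x),
      abs_nonneg (deriv (deriv (u 0)) x), abs_nonneg (ρ 0 x), abs_nonneg (deriv (ρ 0) x)]
  have hExp : C * Real.exp (3 / 4 * (L * τ)) * (K + B * M * Real.exp (l * τ) / l) / φ x ≤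
      C * Real.exp (3 / 4 * (L * τ + Real.exp (L * τ))) *
      Real.exp (L * τ) * (K + B * M * Real.exp (l * τ) / l) / φ x := by
    have := hφ0 x
    gcongr ?_ * _ / _
    have h1 : 1 ≤ Real.exp (L * τ) := Real.one_le_exp (by positivity)
    refine le_trans ?_ (le_mul_of_one_le_right (by positivity) h1)
    gcongr
    exact le_add_of_nonneg_right (Real.exp_pos _).le
  have b1 := (abs_le_of_transport hv hφ hτ0 hτ hl hK hH h.time_deriv_u hcu
    (fun t ht => continuous_iff_continuousAt.2 fun x =>
      (hasDerivAt_opP (hFc t ht) (hFL t ht) x).continuousAt)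
    (fun x => (hj x).1) (fun t ht x => hsum t ht x _ (by
      have := hPb t ht x
      have := hS t x
      have := mul_nonneg hL0 (jetSize_nonneg (u t) (ρ t) x)
      linarith)) x).trans hExp
  have b2 := (abs_le_of_transport hv hφ hτ0 hτ hl hK hH h.time_deriv_ux hcux
    (fun t ht => continuous_iff_continuousAt.2 fun x => (hd2 t ht x).continuousAt)
    (fun x => (hj x).2.1) (fun t ht x => hsum t ht x _ (by
      have e1 := hQb t ht x
      have e2 := hS t x
      have e3 := hprod _ (u t x) (hL t ht x).1
      have e4 := hprod _ (deriv (u t) x) (hL t ht x).2.1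
      have e5 := hprod _ (ρ t x) (hL t ht x).2.2.2.1
      rw [abs_le] at e1 e3 e4 e5 ⊢
      have := hLn (deriv (deriv (u t)) x)
      have := hLn (deriv (ρ t) x)
      constructor <;> nlinarith)) x).trans hExp
  -- uₓₓ is controlled as the space derivative of the transported quantity uₓ. By ∂ₓ(G * F) = -P F,
  -- the differentiated source `hd2` involves no derivative beyond uₓₓ and ρₓ.
  have b3 := abs_deriv_le_of_transport hv hφ hτ0 hτ hl hK hH h.time_deriv_ux hcux
    (fun t ht x => (hd2 t ht x).differentiableAt)
    (fun x => (hj x).2.2.1) (fun t ht x => hsum t ht x _ (by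
      rw [(hd2 t ht x).deriv]
      have e1 := hPb t ht x
      have e2 := hS t x
      have e3 := hprod _ (deriv (u t) x) (hL t ht x).1
      have e4 := hprod _ (deriv (deriv (u t)) x) (hL t ht x).2.1
      have e5 := hprod _ (deriv (ρ t) x) (hL t ht x).2.2.2.1
      rw [abs_le] at e1 e3 e4 e5 ⊢
      have := hLn (u t x)
      have := hLn (ρ t x)
      have := hLn (deriv (deriv (u t)) x)
      have := hLn (deriv (ρ t) x)
      constructor <;> nlinarith)) x
  have b4 := (abs_le_of_transport hv hφ hτ0 hτ hl hK hH h.time_deriv_ρ hcρ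
    (fun t ht => continuous_iff_continuousAt.2 fun x => (hd3 t ht x).continuousAt)
    (fun x => (hj x).2.2.2.1) (fun t ht x => hsum t ht x _ (by
      have e1 := hpos4 t x
      have e2 := hS t x
      have e3 := hprod _ (deriv (u t) x) (hL t ht x).2.2.2.1
      rw [abs_neg]
      have := hLn (u t x)
      have := hLn (ρ t x)
      have := hLn (deriv (u t) x)
      have := hLn (deriv (deriv (u t)) x)
      have := hLn (deriv (ρ t) x)
      linarith)) x).trans hExp
  have b5 := abs_deriv_le_of_transport hv hφ hτ0 hτ hl hK hH h.time_deriv_ρ hcρ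
    (fun t ht x => (hd3 t ht x).differentiableAt)
    (fun x => (hj x).2.2.2.2) (fun t ht x => hsum t ht x _ (by
      rw [(hd3 t ht x).deriv, abs_neg]
      have e1 := hpos4 t x
      have e2 := hS t x
      have e3 := hprod _ (deriv (ρ t) x) (hL t ht x).2.1
      have e4 := hprod _ (deriv (deriv (u t)) x) (hL t ht x).2.2.2.1
      rw [mul_comm] at e3
      refine (abs_add_le _ _).trans ?_
      have := hLn (u t x)
      have := hLn (ρ t x)
      have := hLn (deriv (u t) x)
      have := hLn (deriv (deriv (u t)) x)
      have := hLn (deriv (ρ t) x)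
      linarith)) x
  unfold jetSize
  linarith

/-- Weighted bounds are propagated by the solution, with a constant that depends on the weight
only through its modulus of variation. -/
theorem ClassicalSolution.exists_jetSize_bound {T τ : ℝ} {u ρ : ℝ → ℝ → ℝ}
    (h : ClassicalSolution T u ρ) (hτ : τ ∈ Ico 0 T) (C K : ℝ) :
    ∃ K', ∀ φ : ℝ → ℝ, IsModerate C φ → (∃ N, ∀ x, φ x ≤ N) →
      (∀ x, φ x * jetSize (u 0) (ρ 0) x ≤ K) →
      ∀ t ∈ Icc 0 τ, ∀ x, φ x * jetSize (u t) (ρ t) x ≤ K' := by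
  obtain ⟨L, hL0, hL⟩ := h.exists_bound τ hτ.2
  set E := C * Real.exp (3 / 4 * (L * τ + Real.exp (L * τ))) * Real.exp (L * τ) with hE
  set B := 2 * L + 4 * C * L with hB
  -- This choice gives 5EB/l ≤ 1/2, so that `step` replaces a constant M by 5EK + M/2, whose fixed
  -- point is 10EK.
  set l := 10 * E * B + 1 with hl
  refine ⟨10 * E * K * Real.exp (l * τ), fun φ hφ ⟨N, hN⟩ h0 => ?_⟩
  have hφ0 := hφ.pos
  have hC := hφ.one_le
  have hK : 0 ≤ K := (mul_nonneg (hφ0 0).le (jetSize_nonneg _ _ _)).trans (h0 0)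
  have hτ0 := hτ.1
  have hE0 : 0 < E := by positivity
  have hB0 : 0 ≤ B := by positivity
  have hl0 : 0 < l := by positivity
  have hN0 : 0 ≤ N := (hφ0 0).le.trans (hN 0)
  have h0' : ∀ x, jetSize (u 0) (ρ 0) x ≤ K / φ x := fun x => by
    rw [le_div_iff₀ (hφ0 x), mul_comm]; exact h0 x
  have step : ∀ M, 0 ≤ M →
      (∀ t ∈ Icc 0 τ, ∀ x, jetSize (u t) (ρ t) x ≤ M * Real.exp (l * t) / φ x) →
      ∀ t ∈ Icc 0 τ, ∀ x,
        jetSize (u t) (ρ t) x ≤ (5 * E * K + M / 2) * Real.exp (l * t) / φ x := by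
    intro M hM hb t ht x
    have hsub : Icc 0 t ⊆ Icc 0 τ := Icc_subset_Icc_right ht.2
    have ht0 := ht.1
    have hφx := hφ0 x
    refine (h.jetSize_le_of_jetSize_le ht.1 (ht.2.trans_lt hτ.2) hL0
      (fun r hr => hL r (hsub hr)) hφ hl0 hK hM h0' (fun r hr => hb r (hsub hr)) x).trans ?_
    rw [← mul_div_assoc]
    gcongr ?_ / _
    have h1 : 1 ≤ Real.exp (l * t) := Real.one_le_exp (by positivity)
    have h2 : C * Real.exp (3 / 4 * (L * t + Real.exp (L * t))) * Real.exp (L * t) ≤ E := by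
      rw [hE]; gcongr <;> exact ht.2
    calc _ ≤ 5 * (E * (K * Real.exp (l * t) + B * M * Real.exp (l * t) / l)) := by
          gcongr
          exact le_mul_of_one_le_right hK h1
      _ = (5 * E * K + (5 * E * B / l) * M) * Real.exp (l * t) := by ring
      _ ≤ _ := by
          gcongr
          have : 5 * E * B / l ≤ 1 / 2 := by
            rw [div_le_div_iff₀ hl0 two_pos]; linarith
          nlinarith
  -- The iteration starts from the crude bound 5LN, the only place where the bound N of the weight
  -- enters. Its contribution disappears in the limit.
  have iter : ∀ n : ℕ, ∀ t ∈ Icc 0 τ, ∀ x, jetSize (u t) (ρ t) x ≤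
      (10 * E * K + 5 * L * N / 2 ^ n) * Real.exp (l * t) / φ x := by
    intro n
    induction n with
    | zero =>
      intro t ht x
      obtain ⟨a1, a2, a3, a4, a5⟩ := hL t ht x
      have h1 : jetSize (u t) (ρ t) x ≤ 5 * L := by unfold jetSize; linarith
      have h2 : 1 ≤ Real.exp (l * t) := Real.one_le_exp (by have := ht.1; positivity)
      rw [le_div_iff₀ (hφ0 x)]
      calc jetSize (u t) (ρ t) x * φ x ≤ 5 * L * N :=
            mul_le_mul h1 (hN x) (hφ0 x).le (by positivity)
        _ ≤ (10 * E * K + 5 * L * N / 2 ^ 0) * 1 := by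
            have : 0 ≤ 10 * E * K := by positivity
            simpa
        _ ≤ _ := by gcongr
    | succ n ih =>
      intro t ht x
      refine (step _ (by positivity) ih t ht x).trans_eq ?_
      rw [pow_succ]
      ring
  intro t ht x
  have hlim : Tendsto (fun n : ℕ => (10 * E * K + 5 * L * N / 2 ^ n) * Real.exp (l * t) / φ x)
      atTop (𝓝 ((10 * E * K + 0) * Real.exp (l * t) / φ x)) :=
    (((tendsto_const_nhds.div_atTop (tendsto_pow_atTop_atTop_of_one_lt one_lt_two)).const_add
      _).mul_const _).div_const _
  have h1 := ge_of_tendsto' hlim fun n => iter n t ht x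
  rw [add_zero, le_div_iff₀ (hφ0 x), mul_comm] at h1
  refine h1.trans ?_
  gcongr
  exact ht.2

/-- Persistence for unbounded weights. -/
theorem ClassicalSolution.exists_jetSize_bound_of_isModerate {T τ C : ℝ} {u ρ : ℝ → ℝ → ℝ}
    (h : ClassicalSolution T u ρ) (hτ : τ ∈ Ico 0 T) {ψ : ℝ → ℝ} (hψ : IsModerate C ψ)
    (h0 : ∃ K, ∀ x, ψ x * jetSize (u 0) (ρ 0) x ≤ K) :
    ∃ K, ∀ t ∈ Icc 0 τ, ∀ x, ψ x * jetSize (u t) (ρ t) x ≤ K := by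
  obtain ⟨K, hK⟩ := h0
  obtain ⟨K', hK'⟩ := h.exists_jetSize_bound hτ C K
  refine ⟨K', fun t ht x => ?_⟩
  have hpos := hψ.pos
  have hC := hψ.one_le
  -- The weight is truncated at the level ψ(x). The truncation is bounded, moderate with the same C,
  -- and equal to ψ at x, while K' does not depend on it.
  have := hK' (fun y => min (ψ y) (ψ x)) ⟨fun y => lt_min (hpos y) (hpos x), fun y z => ?_⟩
    ⟨ψ x, fun y => min_le_right _ _⟩
    (fun y => (mul_le_mul_of_nonneg_right (min_le_left _ _) (jetSize_nonneg _ _ _)).trans (hK y))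
    t ht x
  · simpa using this
  · have h1 : 1 ≤ C * Real.exp (3 / 4 * |y - z|) :=
      one_le_mul_of_one_le_of_one_le hC (Real.one_le_exp (by positivity))
    rw [mul_min_of_nonneg _ _ (by positivity)]
    exact min_le_min (hψ.le_mul y z) (le_mul_of_one_le_left (hpos x).le h1)

/-! ### The weight ψ is moderate, and e^{|x|}/ψ² is integrable. -/

/-- A moderate weight `ψ ≥ 1` for which `e^{|x|}/ψ(x)²` is integrable and tends to `0` at `∞`. -/
structure IsDecayWeight (C : ℝ) (ψ : ℝ → ℝ) : Prop extends IsModerate C ψ where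
  one_le_weight : ∀ x, 1 ≤ ψ x
  integrable : Integrable fun x => Real.exp |x| / ψ x ^ 2
  tendsto_zero : Tendsto (fun x => Real.exp |x| / ψ x ^ 2) atTop (𝓝 0)

theorem one_le_log_exp_one_add (x : ℝ) : 1 ≤ Real.log (Real.exp 1 + |x|) := by
  rw [Real.le_log_iff_exp_le (by positivity)]
  exact le_add_of_nonneg_right (abs_nonneg x)

theorem psi_neg (d x : ℝ) : psi d (-x) = psi d x := by simp [psi]

theorem one_le_psi {d : ℝ} (hd : 0 < d) (x : ℝ) : 1 ≤ psi d x := by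
  have h1 : 1 ≤ Real.exp (|x| / 2) := Real.one_le_exp (by positivity)
  have h2 : 1 ≤ (1 + |x|) ^ (1 / 2 : ℝ) := Real.one_le_rpow (by simp) (by norm_num)
  have h3 : 1 ≤ Real.log (Real.exp 1 + |x|) ^ d :=
    Real.one_le_rpow (one_le_log_exp_one_add x) hd.le
  exact one_le_mul_of_one_le_of_one_le (one_le_mul_of_one_le_of_one_le h1 h2) h3

theorem log_exp_one_add_le (x y : ℝ) :
    Real.log (Real.exp 1 + |x|) ≤ (1 + |x - y|) * Real.log (Real.exp 1 + |y|) := by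
  have hy := one_le_log_exp_one_add y
  have he : 1 ≤ Real.exp 1 := Real.one_le_exp zero_le_one
  have h1 : Real.exp 1 + |x| ≤ (Real.exp 1 + |y|) * (1 + |x - y|) := by
    have : |x| ≤ |x - y| + |y| := by simpa using abs_add_le (x - y) y
    nlinarith [abs_nonneg y, abs_nonneg (x - y),
      mul_nonneg (abs_nonneg y) (abs_nonneg (x - y))]
  calc Real.log (Real.exp 1 + |x|)
      ≤ Real.log ((Real.exp 1 + |y|) * (1 + |x - y|)) := Real.log_le_log (by positivity) h1
    _ = Real.log (Real.exp 1 + |y|) + Real.log (1 + |x - y|) :=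
        Real.log_mul (by positivity) (by positivity)
    _ ≤ Real.log (Real.exp 1 + |y|) + |x - y| := by
        have := Real.log_le_sub_one_of_pos (by positivity : 0 < 1 + |x - y|)
        linarith
    _ ≤ _ := by nlinarith [abs_nonneg (x - y)]

theorem exists_isModerate_psi {d : ℝ} (hd : 0 < d) : ∃ C, IsModerate C (psi d) := by
  set p := 1 / 2 + d with hp
  have hp0 : 0 < p := by positivity
  refine ⟨(4 * p) ^ p * Real.exp (1 / 4), fun x => zero_lt_one.trans_le (one_le_psi hd x),
    fun x y => ?_⟩
  set r := |x - y| with hr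
  have hr0 : 0 ≤ r := abs_nonneg _
  have hy := one_le_log_exp_one_add y
  have hx := one_le_log_exp_one_add x
  have hxy : |x| ≤ r + |y| := by simpa [hr] using abs_add_le (x - y) y
  have e1 : Real.exp (|x| / 2) ≤ Real.exp (r / 2) * Real.exp (|y| / 2) := by
    rw [← Real.exp_add]
    exact Real.exp_le_exp.2 (by linarith)
  have e2 : (1 + |x|) ^ (1 / 2 : ℝ) ≤ (1 + r) ^ (1 / 2 : ℝ) * (1 + |y|) ^ (1 / 2 : ℝ) := by
    rw [← Real.mul_rpow (by positivity) (by positivity)]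
    refine Real.rpow_le_rpow (by positivity) ?_ (by norm_num)
    nlinarith [abs_nonneg y, mul_nonneg hr0 (abs_nonneg y)]
  have e3 : Real.log (Real.exp 1 + |x|) ^ d ≤
      (1 + r) ^ d * Real.log (Real.exp 1 + |y|) ^ d := by
    rw [← Real.mul_rpow (by positivity) (by linarith)]
    exact Real.rpow_le_rpow (by linarith) (log_exp_one_add_le x y) hd.le
  -- The algebraic and logarithmic factors vary by at most (1+r)^p, which z ≤ e^z with z =
  -- (1+r)/(4p) bounds by a multiple of e^{r/4}. Together with e^{r/2} this makes the exponent 3/4.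
  have e4 : (1 + r) ^ (1 / 2 : ℝ) * (1 + r) ^ d ≤
      (4 * p) ^ p * Real.exp (1 / 4) * Real.exp (r / 4) := by
    rw [← Real.rpow_add (by positivity), mul_assoc, ← Real.exp_add]
    have h1 : 1 + r ≤ 4 * p * Real.exp ((1 + r) / (4 * p)) := by
      have := Real.add_one_le_exp ((1 + r) / (4 * p))
      have h2 : (1 + r) / (4 * p) ≤ Real.exp ((1 + r) / (4 * p)) := by linarith
      rwa [div_le_iff₀' (by positivity)] at h2
    refine (Real.rpow_le_rpow (by positivity) h1 hp0.le).trans_eq ?_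
    rw [Real.mul_rpow (by positivity) (Real.exp_pos _).le, ← Real.exp_mul]
    congr 2
    field_simp
  have hlx : 0 ≤ Real.log (Real.exp 1 + |x|) ^ d := Real.rpow_nonneg (by linarith) d
  have hly : 0 ≤ Real.log (Real.exp 1 + |y|) ^ d := Real.rpow_nonneg (by linarith) d
  calc psi d x ≤ (Real.exp (r / 2) * Real.exp (|y| / 2)) *
        ((1 + r) ^ (1 / 2 : ℝ) * (1 + |y|) ^ (1 / 2 : ℝ)) *
        ((1 + r) ^ d * Real.log (Real.exp 1 + |y|) ^ d) := by
        unfold psi; gcongr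
    _ = Real.exp (r / 2) * ((1 + r) ^ (1 / 2 : ℝ) * (1 + r) ^ d) * psi d y := by
        unfold psi; ring
    _ ≤ Real.exp (r / 2) * ((4 * p) ^ p * Real.exp (1 / 4) * Real.exp (r / 4)) * psi d y := by
        have := one_le_psi hd y
        gcongr
    _ = _ := by
        have : Real.exp (3 / 4 * r) = Real.exp (r / 2) * Real.exp (r / 4) := by
          rw [← Real.exp_add]; congr 1; ring
        rw [this]; ring

theorem exp_abs_div_psi_sq (d x : ℝ) : Real.exp |x| / psi d x ^ 2 =
    ((1 + |x|) * Real.log (Real.exp 1 + |x|) ^ (2 * d))⁻¹ := by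
  have hx := one_le_log_exp_one_add x
  have h1 : psi d x ^ 2 =
      Real.exp |x| * ((1 + |x|) * Real.log (Real.exp 1 + |x|) ^ (2 * d)) := by
    unfold psi
    rw [mul_pow, mul_pow, ← Real.exp_nat_mul, ← Real.rpow_natCast (_ ^ (1 / 2 : ℝ)),
      ← Real.rpow_mul (by positivity), ← Real.rpow_natCast (_ ^ d),
      ← Real.rpow_mul (by linarith), mul_assoc]
    congr 2
    · push_cast; ring
    · norm_num
    · push_cast; ring_nf
  rw [h1, ← div_div, div_self (Real.exp_pos _).ne', one_div]

theorem integrable_exp_abs_div_psi_sq {d : ℝ} (hd : 1 / 2 < d) :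
    Integrable fun x => Real.exp |x| / psi d x ^ 2 := by
  set g' : ℝ → ℝ := fun x => Real.log (Real.exp 1 + x) ^ (-(2 * d)) / (Real.exp 1 + x) with hg'
  have hlog : ∀ x : ℝ, 0 ≤ x → 1 ≤ Real.log (Real.exp 1 + x) := fun x hx => by
    simpa [abs_of_nonneg hx] using one_le_log_exp_one_add x
  -- The substitution log(e+x) gives the primitive; the exponent 1 - 2d is negative, so it tends to
  -- 0 at infinity.
  have hderiv : ∀ x ∈ Ici (0 : ℝ), HasDerivAt
      (fun x => Real.log (Real.exp 1 + x) ^ (1 - 2 * d) / (1 - 2 * d)) (g' x) x := by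
    intro x hx
    have hx0 : 0 < Real.exp 1 + x := add_pos_of_pos_of_nonneg (Real.exp_pos 1) hx
    have h1 := ((((hasDerivAt_id x).const_add (Real.exp 1)).log hx0.ne').rpow_const
      (p := 1 - 2 * d) (Or.inl (by have := hlog x hx; simp only [id]; linarith))).div_const
      (1 - 2 * d)
    refine h1.congr_deriv ?_
    have : 1 - 2 * d ≠ 0 := by linarith
    simp only [id, hg']
    rw [show 1 - 2 * d - 1 = -(2 * d) by ring]
    field_simp
  have hpos : ∀ x ∈ Ioi (0 : ℝ), 0 ≤ g' x := fun x hx => by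
    have := hlog x (le_of_lt hx)
    have : (0 : ℝ) < x := hx
    exact div_nonneg (Real.rpow_nonneg (by linarith) _) (by positivity)
  have hlim : Tendsto (fun x => Real.log (Real.exp 1 + x) ^ (1 - 2 * d) / (1 - 2 * d)) atTop
      (𝓝 (0 / (1 - 2 * d))) := by
    refine Tendsto.div_const ?_ _
    have h1 := tendsto_rpow_neg_atTop (y := 2 * d - 1) (by linarith)
    rw [neg_sub] at h1
    exact h1.comp (Real.tendsto_log_atTop.comp (tendsto_atTop_add_const_left _ _ tendsto_id))
  have hval := integral_Ioi_of_hasDerivAt_of_nonneg' hderiv hpos hlim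
  have hint : Integrable fun x => g' |x| := by
    -- The integral equals 2/(2d-1). Being nonzero, it cannot be the default value of a
    -- non-integrable function.
    refine Integrable.of_integral_ne_zero ?_
    rw [integral_comp_abs, hval]
    simp
    linarith
  refine (hint.const_mul (Real.exp 1)).mono' ?_ (Eventually.of_forall fun x => ?_)
  · have : Measurable (psi d) := by unfold psi; fun_prop
    exact ((by fun_prop : Measurable fun x : ℝ => Real.exp |x|).div
      (this.pow_const 2)).aestronglyMeasurable
  · have hl := one_le_log_exp_one_add x
    have hl' : 0 < Real.log (Real.exp 1 + |x|) := by linarith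
    rw [exp_abs_div_psi_sq, Real.norm_of_nonneg (by positivity), hg']
    simp only
    rw [Real.rpow_neg hl'.le, mul_inv, mul_comm, div_eq_mul_inv, ← mul_assoc,
      mul_comm (Real.exp 1), mul_assoc]
    gcongr
    rw [inv_eq_one_div, ← div_eq_mul_inv, div_le_div_iff₀ (by positivity) (by positivity)]
    have : 1 ≤ Real.exp 1 := Real.one_le_exp zero_le_one
    nlinarith [abs_nonneg x]

theorem exists_isDecayWeight_psi {d : ℝ} (hd : 1 / 2 < d) : ∃ C, IsDecayWeight C (psi d) := by
  obtain ⟨C, hC⟩ := exists_isModerate_psi (d := d) (by linarith)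
  refine ⟨C, hC, one_le_psi (by linarith), integrable_exp_abs_div_psi_sq hd, ?_⟩
  refine squeeze_zero (g := fun x => (1 + |x|)⁻¹) (fun x => by positivity) (fun x => ?_)
    (tendsto_inv_atTop_zero.comp
      (tendsto_atTop_add_const_left _ _ tendsto_abs_atTop_atTop))
  rw [exp_abs_div_psi_sq]
  have := Real.one_le_rpow (one_le_log_exp_one_add x) (by linarith : 0 ≤ 2 * d)
  gcongr
  exact le_mul_of_one_le_right (by positivity) this

/-! ### Reflection -/

theorem greenConv_comp_neg (f : ℝ → ℝ) (x : ℝ) :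
    greenConv (fun y => f (-y)) x = greenConv f (-x) := by
  rw [greenConv, greenConv, ← integral_neg_eq_self]
  congr 1; ext y
  have : green (x - -y) = green (-x - y) := by
    unfold green; rw [← abs_neg]; congr 4; ring
  rw [this, neg_neg]

theorem opP_comp_neg (f : ℝ → ℝ) (x : ℝ) : opP (fun y => f (-y)) x = -opP f (-x) := by
  change -deriv (greenConv fun y => f (-y)) x = - -deriv (greenConv f) (-x)
  rw [show greenConv (fun y => f (-y)) = fun x => greenConv f (-x) from
    funext (greenConv_comp_neg f), deriv_comp_neg]

theorem deriv_neg_comp_neg (f : ℝ → ℝ) : deriv (fun x => -f (-x)) = fun x => deriv f (-x) := by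
  ext x
  rw [deriv.fun_neg, deriv_comp_neg, neg_neg]

theorem deriv_fun_comp_neg (f : ℝ → ℝ) : deriv (fun x => f (-x)) = fun x => -deriv f (-x) := by
  ext x
  rw [deriv_comp_neg]

theorem nonlin_reflect (u ρ : ℝ → ℝ) :
    nonlin (fun x => -u (-x)) (fun x => ρ (-x)) = fun x => nonlin u ρ (-x) := by
  ext x
  unfold nonlin
  rw [deriv_neg_comp_neg]
  ring

theorem jetSize_reflect (u ρ : ℝ → ℝ) (x : ℝ) :
    jetSize (fun x => -u (-x)) (fun x => ρ (-x)) x = jetSize u ρ (-x) := by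
  unfold jetSize
  simp only [deriv_neg_comp_neg, deriv_fun_comp_neg, abs_neg]

theorem HasUnifTimeDeriv.reflect {T : ℝ} {f g : ℝ → ℝ → ℝ} (h : HasUnifTimeDeriv T f g) :
    HasUnifTimeDeriv T (fun t x => f t (-x)) fun t x => g t (-x) := fun t ht ε hε => by
  filter_upwards [h t ht ε hε] with r hr x using hr (-x)

theorem HasUnifTimeDeriv.neg {T : ℝ} {f g : ℝ → ℝ → ℝ} (h : HasUnifTimeDeriv T f g) :
    HasUnifTimeDeriv T (fun t x => -f t x) fun t x => -g t x := fun t ht ε hε => by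
  filter_upwards [h t ht ε hε] with r hr x
  have := hr x
  rw [← abs_neg] at this
  convert! this using 2
  ring

/-- The system is invariant under x ↦ -x with u reflected oddly and ρ evenly. The behaviour at -∞ is
thus that of another solution at +∞. -/
theorem ClassicalSolution.reflect {T : ℝ} {u ρ : ℝ → ℝ → ℝ} (h : ClassicalSolution T u ρ) :
    ClassicalSolution T (fun t x => -u t (-x)) fun t x => ρ t (-x) where
  contDiff_u t ht := ((h.contDiff_u t ht).comp contDiff_neg).neg
  contDiff_ρ t ht := (h.contDiff_ρ t ht).comp contDiff_neg
  exists_bound τ hτ := by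
    obtain ⟨L, hL0, hL⟩ := h.exists_bound τ hτ
    refine ⟨L, hL0, fun t ht x => ?_⟩
    simpa only [deriv_neg_comp_neg, deriv_fun_comp_neg, abs_neg] using hL t ht (-x)
  time_deriv_u := by
    convert! h.time_deriv_u.reflect.neg using 3 with t x
    rw [nonlin_reflect, opP_comp_neg, deriv_neg_comp_neg]
    ring
  time_deriv_ux := by
    convert! h.time_deriv_ux.reflect using 3 with t t x
    · rw [deriv_neg_comp_neg]
    · rw [nonlin_reflect, greenConv_comp_neg, deriv_neg_comp_neg, deriv_fun_comp_neg]
      ring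
  time_deriv_ρ := by
    convert! h.time_deriv_ρ.reflect using 3 with t x
    rw [deriv_neg_comp_neg, deriv_fun_comp_neg]
    ring

/-! ### The energy density and its flux at a fixed time. -/

/-- The energy density `u² + uₓ² + ρ²`. -/
def energyDensity (u ρ : ℝ → ℝ) (x : ℝ) : ℝ := u x ^ 2 + deriv u x ^ 2 + ρ x ^ 2

/-- The flux `2 u (G * F) + u (uₓ² + ρ²)` of the energy density. -/
def energyFlux (u ρ : ℝ → ℝ) (x : ℝ) : ℝ :=
  2 * (u x * greenConv (nonlin u ρ) x) + u x * (deriv u x ^ 2 + ρ x ^ 2)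

/-- The time derivative of the energy density along a solution. -/
def energyRate (u ρ : ℝ → ℝ) (x : ℝ) : ℝ :=
  2 * u x * (opP (nonlin u ρ) x - u x * deriv u x)
    + 2 * deriv u x * ((u x ^ 2 - deriv u x ^ 2 / 2 + ρ x ^ 2 / 2 - greenConv (nonlin u ρ) x)
      - u x * deriv (deriv u) x)
    + 2 * ρ x * (-(ρ x * deriv u x) - u x * deriv ρ x)

/-- `u ∈ C²` and `ρ ∈ C¹` with `|u| + |uₓ| + |uₓₓ| + |ρ| + |ρₓ| ≤ K/ψ`. -/
structure DecaysLike (ψ : ℝ → ℝ) (K : ℝ) (u ρ : ℝ → ℝ) : Prop where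
  contDiff_u : ContDiff ℝ 2 u
  contDiff_ρ : ContDiff ℝ 1 ρ
  le : ∀ x, ψ x * jetSize u ρ x ≤ K

section FixedTime

variable {C K : ℝ} {ψ u ρ : ℝ → ℝ}

theorem abs_le_jetSize (u ρ : ℝ → ℝ) (x : ℝ) : |u x| ≤ jetSize u ρ x ∧
    |deriv u x| ≤ jetSize u ρ x ∧ |deriv (deriv u) x| ≤ jetSize u ρ x ∧
    |ρ x| ≤ jetSize u ρ x ∧ |deriv ρ x| ≤ jetSize u ρ x := by
  unfold jetSize
  refine ⟨?_, ?_, ?_, ?_, ?_⟩ <;>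
  linarith [abs_nonneg (u x), abs_nonneg (deriv u x), abs_nonneg (deriv (deriv u) x),
    abs_nonneg (ρ x), abs_nonneg (deriv ρ x)]

theorem energyDensity_nonneg (u ρ : ℝ → ℝ) (x : ℝ) : 0 ≤ energyDensity u ρ x := by
  unfold energyDensity; positivity

theorem nonlin_le_energyDensity (u ρ : ℝ → ℝ) (x : ℝ) :
    nonlin u ρ x ≤ energyDensity u ρ x := by
  unfold nonlin energyDensity
  linarith [sq_nonneg (deriv u x), sq_nonneg (ρ x)]

theorem energyDensity_le_jetSize_sq (u ρ : ℝ → ℝ) (x : ℝ) :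
    energyDensity u ρ x ≤ jetSize u ρ x ^ 2 := by
  unfold energyDensity jetSize
  rw [← sq_abs (u x), ← sq_abs (deriv u x), ← sq_abs (ρ x)]
  nlinarith [abs_nonneg (u x), abs_nonneg (deriv u x), abs_nonneg (deriv (deriv u) x),
    abs_nonneg (ρ x), abs_nonneg (deriv ρ x), mul_nonneg (abs_nonneg (u x)) (abs_nonneg (ρ x)),
    mul_nonneg (abs_nonneg (u x)) (abs_nonneg (deriv u x)),
    mul_nonneg (abs_nonneg (deriv u x)) (abs_nonneg (ρ x)),
    mul_nonneg (add_nonneg (add_nonneg (abs_nonneg (u x)) (abs_nonneg (deriv u x)))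
      (abs_nonneg (ρ x))) (add_nonneg (abs_nonneg (deriv (deriv u) x)) (abs_nonneg (deriv ρ x))),
    sq_nonneg (|deriv (deriv u) x| + |deriv ρ x|)]

theorem DecaysLike.nonneg (h : DecaysLike ψ K u ρ) (hψ : IsDecayWeight C ψ) : 0 ≤ K :=
  (mul_nonneg (hψ.pos 0).le (jetSize_nonneg _ _ _)).trans (h.le 0)

theorem DecaysLike.jetSize_le (h : DecaysLike ψ K u ρ) (hψ : IsDecayWeight C ψ) (x : ℝ) :
    jetSize u ρ x ≤ K := by
  refine le_trans ?_ (h.le x)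
  exact le_mul_of_one_le_left (jetSize_nonneg _ _ _) (hψ.one_le_weight x)

theorem DecaysLike.exp_mul_jetSize_sq_le (h : DecaysLike ψ K u ρ) (hψ : IsDecayWeight C ψ)
    (x : ℝ) : Real.exp |x| * jetSize u ρ x ^ 2 ≤ K ^ 2 * (Real.exp |x| / ψ x ^ 2) := by
  have hp := hψ.pos x
  have h1 : ψ x ^ 2 * jetSize u ρ x ^ 2 ≤ K ^ 2 := by
    rw [← mul_pow]
    exact pow_le_pow_left₀ (mul_nonneg hp.le (jetSize_nonneg _ _ _)) (h.le x) 2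
  rw [← mul_div_assoc, le_div_iff₀ (by positivity)]
  calc _ = Real.exp |x| * (ψ x ^ 2 * jetSize u ρ x ^ 2) := by ring
    _ ≤ Real.exp |x| * K ^ 2 := by gcongr
    _ = _ := by ring

/-- Moderateness against the origin gives ψ(x) ≤ C ψ(0) e^{|x|}, hence 1/ψ ≤ C ψ(0) e^{|x|}/ψ². So
the jet itself, and not only its square, has an integrable majorant. -/
theorem DecaysLike.jetSize_le_mul (h : DecaysLike ψ K u ρ) (hψ : IsDecayWeight C ψ) (x : ℝ) :
    jetSize u ρ x ≤ K * (C * ψ 0) * (Real.exp |x| / ψ x ^ 2) := by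
  have hp := hψ.pos x
  have hK := h.nonneg hψ
  have h1 : ψ x ≤ C * ψ 0 * Real.exp |x| := by
    have h2 := hψ.le_mul x 0
    rw [sub_zero] at h2
    have h3 := hψ.pos 0
    have h4 := hψ.one_le
    calc ψ x ≤ C * Real.exp (3 / 4 * |x|) * ψ 0 := h2
      _ ≤ C * Real.exp |x| * ψ 0 := by
          gcongr; linarith [abs_nonneg x]
      _ = _ := by ring
  rw [← mul_div_assoc, le_div_iff₀ (by positivity)]
  calc jetSize u ρ x * ψ x ^ 2 = (ψ x * jetSize u ρ x) * ψ x := by ring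
    _ ≤ K * (C * ψ 0 * Real.exp |x|) :=
        mul_le_mul (h.le x) h1 hp.le hK
    _ = _ := by ring

theorem DecaysLike.continuous_nonlin (h : DecaysLike ψ K u ρ) : Continuous (nonlin u ρ) :=
  TwoCH.continuous_nonlin (h.contDiff_u.of_le one_le_two) h.contDiff_ρ.continuous

theorem DecaysLike.abs_nonlin_le (h : DecaysLike ψ K u ρ) (hψ : IsDecayWeight C ψ) (x : ℝ) :
    |nonlin u ρ x| ≤ 2 * K ^ 2 := by
  obtain ⟨h1, h2, -, h3, -⟩ := abs_le_jetSize u ρ x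
  have := h.jetSize_le hψ x
  exact TwoCH.abs_nonlin_le (h1.trans this) (h2.trans this) (h3.trans this)

theorem DecaysLike.continuous_energyDensity (h : DecaysLike ψ K u ρ) :
    Continuous (energyDensity u ρ) := by
  have h1 := h.contDiff_u.continuous
  have h2 := (contDiff_deriv h.contDiff_u).continuous
  have h3 := h.contDiff_ρ.continuous
  unfold energyDensity
  fun_prop

theorem DecaysLike.integrable_mul_energyDensity (h : DecaysLike ψ K u ρ)
    (hψ : IsDecayWeight C ψ) {w : ℝ → ℝ} (hw : Continuous w) (hwb : ∀ x, |w x| ≤ Real.exp |x|) :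
    Integrable fun x => w x * energyDensity u ρ x := by
  refine (hψ.integrable.const_mul (K ^ 2)).mono'
    (hw.mul h.continuous_energyDensity).aestronglyMeasurable (Eventually.of_forall fun x => ?_)
  rw [Real.norm_eq_abs, abs_mul, abs_of_nonneg (energyDensity_nonneg u ρ x)]
  refine le_trans ?_ (h.exp_mul_jetSize_sq_le hψ x)
  exact mul_le_mul (hwb x) (energyDensity_le_jetSize_sq u ρ x) (energyDensity_nonneg u ρ x)
    (Real.exp_pos _).le

theorem DecaysLike.integrable_mul_nonlin (h : DecaysLike ψ K u ρ)
    (hψ : IsDecayWeight C ψ) {w : ℝ → ℝ} (hw : Continuous w) (hwb : ∀ x, |w x| ≤ Real.exp |x|) :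
    Integrable fun x => w x * nonlin u ρ x := by
  refine (h.integrable_mul_energyDensity hψ hw hwb).mono
    (hw.mul h.continuous_nonlin).aestronglyMeasurable (Eventually.of_forall fun x => ?_)
  rw [norm_mul, norm_mul, Real.norm_of_nonneg (nonlin_nonneg u ρ x),
    Real.norm_of_nonneg (energyDensity_nonneg u ρ x)]
  exact mul_le_mul_of_nonneg_left (nonlin_le_energyDensity u ρ x) (norm_nonneg _)

/-- The hypothesis on a and b says G(x-y) ≤ ½ e^{-b} e^{a(y)}. It is applied with a(y) = |y|, 0 and
y. -/
theorem greenConv_le_exp {f : ℝ → ℝ} (hf : ∀ x, 0 ≤ f x) {a : ℝ → ℝ} {b x : ℝ}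
    (hab : ∀ y, -|x - y| ≤ a y - b) (hint : Integrable fun y => Real.exp (a y) * f y) :
    greenConv f x ≤ Real.exp (-b) / 2 * ∫ y, Real.exp (a y) * f y := by
  rw [greenConv, ← integral_const_mul]
  refine integral_mono_of_nonneg
    (Eventually.of_forall fun y => mul_nonneg (green_nonneg _) (hf y)) (hint.const_mul _)
    (Eventually.of_forall fun y => ?_)
  calc green (x - y) * f y ≤ Real.exp (a y - b) / 2 * f y := by
        unfold green
        gcongr
        · exact hf y
        · exact hab y
    _ = _ := by rw [sub_eq_add_neg, Real.exp_add]; ring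

theorem DecaysLike.greenConv_le (h : DecaysLike ψ K u ρ) (hψ : IsDecayWeight C ψ) (x : ℝ) :
    greenConv (nonlin u ρ) x ≤
      K ^ 2 * (∫ y, Real.exp |y| / ψ y ^ 2) * Real.exp (-|x|) := by
  have hint := h.integrable_mul_nonlin hψ (w := fun y => Real.exp |y|) (by fun_prop)
    (fun y => by simp)
  refine (greenConv_le_exp (nonlin_nonneg u ρ) (a := fun y => |y|) (b := |x|) (fun y => ?_)
    hint).trans ?_
  · have := abs_sub_abs_le_abs_sub x y
    linarith
  · have h1 : ∫ y, Real.exp |y| * nonlin u ρ y ≤ K ^ 2 * ∫ y, Real.exp |y| / ψ y ^ 2 := by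
      rw [← integral_const_mul]
      refine integral_mono hint (hψ.integrable.const_mul _) fun y => ?_
      refine le_trans ?_ (h.exp_mul_jetSize_sq_le hψ y)
      exact mul_le_mul_of_nonneg_left
        ((nonlin_le_energyDensity u ρ y).trans (energyDensity_le_jetSize_sq u ρ y))
        (Real.exp_pos _).le
    have h2 : 0 ≤ ∫ y, Real.exp |y| * nonlin u ρ y :=
      integral_nonneg fun y => mul_nonneg (Real.exp_pos _).le (nonlin_nonneg u ρ y)
    have h3 := Real.exp_pos (-|x|)
    nlinarith

/-- A common majorant of the energy flux and its derivative. -/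
def fluxMajorant (u ρ : ℝ → ℝ) (x : ℝ) : ℝ :=
  jetSize u ρ x * greenConv (nonlin u ρ) x + jetSize u ρ x ^ 3

theorem DecaysLike.exp_mul_fluxMajorant_le (h : DecaysLike ψ K u ρ) (hψ : IsDecayWeight C ψ)
    (x : ℝ) : Real.exp |x| * fluxMajorant u ρ x ≤
      (K ^ 2 * (∫ y, Real.exp |y| / ψ y ^ 2) * (K * (C * ψ 0)) + K ^ 3) *
        (Real.exp |x| / ψ x ^ 2) := by
  have hI : 0 ≤ ∫ y, Real.exp |y| / ψ y ^ 2 := integral_nonneg fun y => by positivity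
  have hS := jetSize_nonneg u ρ x
  have hK := h.nonneg hψ
  have h1 : Real.exp |x| * (jetSize u ρ x * greenConv (nonlin u ρ) x) ≤
      K ^ 2 * (∫ y, Real.exp |y| / ψ y ^ 2) * (K * (C * ψ 0) * (Real.exp |x| / ψ x ^ 2)) := by
    calc _ ≤ Real.exp |x| * (jetSize u ρ x *
          (K ^ 2 * (∫ y, Real.exp |y| / ψ y ^ 2) * Real.exp (-|x|))) := by
          gcongr; exact h.greenConv_le hψ x
      _ = K ^ 2 * (∫ y, Real.exp |y| / ψ y ^ 2) * jetSize u ρ x := by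
          rw [Real.exp_neg]; field_simp
      _ ≤ _ := by gcongr; exact h.jetSize_le_mul hψ x
  have h2 : Real.exp |x| * jetSize u ρ x ^ 3 ≤ K ^ 3 * (Real.exp |x| / ψ x ^ 2) := by
    calc _ = (Real.exp |x| * jetSize u ρ x ^ 2) * jetSize u ρ x := by ring
      _ ≤ (K ^ 2 * (Real.exp |x| / ψ x ^ 2)) * K :=
          mul_le_mul (h.exp_mul_jetSize_sq_le hψ x) (h.jetSize_le hψ x) hS
            (by have := hψ.pos x; positivity)
      _ = _ := by ring
  unfold fluxMajorant
  linarith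

theorem abs_mul_mul_le {a b c S : ℝ} (ha : |a| ≤ S) (hb : |b| ≤ S) (hc : |c| ≤ S) :
    |a * b * c| ≤ S ^ 3 := by
  have hS := (abs_nonneg a).trans ha
  rw [abs_mul, abs_mul]
  calc |a| * |b| * |c| ≤ S * S * S := by gcongr
    _ = S ^ 3 := by ring

theorem abs_energyFlux_le (u ρ : ℝ → ℝ) (x : ℝ) :
    |energyFlux u ρ x| ≤ 2 * fluxMajorant u ρ x := by
  obtain ⟨h1, h2, -, h3, -⟩ := abs_le_jetSize u ρ x
  have e1 := abs_mul_mul_le h1 h2 h2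
  have e2 := abs_mul_mul_le h1 h3 h3
  have hP := greenConv_nonneg (nonlin_nonneg u ρ) x
  have e3 : |u x * greenConv (nonlin u ρ) x| ≤ jetSize u ρ x * greenConv (nonlin u ρ) x := by
    rw [abs_mul, abs_of_nonneg hP]; gcongr
  rw [abs_le] at *
  unfold energyFlux fluxMajorant
  constructor <;> linarith

theorem DecaysLike.abs_opP_le (h : DecaysLike ψ K u ρ) (hψ : IsDecayWeight C ψ) (x : ℝ) :
    |opP (nonlin u ρ) x| ≤ greenConv (nonlin u ρ) x := by
  refine (TwoCH.abs_opP_le h.continuous_nonlin (h.abs_nonlin_le hψ) x).trans_eq ?_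
  congr 1; ext y
  exact abs_of_nonneg (nonlin_nonneg u ρ y)

theorem DecaysLike.abs_energyRate_le (h : DecaysLike ψ K u ρ) (hψ : IsDecayWeight C ψ) (x : ℝ) :
    |energyRate u ρ x| ≤ 12 * fluxMajorant u ρ x := by
  obtain ⟨h1, h2, h3, h4, h5⟩ := abs_le_jetSize u ρ x
  have hS := jetSize_nonneg u ρ x
  have hP := greenConv_nonneg (nonlin_nonneg u ρ) x
  have e1 : |u x * opP (nonlin u ρ) x| ≤ jetSize u ρ x * greenConv (nonlin u ρ) x := by
    rw [abs_mul]; gcongr; exact h.abs_opP_le hψ x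
  have e2 : |deriv u x * greenConv (nonlin u ρ) x| ≤
      jetSize u ρ x * greenConv (nonlin u ρ) x := by
    rw [abs_mul, abs_of_nonneg hP]; gcongr
  have e3 := abs_mul_mul_le h2 h2 h2
  have e4 := abs_mul_mul_le h2 h4 h4
  have e5 := abs_mul_mul_le h2 h1 h3
  have e6 := abs_mul_mul_le h1 h4 h5
  have e7 : 0 ≤ jetSize u ρ x * greenConv (nonlin u ρ) x := mul_nonneg hS hP
  have e8 : 0 ≤ jetSize u ρ x ^ 3 := by positivity
  rw [abs_le] at e1 e2 e3 e4 e5 e6 ⊢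
  unfold energyRate fluxMajorant
  constructor <;> linarith

theorem DecaysLike.hasDerivAt_u (h : DecaysLike ψ K u ρ) (x : ℝ) :
    HasDerivAt u (deriv u x) x := (h.contDiff_u.differentiable two_ne_zero x).hasDerivAt

theorem DecaysLike.hasDerivAt_ux (h : DecaysLike ψ K u ρ) (x : ℝ) :
    HasDerivAt (deriv u) (deriv (deriv u) x) x :=
  ((contDiff_deriv h.contDiff_u).differentiable one_ne_zero x).hasDerivAt

theorem DecaysLike.hasDerivAt_ρ (h : DecaysLike ψ K u ρ) (x : ℝ) :
    HasDerivAt ρ (deriv ρ x) x := (h.contDiff_ρ.differentiable one_ne_zero x).hasDerivAt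

theorem DecaysLike.hasDerivAt_greenConv (h : DecaysLike ψ K u ρ) (hψ : IsDecayWeight C ψ)
    (x : ℝ) : HasDerivAt (greenConv (nonlin u ρ)) (-opP (nonlin u ρ) x) x :=
  hasDerivAt_greenConv' h.continuous_nonlin (h.abs_nonlin_le hψ) x

/-- This is the local conservation law. In the rate the terms u² uₓ cancel, the nonlocal ones
combine by ∂ₓ(G * F) = -P F, and the rest is -∂ₓ(u (uₓ² + ρ²)). -/
theorem DecaysLike.hasDerivAt_energyFlux (h : DecaysLike ψ K u ρ) (hψ : IsDecayWeight C ψ)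
    (x : ℝ) : HasDerivAt (energyFlux u ρ) (-energyRate u ρ x) x := by
  have h1 := h.hasDerivAt_u x
  have h2 := h.hasDerivAt_ux x
  have h3 := h.hasDerivAt_ρ x
  have h4 := h.hasDerivAt_greenConv hψ x
  refine (((h1.mul h4).const_mul 2).add (h1.mul ((h2.pow 2).add (h3.pow 2)))).congr_deriv ?_
  simp only [Pi.add_apply, Pi.pow_apply]
  unfold energyRate
  push_cast
  ring

theorem DecaysLike.continuous_greenConv (h : DecaysLike ψ K u ρ) (hψ : IsDecayWeight C ψ) :
    Continuous (greenConv (nonlin u ρ)) :=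
  continuous_iff_continuousAt.2 fun x => (h.hasDerivAt_greenConv hψ x).continuousAt

theorem DecaysLike.continuous_opP (h : DecaysLike ψ K u ρ) (hψ : IsDecayWeight C ψ) :
    Continuous (opP (nonlin u ρ)) :=
  continuous_iff_continuousAt.2 fun x =>
    (hasDerivAt_opP h.continuous_nonlin (h.abs_nonlin_le hψ) x).continuousAt

theorem DecaysLike.continuous_energyFlux (h : DecaysLike ψ K u ρ) (hψ : IsDecayWeight C ψ) :
    Continuous (energyFlux u ρ) :=
  continuous_iff_continuousAt.2 fun x => (h.hasDerivAt_energyFlux hψ x).continuousAt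

theorem DecaysLike.continuous_energyRate (h : DecaysLike ψ K u ρ) (hψ : IsDecayWeight C ψ) :
    Continuous (energyRate u ρ) := by
  have h1 := h.contDiff_u.continuous
  have h2 := (contDiff_deriv h.contDiff_u).continuous
  have h3 := (contDiff_deriv h.contDiff_u).continuous_deriv le_rfl
  have h4 := h.contDiff_ρ.continuous
  have h5 := h.contDiff_ρ.continuous_deriv le_rfl
  have h6 := h.continuous_greenConv hψ
  have h7 := h.continuous_opP hψ
  unfold energyRate
  fun_prop

theorem DecaysLike.integrable_mul_of_le_fluxMajorant (h : DecaysLike ψ K u ρ)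
    (hψ : IsDecayWeight C ψ) {w f : ℝ → ℝ} (hw : Continuous w) (hwb : ∀ x, |w x| ≤ Real.exp |x|)
    (hf : Continuous f) {c : ℝ} (hc : 0 ≤ c) (hfb : ∀ x, |f x| ≤ c * fluxMajorant u ρ x) :
    Integrable fun x => w x * f x := by
  refine (hψ.integrable.const_mul (c *
    (K ^ 2 * (∫ y, Real.exp |y| / ψ y ^ 2) * (K * (C * ψ 0)) + K ^ 3))).mono'
    (hw.mul hf).aestronglyMeasurable (Eventually.of_forall fun x => ?_)
  rw [norm_mul]
  calc ‖w x‖ * ‖f x‖ ≤ Real.exp |x| * (c * fluxMajorant u ρ x) :=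
        mul_le_mul (hwb x) (hfb x) (norm_nonneg _) (Real.exp_pos _).le
    _ = c * (Real.exp |x| * fluxMajorant u ρ x) := by ring
    _ ≤ _ := (mul_le_mul_of_nonneg_left (h.exp_mul_fluxMajorant_le hψ x) hc).trans_eq (by ring)

/-- Integration by parts. The flux and the rate remain integrable against weights up to e^{|x|}, so
there are no boundary terms. -/
theorem DecaysLike.integral_mul_energyRate (h : DecaysLike ψ K u ρ) (hψ : IsDecayWeight C ψ)
    {w w' : ℝ → ℝ} (hw : ∀ x, HasDerivAt w (w' x) x) (hw' : Continuous w')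
    (hwb : ∀ x, |w x| ≤ Real.exp |x|) (hwb' : ∀ x, |w' x| ≤ Real.exp |x|) :
    ∫ x, w x * energyRate u ρ x = ∫ x, w' x * energyFlux u ρ x := by
  have hwc : Continuous w := continuous_iff_continuousAt.2 fun x => (hw x).continuousAt
  have i1 := h.integrable_mul_of_le_fluxMajorant hψ hwc hwb (h.continuous_energyRate hψ)
    (by norm_num) (h.abs_energyRate_le hψ)
  have i2 := h.integrable_mul_of_le_fluxMajorant hψ hwc hwb (h.continuous_energyFlux hψ)
    (by norm_num) (abs_energyFlux_le u ρ)
  have i3 := h.integrable_mul_of_le_fluxMajorant hψ hw' hwb' (h.continuous_energyFlux hψ)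
    (by norm_num) (abs_energyFlux_le u ρ)
  have h1 := integral_eq_zero_of_hasDerivAt_of_integrable
    (fun x => (hw x).mul (h.hasDerivAt_energyFlux hψ x))
    (by simpa only [mul_neg, ← sub_eq_add_neg] using! i3.sub i1) i2
  simp only [mul_neg, ← sub_eq_add_neg] at h1
  rw [integral_sub i3 i1] at h1
  linarith

end FixedTime

/-! ### Gronwall's inequality and the weighted energy balance in time. -/

theorem le_exp_mul_of_hasDerivAt_le {E E' : ℝ → ℝ} {A B τ : ℝ} (hτ : 0 ≤ τ) (hA : 0 ≤ A)
    (hB : 0 ≤ B) (hE : ContinuousOn E (Icc 0 τ)) (hE' : ∀ t ∈ Ioo 0 τ, HasDerivAt E (E' t) t)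
    (hb : ∀ t ∈ Ioo 0 τ, E' t ≤ A + B * E t) : E τ ≤ Real.exp (B * τ) * (E 0 + A * τ) := by
  have hanti : AntitoneOn (fun t => Real.exp (-(B * t)) * E t - A * t) (Icc 0 τ) := by
    refine antitoneOn_of_hasDerivWithinAt_nonpos (convex_Icc 0 τ)
      (f' := fun t => Real.exp (-(B * t)) * (E' t - B * E t) - A) (by fun_prop)
      (fun t ht => ?_) (fun t ht => ?_)
    · rw [interior_Icc] at ht
      have h1 : HasDerivAt (fun t => Real.exp (-(B * t))) (Real.exp (-(B * t)) * (-(B * 1))) t :=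
        (((hasDerivAt_id t).const_mul B).neg).exp
      refine ((h1.mul (hE' t ht)).sub ((hasDerivAt_id t).const_mul A)).hasDerivWithinAt.congr_deriv
        ?_
      ring
    · rw [interior_Icc] at ht
      have h1 := hb t ht
      have h2 : Real.exp (-(B * t)) ≤ 1 :=
        Real.exp_le_one_iff.2 (neg_nonpos.2 (mul_nonneg hB ht.1.le))
      have h3 := Real.exp_pos (-(B * t))
      have h4 : Real.exp (-(B * t)) * (E' t - B * E t) ≤ Real.exp (-(B * t)) * A := by
        gcongr; linarith
      nlinarith
  have h := hanti (left_mem_Icc.2 hτ) (right_mem_Icc.2 hτ) hτ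
  simp only [mul_zero, neg_zero, Real.exp_zero, one_mul, sub_zero, Real.exp_neg] at h
  have h5 := Real.exp_pos (B * τ)
  have h6 : (Real.exp (B * τ))⁻¹ * E τ ≤ E 0 + A * τ := by linarith
  rwa [inv_mul_le_iff₀ h5] at h6

section

variable {T C : ℝ} {ψ : ℝ → ℝ} {u ρ : ℝ → ℝ → ℝ}

theorem ClassicalSolution.hasDerivAt_energyDensity (h : ClassicalSolution T u ρ) {t : ℝ}
    (ht : t ∈ Ioo 0 T) (x : ℝ) :
    HasDerivAt (fun r => energyDensity (u r) (ρ r) x) (energyRate (u t) (ρ t) x) t := by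
  have hI : t ∈ Ico 0 T := ⟨ht.1.le, ht.2⟩
  have hm := Ico_mem_nhds ht.1 ht.2
  have h1 := (h.time_deriv_u.hasDerivWithinAt hI x).hasDerivAt hm
  have h2 := (h.time_deriv_ux.hasDerivWithinAt hI x).hasDerivAt hm
  have h3 := (h.time_deriv_ρ.hasDerivWithinAt hI x).hasDerivAt hm
  refine (((h1.pow 2).add (h2.pow 2)).add (h3.pow 2)).congr_deriv ?_
  unfold energyRate
  push_cast
  ring

theorem ClassicalSolution.continuousOn_energyDensity (h : ClassicalSolution T u ρ) (x : ℝ) :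
    ContinuousOn (fun r => energyDensity (u r) (ρ r) x) (Ico 0 T) := by
  have h1 : ContinuousOn (fun r => u r x) (Ico 0 T) := fun t ht =>
    (h.time_deriv_u.hasDerivWithinAt ht x).continuousWithinAt
  have h2 : ContinuousOn (fun r => deriv (u r) x) (Ico 0 T) := fun t ht =>
    (h.time_deriv_ux.hasDerivWithinAt ht x).continuousWithinAt
  have h3 : ContinuousOn (fun r => ρ r x) (Ico 0 T) := fun t ht =>
    (h.time_deriv_ρ.hasDerivWithinAt ht x).continuousWithinAt
  exact ((h1.pow 2).add (h2.pow 2)).add (h3.pow 2)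

theorem ClassicalSolution.continuousOn_nonlin (h : ClassicalSolution T u ρ) (x : ℝ) :
    ContinuousOn (fun r => nonlin (u r) (ρ r) x) (Ico 0 T) := by
  have h1 : ContinuousOn (fun r => u r x) (Ico 0 T) := fun t ht =>
    (h.time_deriv_u.hasDerivWithinAt ht x).continuousWithinAt
  have h2 : ContinuousOn (fun r => deriv (u r) x) (Ico 0 T) := fun t ht =>
    (h.time_deriv_ux.hasDerivWithinAt ht x).continuousWithinAt
  have h3 : ContinuousOn (fun r => ρ r x) (Ico 0 T) := fun t ht =>
    (h.time_deriv_ρ.hasDerivWithinAt ht x).continuousWithinAt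
  exact ((h1.pow 2).add ((h2.pow 2).div_const 2)).add ((h3.pow 2).div_const 2)

theorem ClassicalSolution.continuousOn_integral_energyDensity (h : ClassicalSolution T u ρ)
    {τ K : ℝ} (hτ : τ < T) (hψ : IsDecayWeight C ψ)
    (hK : ∀ t ∈ Icc 0 τ, DecaysLike ψ K (u t) (ρ t)) {w : ℝ → ℝ} (hw : Continuous w)
    (hwb : ∀ x, |w x| ≤ Real.exp |x|) :
    ContinuousOn (fun t => ∫ x, w x * energyDensity (u t) (ρ t) x) (Icc 0 τ) := by
  refine continuousOn_of_dominated (bound := fun x => K ^ 2 * (Real.exp |x| / ψ x ^ 2))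
    (fun t ht => (hw.mul (hK t ht).continuous_energyDensity).aestronglyMeasurable)
    (fun t ht => Eventually.of_forall fun x => ?_) (hψ.integrable.const_mul _)
    (Eventually.of_forall fun x => ((h.continuousOn_energyDensity x).mono
      fun r hr => ⟨hr.1, hr.2.trans_lt hτ⟩).const_mul _)
  rw [Real.norm_eq_abs, abs_mul, abs_of_nonneg (energyDensity_nonneg _ _ x)]
  refine le_trans ?_ ((hK t ht).exp_mul_jetSize_sq_le hψ x)
  exact mul_le_mul (hwb x) (energyDensity_le_jetSize_sq _ _ x) (energyDensity_nonneg _ _ x)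
    (Real.exp_pos _).le

theorem ClassicalSolution.continuousOn_integral_nonlin (h : ClassicalSolution T u ρ)
    {τ K : ℝ} (hτ : τ < T) (hψ : IsDecayWeight C ψ)
    (hK : ∀ t ∈ Icc 0 τ, DecaysLike ψ K (u t) (ρ t)) {w : ℝ → ℝ} (hw : Continuous w)
    (hwb : ∀ x, |w x| ≤ Real.exp |x|) :
    ContinuousOn (fun t => ∫ x, w x * nonlin (u t) (ρ t) x) (Icc 0 τ) := by
  refine continuousOn_of_dominated (bound := fun x => K ^ 2 * (Real.exp |x| / ψ x ^ 2))
    (fun t ht => (hw.mul (hK t ht).continuous_nonlin).aestronglyMeasurable)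
    (fun t ht => Eventually.of_forall fun x => ?_) (hψ.integrable.const_mul _)
    (Eventually.of_forall fun x => ((h.continuousOn_nonlin x).mono
      fun r hr => ⟨hr.1, hr.2.trans_lt hτ⟩).const_mul _)
  rw [Real.norm_eq_abs, abs_mul, abs_of_nonneg (nonlin_nonneg _ _ x)]
  refine le_trans ?_ ((hK t ht).exp_mul_jetSize_sq_le hψ x)
  exact mul_le_mul (hwb x) ((nonlin_le_energyDensity _ _ x).trans
    (energyDensity_le_jetSize_sq _ _ x)) (nonlin_nonneg _ _ x) (Real.exp_pos _).le

/-- The weighted energy balance. -/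
theorem ClassicalSolution.hasDerivAt_integral_energyDensity (h : ClassicalSolution T u ρ)
    {τ K : ℝ} (hτ : τ < T) (hψ : IsDecayWeight C ψ)
    (hK : ∀ t ∈ Icc 0 τ, DecaysLike ψ K (u t) (ρ t)) {w w' : ℝ → ℝ}
    (hw : ∀ x, HasDerivAt w (w' x) x) (hw' : Continuous w') (hwb : ∀ x, |w x| ≤ Real.exp |x|)
    (hwb' : ∀ x, |w' x| ≤ Real.exp |x|) {t : ℝ} (ht : t ∈ Ioo 0 τ) :
    HasDerivAt (fun t => ∫ x, w x * energyDensity (u t) (ρ t) x)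
      (∫ x, w' x * energyFlux (u t) (ρ t) x) t := by
  have hwc : Continuous w := continuous_iff_continuousAt.2 fun x => (hw x).continuousAt
  have hsub : ∀ r ∈ Ioo 0 τ, r ∈ Icc 0 τ := fun r hr => ⟨hr.1.le, hr.2.le⟩
  have hKt := hK t (hsub t ht)
  rw [← hKt.integral_mul_energyRate hψ hw hw' hwb hwb']
  refine (hasDerivAt_integral_of_dominated_loc_of_deriv_le (s := Ioo 0 τ)
    (F' := fun r x => w x * energyRate (u r) (ρ r) x)
    (bound := fun x => 12 * ((K ^ 2 * (∫ y, Real.exp |y| / ψ y ^ 2) * (K * (C * ψ 0)) + K ^ 3)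
      * (Real.exp |x| / ψ x ^ 2)))
    (Ioo_mem_nhds ht.1 ht.2) ?_ (hKt.integrable_mul_energyDensity hψ hwc hwb)
    (hwc.mul (hKt.continuous_energyRate hψ)).aestronglyMeasurable
    (Eventually.of_forall fun x r hr => ?_) ((hψ.integrable.const_mul _).const_mul _)
    (Eventually.of_forall fun x r hr => ?_)).2
  · filter_upwards [Ioo_mem_nhds ht.1 ht.2] with r hr
    exact (hwc.mul (hK r (hsub r hr)).continuous_energyDensity).aestronglyMeasurable
  · rw [norm_mul]
    calc ‖w x‖ * ‖energyRate (u r) (ρ r) x‖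
        ≤ Real.exp |x| * (12 * fluxMajorant (u r) (ρ r) x) :=
          mul_le_mul (hwb x) ((hK r (hsub r hr)).abs_energyRate_le hψ x) (norm_nonneg _)
            (Real.exp_pos _).le
      _ = 12 * (Real.exp |x| * fluxMajorant (u r) (ρ r) x) := by ring
      _ ≤ _ := mul_le_mul_of_nonneg_left
          ((hK r (hsub r hr)).exp_mul_fluxMajorant_le hψ x) (by norm_num)
  · exact (h.hasDerivAt_energyDensity ⟨hr.1, hr.2.trans hτ⟩ x).const_mul (w x)

end

/-! ### A bound for the exponentially weighted energy up to the time T. -/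

section FixedTime

variable {C K : ℝ} {ψ u ρ : ℝ → ℝ}

/-- u(x)² is the integral of 2 u uₓ ≤ u² + uₓ² over (-∞, x]. -/
theorem DecaysLike.sq_le_integral_energyDensity (h : DecaysLike ψ K u ρ)
    (hψ : IsDecayWeight C ψ) (x : ℝ) : u x ^ 2 ≤ ∫ y, energyDensity u ρ y := by
  have hie : Integrable (energyDensity u ρ) := by
    simpa using h.integrable_mul_energyDensity hψ (w := fun _ => 1) continuous_const
      (fun x => by simp)
  have hu := h.contDiff_u.continuous
  have hux := (contDiff_deriv h.contDiff_u).continuous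
  have hder : ∀ y, HasDerivAt (fun y => u y ^ 2) (2 * (u y * deriv u y)) y := fun y => by
    refine ((h.hasDerivAt_u y).pow 2).congr_deriv ?_
    push_cast; ring
  have hle : ∀ y, |2 * (u y * deriv u y)| ≤ energyDensity u ρ y := fun y => by
    unfold energyDensity
    rw [abs_le]
    constructor <;> nlinarith [sq_nonneg (u y - deriv u y), sq_nonneg (u y + deriv u y),
      sq_nonneg (ρ y)]
  have i1 : Integrable fun y => 2 * (u y * deriv u y) :=
    hie.mono' (by fun_prop) (Eventually.of_forall hle)
  have i2 : Integrable fun y => u y ^ 2 := by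
    refine hie.mono' (by fun_prop) (Eventually.of_forall fun y => ?_)
    rw [Real.norm_of_nonneg (sq_nonneg _)]
    unfold energyDensity
    linarith [sq_nonneg (deriv u y), sq_nonneg (ρ y)]
  have hlim : Tendsto (fun y => u y ^ 2) atBot (𝓝 0) :=
    tendsto_zero_of_hasDerivAt_of_integrableOn_Iic (a := 0) (fun y _ => hder y)
      i1.integrableOn i2.integrableOn
  have h1 := integral_Iic_of_hasDerivAt_of_tendsto' (a := x) (fun y _ => hder y)
    i1.integrableOn hlim
  rw [sub_zero] at h1
  rw [← h1]
  calc _ ≤ ∫ y in Iic x, energyDensity u ρ y :=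
        integral_mono i1.integrableOn hie.integrableOn fun y => (le_abs_self _).trans (hle y)
    _ ≤ _ := setIntegral_le_integral hie (Eventually.of_forall (energyDensity_nonneg u ρ))

/-- `∫ e^{x/2} G * F = 4/3 ∫ e^{x/2} F`. -/
theorem DecaysLike.integral_exp_half_mul_greenConv (h : DecaysLike ψ K u ρ)
    (hψ : IsDecayWeight C ψ) :
    (Integrable fun x => Real.exp (x / 2) * greenConv (nonlin u ρ) x) ∧
    ∫ x, Real.exp (x / 2) * greenConv (nonlin u ρ) x =
      4 / 3 * ∫ x, Real.exp (x / 2) * nonlin u ρ x := by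
  have hexp : ∀ x : ℝ, Real.exp (x / 2) ≤ Real.exp (|x| / 2) := fun x =>
    Real.exp_le_exp.2 (by linarith [le_abs_self x])
  have hI : 0 ≤ ∫ y, Real.exp |y| / ψ y ^ 2 := integral_nonneg fun y => by positivity
  have hPc := h.continuous_greenConv hψ
  have hQc := h.continuous_opP hψ
  have hmaj : ∀ f : ℝ → ℝ, Continuous f → (∀ x, |f x| ≤ greenConv (nonlin u ρ) x) →
      Integrable fun x => Real.exp (x / 2) * f x := fun f hf hfb => by
    refine ((integrable_exp_neg_mul_abs (a := 1 / 2) (by norm_num)).const_mul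
      (K ^ 2 * (∫ y, Real.exp |y| / ψ y ^ 2))).mono' (by fun_prop)
      (Eventually.of_forall fun x => ?_)
    rw [norm_mul, Real.norm_of_nonneg (Real.exp_pos _).le]
    calc Real.exp (x / 2) * ‖f x‖ ≤ Real.exp (|x| / 2) *
          (K ^ 2 * (∫ y, Real.exp |y| / ψ y ^ 2) * Real.exp (-|x|)) :=
          mul_le_mul (hexp x) ((hfb x).trans (h.greenConv_le hψ x)) (norm_nonneg _)
            (Real.exp_pos _).le
      _ = K ^ 2 * (∫ y, Real.exp |y| / ψ y ^ 2) * (Real.exp (|x| / 2) * Real.exp (-|x|)) := by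
          ring
      _ = _ := by rw [← Real.exp_add]; congr 2; ring
  have i1 := hmaj _ hPc fun x =>
    (abs_of_nonneg (greenConv_nonneg (nonlin_nonneg u ρ) x)).le
  have i2 := hmaj _ hQc (h.abs_opP_le hψ)
  have i3 : Integrable fun x => Real.exp (x / 2) * nonlin u ρ x :=
    h.integrable_mul_nonlin hψ (by fun_prop) fun x => by
      rw [abs_of_pos (Real.exp_pos _)]
      exact Real.exp_le_exp.2 (by linarith [le_abs_self x, abs_nonneg x])
  refine ⟨i1, ?_⟩
  -- This is (1 - ∂ₓ²)(G * F) = F tested against e^{x/2}, for which 1 - ∂ₓ² has the value 3/4; the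
  -- function differentiated collects the boundary terms.
  have hder : ∀ x, HasDerivAt
      (fun x => Real.exp (x / 2) * (opP (nonlin u ρ) x + greenConv (nonlin u ρ) x / 2))
      (Real.exp (x / 2) * nonlin u ρ x - 3 / 4 * (Real.exp (x / 2) * greenConv (nonlin u ρ) x))
      x := fun x => by
    have h1 : HasDerivAt (fun x : ℝ => Real.exp (x / 2)) (Real.exp (x / 2) * (1 / 2)) x :=
      ((hasDerivAt_id x).div_const 2).exp
    refine (h1.mul ((hasDerivAt_opP h.continuous_nonlin (h.abs_nonlin_le hψ) x).add
      ((h.hasDerivAt_greenConv hψ x).div_const 2))).congr_deriv ?_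
    simp only [Pi.add_apply]
    ring
  have h1 := integral_eq_zero_of_hasDerivAt_of_integrable hder (i3.sub (i1.const_mul _)) (by
    refine (i2.add (i1.const_mul (1 / 2))).congr (Eventually.of_forall fun x => ?_)
    simp only [Pi.add_apply]
    ring)
  rw [integral_sub i3 (i1.const_mul _), integral_const_mul] at h1
  linarith

end FixedTime

section FixedTime

variable {C K U : ℝ} {ψ u ρ : ℝ → ℝ}

theorem energyFlux_le {x : ℝ} (hU : |u x| ≤ U) :
    energyFlux u ρ x ≤ 2 * (|u x| * greenConv (nonlin u ρ) x) + U * energyDensity u ρ x := by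
  have hP := greenConv_nonneg (nonlin_nonneg u ρ) x
  have h1 : u x * greenConv (nonlin u ρ) x ≤ |u x| * greenConv (nonlin u ρ) x := by
    gcongr; exact le_abs_self _
  have h2 : u x * (deriv u x ^ 2 + ρ x ^ 2) ≤ U * energyDensity u ρ x := by
    unfold energyDensity
    have h3 : u x ≤ U := (le_abs_self _).trans hU
    have h4 : 0 ≤ U := (abs_nonneg _).trans hU
    refine (mul_le_mul_of_nonneg_right h3 (by positivity)).trans ?_
    gcongr
    linarith [sq_nonneg (u x)]
  unfold energyFlux
  linarith

theorem abs_exp_half_le (x : ℝ) : |Real.exp (x / 2)| ≤ Real.exp |x| := by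
  rw [abs_of_pos (Real.exp_pos _)]
  exact Real.exp_le_exp.2 (by linarith [le_abs_self x, abs_nonneg x])

theorem abs_exp_le (x : ℝ) : |Real.exp x| ≤ Real.exp |x| := by
  rw [abs_of_pos (Real.exp_pos _)]
  exact Real.exp_le_exp.2 (le_abs_self x)

/-- The weight e^{x/2} grows more slowly than G decays, so the nonlocal part of the flux costs only
a factor 4/3. The constant arises from 4/3 + 1/2 ≤ 2. -/
theorem DecaysLike.integral_exp_half_mul_energyFlux_le (h : DecaysLike ψ K u ρ)
    (hψ : IsDecayWeight C ψ) (hU0 : 0 ≤ U) (hU : ∀ x, |u x| ≤ U) :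
    ∫ x, Real.exp (x / 2) * (1 / 2) * energyFlux u ρ x ≤
      2 * U * ∫ x, Real.exp (x / 2) * energyDensity u ρ x := by
  obtain ⟨i1, e1⟩ := h.integral_exp_half_mul_greenConv hψ
  have i2 := h.integrable_mul_energyDensity hψ (w := fun x => Real.exp (x / 2)) (by fun_prop)
    abs_exp_half_le
  have i3 := h.integrable_mul_nonlin hψ (w := fun x => Real.exp (x / 2)) (by fun_prop)
    abs_exp_half_le
  have i4 : Integrable fun x => Real.exp (x / 2) * (1 / 2) * energyFlux u ρ x :=
    h.integrable_mul_of_le_fluxMajorant hψ (w := fun x => Real.exp (x / 2) * (1 / 2))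
      (by fun_prop) (fun x => by
        rw [abs_mul]
        refine le_trans ?_ (abs_exp_half_le x)
        exact mul_le_of_le_one_right (abs_nonneg _) (by norm_num [abs_of_pos]))
      (h.continuous_energyFlux hψ) (by norm_num) (abs_energyFlux_le u ρ)
  have h1 : ∫ x, Real.exp (x / 2) * (1 / 2) * energyFlux u ρ x ≤
      ∫ x, (U * (Real.exp (x / 2) * greenConv (nonlin u ρ) x)
        + U / 2 * (Real.exp (x / 2) * energyDensity u ρ x)) := by
    refine integral_mono i4 ((i1.const_mul _).add (i2.const_mul _)) fun x => ?_
    have hP := greenConv_nonneg (nonlin_nonneg u ρ) x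
    have h2 := energyFlux_le (ρ := ρ) (hU x)
    have h3 : |u x| * greenConv (nonlin u ρ) x ≤ U * greenConv (nonlin u ρ) x := by
      gcongr; exact hU x
    have h4 : energyFlux u ρ x ≤ 2 * (U * greenConv (nonlin u ρ) x) + U * energyDensity u ρ x := by
      linarith
    calc Real.exp (x / 2) * (1 / 2) * energyFlux u ρ x ≤ Real.exp (x / 2) * (1 / 2) *
          (2 * (U * greenConv (nonlin u ρ) x) + U * energyDensity u ρ x) := by gcongr
      _ = _ := by ring
  have h2 : ∫ x, Real.exp (x / 2) * nonlin u ρ x ≤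
      ∫ x, Real.exp (x / 2) * energyDensity u ρ x :=
    integral_mono i3 i2 fun x =>
      mul_le_mul_of_nonneg_left (nonlin_le_energyDensity u ρ x) (Real.exp_pos _).le
  rw [integral_add (i1.const_mul _) (i2.const_mul _), integral_const_mul, integral_const_mul,
    e1] at h1
  have h3 : 0 ≤ ∫ x, Real.exp (x / 2) * energyDensity u ρ x :=
    integral_nonneg fun x => mul_nonneg (Real.exp_pos _).le (energyDensity_nonneg u ρ x)
  nlinarith [mul_le_mul_of_nonneg_left h2 hU0, mul_nonneg hU0 h3]

/-- The weight e^x grows as fast as G decays, and e^x (G * F) is controlled only in the sup norm, by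
E₂/2. For x ≥ 0 integrability is supplied by u, through |u| ≤ ½ (e^{-x/2} + e^{x/2} u²), which
brings in E₁; for x ≤ 0 it is supplied by the weight. The result is linear in E₂ once E₀, E₁ and U
are bounded. -/
theorem DecaysLike.integral_exp_mul_energyFlux_le (h : DecaysLike ψ K u ρ)
    (hψ : IsDecayWeight C ψ) (hU0 : 0 ≤ U) (hU : ∀ x, |u x| ≤ U) :
    ∫ x, Real.exp x * energyFlux u ρ x ≤
      4 * U * (∫ x, energyDensity u ρ x) +
      (2 + (∫ x, Real.exp (x / 2) * energyDensity u ρ x) / 2 + U) *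
        ∫ x, Real.exp x * energyDensity u ρ x := by
  set E₀ := ∫ x, energyDensity u ρ x with hE₀
  set E₁ := ∫ x, Real.exp (x / 2) * energyDensity u ρ x with hE₁
  set E₂ := ∫ x, Real.exp x * energyDensity u ρ x with hE₂
  have j0 : Integrable (energyDensity u ρ) := by
    simpa using h.integrable_mul_energyDensity hψ (w := fun _ => 1) continuous_const
      (fun x => by simp)
  have j1 := h.integrable_mul_energyDensity hψ (w := fun x => Real.exp (x / 2)) (by fun_prop)
    abs_exp_half_le
  have j2 := h.integrable_mul_energyDensity hψ (w := fun x => Real.exp x) (by fun_prop)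
    abs_exp_le
  have n0 : Integrable (nonlin u ρ) := by
    simpa using h.integrable_mul_nonlin hψ (w := fun _ => 1) continuous_const (fun x => by simp)
  have n2 := h.integrable_mul_nonlin hψ (w := fun x => Real.exp x) (by fun_prop) abs_exp_le
  have jf : Integrable fun x => Real.exp x * energyFlux u ρ x :=
    h.integrable_mul_of_le_fluxMajorant hψ (w := fun x => Real.exp x)
      (by fun_prop) abs_exp_le (h.continuous_energyFlux hψ) (by norm_num) (abs_energyFlux_le u ρ)
  have je := integrable_exp_neg_mul_abs (a := 1 / 2) (by norm_num)
  have hE₀0 : 0 ≤ E₀ := integral_nonneg (energyDensity_nonneg u ρ)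
  have hE₂0 : 0 ≤ E₂ :=
    integral_nonneg fun x => mul_nonneg (Real.exp_pos _).le (energyDensity_nonneg u ρ x)
  have hP0 : ∀ x, greenConv (nonlin u ρ) x ≤ 1 / 2 * E₀ := fun x => by
    have := greenConv_le_exp (nonlin_nonneg u ρ) (a := fun _ => 0) (b := 0) (x := x)
      (fun y => by simp) (by simpa using n0)
    simp only [neg_zero, Real.exp_zero, one_mul] at this
    refine this.trans ?_
    gcongr
    exact integral_mono n0 j0 (nonlin_le_energyDensity u ρ)
  have hP2 : ∀ x, greenConv (nonlin u ρ) x ≤ Real.exp (-x) / 2 * E₂ := fun x => by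
    have := greenConv_le_exp (nonlin_nonneg u ρ) (a := fun y => y) (b := x) (x := x)
      (fun y => by linarith [le_abs_self (x - y)]) n2
    refine this.trans ?_
    gcongr
    exact integral_mono n2 j2 fun x =>
      mul_le_mul_of_nonneg_left (nonlin_le_energyDensity u ρ x) (Real.exp_pos _).le
  have hpt : ∀ x, Real.exp x * (|u x| * greenConv (nonlin u ρ) x) ≤
      (U * E₀ / 2 + E₂ / 4) * Real.exp (-(1 / 2 * |x|))
        + E₂ / 4 * (Real.exp (x / 2) * energyDensity u ρ x) := by
    intro x
    have hP := greenConv_nonneg (nonlin_nonneg u ρ) x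
    have hee := Real.exp_pos (-(1 / 2 * |x|))
    have hed := mul_nonneg (Real.exp_pos (x / 2)).le (energyDensity_nonneg u ρ x)
    rcases le_total x 0 with hx | hx
    · have h1 : Real.exp x ≤ Real.exp (-(1 / 2 * |x|)) :=
        Real.exp_le_exp.2 (by rw [abs_of_nonpos hx]; linarith)
      have h2 : |u x| * greenConv (nonlin u ρ) x ≤ U * (1 / 2 * E₀) :=
        mul_le_mul (hU x) (hP0 x) hP hU0
      have h3 : Real.exp x * (|u x| * greenConv (nonlin u ρ) x) ≤
          Real.exp (-(1 / 2 * |x|)) * (U * (1 / 2 * E₀)) :=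
        mul_le_mul h1 h2 (mul_nonneg (abs_nonneg _) hP) hee.le
      have h4 : 0 ≤ E₂ / 4 * (Real.exp (x / 2) * energyDensity u ρ x) := by positivity
      nlinarith [mul_nonneg hE₂0 hee.le]
    · have h1 : |u x| ≤ 1 / 2 * (Real.exp (-(1 / 2 * |x|)) + Real.exp (x / 2) * u x ^ 2) := by
        rw [abs_of_nonneg hx]
        have h3 : Real.exp (x / 2) = Real.exp (x / 4) ^ 2 := by
          rw [← Real.exp_nat_mul]; congr 1; push_cast; ring
        have h4 : Real.exp (-(1 / 2 * x)) = Real.exp (-(x / 4)) ^ 2 := by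
          rw [← Real.exp_nat_mul]; congr 1; push_cast; ring
        have h5 : Real.exp (-(x / 4)) * Real.exp (x / 4) = 1 := by
          rw [← Real.exp_add]; simp
        rw [h3, h4, ← sq_abs (u x)]
        have h6 : Real.exp (-(x / 4)) * Real.exp (x / 4) * |u x| = |u x| := by rw [h5, one_mul]
        linarith [sq_nonneg (Real.exp (-(x / 4)) - Real.exp (x / 4) * |u x|)]
      have h2 : u x ^ 2 ≤ energyDensity u ρ x := by
        unfold energyDensity; linarith [sq_nonneg (deriv u x), sq_nonneg (ρ x)]
      have h3 : Real.exp x * greenConv (nonlin u ρ) x ≤ E₂ / 2 := by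
        have h4 : Real.exp x * Real.exp (-x) = 1 := by rw [← Real.exp_add]; simp
        calc _ ≤ Real.exp x * (Real.exp (-x) / 2 * E₂) := by gcongr; exact hP2 x
          _ = (Real.exp x * Real.exp (-x)) * E₂ / 2 := by ring
          _ = _ := by rw [h4, one_mul]
      calc Real.exp x * (|u x| * greenConv (nonlin u ρ) x)
          = |u x| * (Real.exp x * greenConv (nonlin u ρ) x) := by ring
        _ ≤ (1 / 2 * (Real.exp (-(1 / 2 * |x|)) + Real.exp (x / 2) * energyDensity u ρ x)) *
              (E₂ / 2) := by
            refine mul_le_mul (h1.trans ?_) h3 (mul_nonneg (Real.exp_pos _).le hP)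
              (by positivity)
            gcongr
        _ ≤ _ := by nlinarith [mul_nonneg (mul_nonneg hU0 hE₀0) hee.le]
  have i12 : Integrable fun x => 2 * (U * E₀ / 2 + E₂ / 4) * Real.exp (-(1 / 2 * |x|))
        + 2 * (E₂ / 4) * (Real.exp (x / 2) * energyDensity u ρ x) :=
    (je.const_mul _).add (j1.const_mul _)
  have h1 : ∫ x, Real.exp x * energyFlux u ρ x ≤
      ∫ x, ((2 * (U * E₀ / 2 + E₂ / 4) * Real.exp (-(1 / 2 * |x|))
        + 2 * (E₂ / 4) * (Real.exp (x / 2) * energyDensity u ρ x))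
        + U * (Real.exp x * energyDensity u ρ x)) := by
    refine integral_mono jf (i12.add (j2.const_mul _))
      fun x => ?_
    have h2 := mul_le_mul_of_nonneg_left (energyFlux_le (ρ := ρ) (hU x)) (Real.exp_pos x).le
    simp only
    linarith [hpt x]
  rw [integral_add i12 (j2.const_mul _),
    integral_add (je.const_mul _) (j1.const_mul _), integral_const_mul, integral_const_mul,
    integral_const_mul, integral_exp_neg_mul_abs (by norm_num), ← hE₁, ← hE₂] at h1
  refine h1.trans_eq ?_
  ring

end FixedTime

section

variable {T C : ℝ} {ψ : ℝ → ℝ} {u ρ : ℝ → ℝ → ℝ}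

/-- The exponentially weighted energy of a solution is bounded up to the time `T`, even if the
solution breaks down at that time. -/
theorem ClassicalSolution.exists_integral_exp_mul_energyDensity_le
    (h : ClassicalSolution T u ρ) (hψ : IsDecayWeight C ψ)
    (hdec : ∀ τ ∈ Ico 0 T, ∃ K, ∀ t ∈ Icc 0 τ, DecaysLike ψ K (u t) (ρ t)) :
    ∃ M, ∀ t ∈ Ico 0 T, ∫ x, Real.exp x * energyDensity (u t) (ρ t) x ≤ M := by
  set E₀ : ℝ → ℝ := fun t => ∫ x, energyDensity (u t) (ρ t) x with hE₀
  set E₁ : ℝ → ℝ := fun t => ∫ x, Real.exp (x / 2) * energyDensity (u t) (ρ t) x with hE₁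
  set E₂ : ℝ → ℝ := fun t => ∫ x, Real.exp x * energyDensity (u t) (ρ t) x with hE₂
  have hE₁0 : ∀ t, 0 ≤ E₁ t := fun t =>
    integral_nonneg fun x => mul_nonneg (Real.exp_pos _).le (energyDensity_nonneg _ _ x)
  have hE₂0 : ∀ t, 0 ≤ E₂ t := fun t =>
    integral_nonneg fun x => mul_nonneg (Real.exp_pos _).le (energyDensity_nonneg _ _ x)
  have hE₀0 : 0 ≤ E₀ 0 := integral_nonneg fun x => energyDensity_nonneg _ _ x
  have b0 : ∀ t ∈ Ico 0 T, E₀ t ≤ E₀ 0 := fun t ht => by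
    obtain ⟨K, hK⟩ := hdec t ht
    have hc := h.continuousOn_integral_energyDensity ht.2 hψ hK (w := fun _ => 1)
      continuous_const (fun x => by simp)
    have hd := fun r hr => h.hasDerivAt_integral_energyDensity ht.2 hψ hK (w := fun _ => 1)
      (w' := fun _ => 0) (fun x => hasDerivAt_const x 1) continuous_const (fun x => by simp)
      (fun x => by simpa using (Real.exp_pos _).le) (t := r) hr
    simp only [one_mul, zero_mul, integral_zero] at hc hd
    have := le_exp_mul_of_hasDerivAt_le ht.1 le_rfl le_rfl hc hd (fun r _ => by simp)
    simpa using this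
  -- The energy at time 0 bounds |u| on all of [0,T), whatever happens to uₓ as t approaches T.
  set U := Real.sqrt (E₀ 0) with hU
  have hU0 : 0 ≤ U := Real.sqrt_nonneg _
  have hUb : ∀ t ∈ Ico 0 T, ∀ x, |u t x| ≤ U := fun t ht x => by
    obtain ⟨K, hK⟩ := hdec t ht
    refine Real.abs_le_sqrt (le_trans ?_ (b0 t ht))
    exact (hK t ⟨ht.1, le_rfl⟩).sq_le_integral_energyDensity hψ x
  have hsub : ∀ t ∈ Ico 0 T, ∀ r ∈ Ioo 0 t, r ∈ Ico 0 T ∧ r ∈ Icc 0 t := fun t ht r hr =>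
    ⟨⟨hr.1.le, hr.2.trans ht.2⟩, ⟨hr.1.le, hr.2.le⟩⟩
  have b1 : ∀ t ∈ Ico 0 T, E₁ t ≤ Real.exp (2 * U * T) * E₁ 0 := fun t ht => by
    obtain ⟨K, hK⟩ := hdec t ht
    have hc := h.continuousOn_integral_energyDensity ht.2 hψ hK
      (w := fun x => Real.exp (x / 2)) (by fun_prop) abs_exp_half_le
    have hd := fun r hr => h.hasDerivAt_integral_energyDensity ht.2 hψ hK
      (w := fun x => Real.exp (x / 2)) (w' := fun x => Real.exp (x / 2) * (1 / 2))
      (fun x => ((hasDerivAt_id x).div_const 2).exp) (by fun_prop) abs_exp_half_le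
      (fun x => by
        rw [abs_mul]
        refine le_trans ?_ (abs_exp_half_le x)
        exact mul_le_of_le_one_right (abs_nonneg _) (by norm_num [abs_of_pos])) (t := r) hr
    have := le_exp_mul_of_hasDerivAt_le (B := 2 * U) ht.1 le_rfl (by positivity) hc hd
      (fun r hr => by
        rw [zero_add]
        exact (hK r (hsub t ht r hr).2).integral_exp_half_mul_energyFlux_le hψ hU0
          (hUb r (hsub t ht r hr).1))
    refine this.trans ?_
    rw [zero_mul, add_zero]
    have := hE₁0 0
    gcongr
    exact ht.2.le
  set M₁ := Real.exp (2 * U * T) * E₁ 0 with hM₁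
  have hM₁0 : 0 ≤ M₁ := mul_nonneg (Real.exp_pos _).le (hE₁0 0)
  -- These coefficients do not depend on t. The constants K, which do, serve only to justify
  -- continuity and differentiation of the integrals.
  set A := 4 * U * E₀ 0 with hA
  set B := 2 + M₁ / 2 + U with hB
  have hA0 : 0 ≤ A := by positivity
  have hB0 : 0 ≤ B := by positivity
  refine ⟨Real.exp (B * T) * (E₂ 0 + A * T), fun t ht => ?_⟩
  obtain ⟨K, hK⟩ := hdec t ht
  have hc := h.continuousOn_integral_energyDensity ht.2 hψ hK
    (w := fun x => Real.exp x) (by fun_prop) abs_exp_le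
  have hd := fun r hr => h.hasDerivAt_integral_energyDensity ht.2 hψ hK
    (w := fun x => Real.exp x) (w' := fun x => Real.exp x)
    (fun x => Real.hasDerivAt_exp x) (by fun_prop) abs_exp_le abs_exp_le (t := r) hr
  have := le_exp_mul_of_hasDerivAt_le ht.1 hA0 hB0 hc hd (fun r hr => by
    obtain ⟨hr1, hr2⟩ := hsub t ht r hr
    refine ((hK r hr2).integral_exp_mul_energyFlux_le hψ hU0 (hUb r hr1)).trans ?_
    have h1 := b0 r hr1
    have h2 := b1 r hr1
    have h3 := hE₂0 r
    simp only [hE₀, hE₁, hE₂] at h1 h2 h3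
    rw [hA, hB]
    gcongr)
  refine this.trans ?_
  have h1 := ht.2.le
  have h2 := hE₂0 0
  have h3 := ht.1
  simp only [hE₂] at h2 ⊢
  gcongr

end

/-! ### The expansion at +∞. -/

/-- `½ ∫ e^y F(y) dy`, the leading coefficient of `-∂ₓ G * F` at `+∞`. -/
def expMoment (u ρ : ℝ → ℝ) : ℝ := (∫ x, Real.exp x * nonlin u ρ x) / 2

theorem expMoment_nonneg (u ρ : ℝ → ℝ) : 0 ≤ expMoment u ρ :=
  div_nonneg (integral_nonneg fun x => mul_nonneg (Real.exp_pos x).le (nonlin_nonneg u ρ x))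
    zero_le_two

/-- The error term of the expansion at `+∞`. -/
def tailError (ψ : ℝ → ℝ) (x : ℝ) : ℝ :=
  Real.exp |x| / ψ x ^ 2 + ∫ y in Ioi x, Real.exp |y| / ψ y ^ 2

theorem IsDecayWeight.tendsto_tailError {C : ℝ} {ψ : ℝ → ℝ} (hψ : IsDecayWeight C ψ) :
    Tendsto (tailError ψ) atTop (𝓝 0) := by
  have := hψ.tendsto_zero.add
    (tendsto_integral_Ioi_zero (f := fun y => Real.exp |y| / ψ y ^ 2) (μ := volume) tendsto_id)
  simpa [tailError] using! this

theorem tailError_nonneg (ψ : ℝ → ℝ) (x : ℝ) : 0 ≤ tailError ψ x :=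
  add_nonneg (by positivity) (integral_nonneg fun y => by positivity)

section FixedTime

variable {C K : ℝ} {ψ u ρ : ℝ → ℝ}

theorem DecaysLike.expMoment_pos (h : DecaysLike ψ K u ρ) (hψ : IsDecayWeight C ψ)
    (hne : u ≠ 0 ∨ ρ ≠ 0) : 0 < expMoment u ρ := by
  refine (expMoment_nonneg u ρ).lt_of_ne' fun h0 => ?_
  have hi := h.integrable_mul_nonlin hψ (w := fun x => Real.exp x) (by fun_prop) abs_exp_le
  have h1 : ∫ x, Real.exp x * nonlin u ρ x = 0 := by unfold expMoment at h0; linarith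
  have hn := h.continuous_nonlin
  rw [integral_eq_zero_iff_of_nonneg
    (fun x => mul_nonneg (Real.exp_pos x).le (nonlin_nonneg u ρ x)) hi] at h1
  replace h1 := (Continuous.ae_eq_iff_eq volume (Real.continuous_exp.mul hn) continuous_zero).1 h1
  have h2 : ∀ x, u x = 0 ∧ ρ x = 0 := fun x => by
    have h3 : nonlin u ρ x = 0 := by
      simpa [Real.exp_ne_zero] using congrFun h1 x
    unfold nonlin at h3
    constructor <;> refine pow_eq_zero_iff two_ne_zero |>.1 ?_ <;>
    nlinarith [sq_nonneg (u x), sq_nonneg (deriv u x), sq_nonneg (ρ x)]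
  rcases hne with h3 | h3
  · exact h3 (funext fun x => (h2 x).1)
  · exact h3 (funext fun x => (h2 x).2)

/-- P F(x) differs from e^{-x} `expMoment` in two ways: the left mean omits the moment over (x,∞),
and the right mean is subtracted. Each costs at most ½ e^{-x} times that tail moment. -/
theorem DecaysLike.abs_opP_sub_le (h : DecaysLike ψ K u ρ) (hψ : IsDecayWeight C ψ) (x : ℝ) :
    |opP (nonlin u ρ) x - Real.exp (-x) * expMoment u ρ| ≤
      K ^ 2 * Real.exp (-x) * ∫ y in Ioi x, Real.exp |y| / ψ y ^ 2 := by
  have hi := h.integrable_mul_nonlin hψ (w := fun x => Real.exp x) (by fun_prop) abs_exp_le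
  have hF := nonlin_nonneg u ρ
  have hR : rightExpMean (nonlin u ρ) x ≤
      Real.exp (-x) * ∫ y in Ioi x, Real.exp y * nonlin u ρ y := by
    rw [rightExpMean, ← integral_const_mul]
    refine integral_mono_of_nonneg
      (Eventually.of_forall fun y => mul_nonneg (Real.exp_pos _).le (hF y))
      (hi.integrableOn.const_mul _) ?_
    filter_upwards [ae_restrict_mem measurableSet_Ioi] with y hy
    rw [← mul_assoc, ← Real.exp_add]
    have : x < y := hy
    gcongr
    · exact hF y
    · linarith
  have hR0 : 0 ≤ rightExpMean (nonlin u ρ) x :=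
    integral_nonneg fun y => mul_nonneg (Real.exp_pos _).le (hF y)
  have hT : ∫ y in Ioi x, Real.exp y * nonlin u ρ y ≤
      K ^ 2 * ∫ y in Ioi x, Real.exp |y| / ψ y ^ 2 := by
    rw [← integral_const_mul]
    refine integral_mono hi.integrableOn (hψ.integrable.integrableOn.const_mul _) fun y => ?_
    refine le_trans ?_ (h.exp_mul_jetSize_sq_le hψ y)
    exact mul_le_mul ((le_abs_self _).trans (abs_exp_le y))
      ((nonlin_le_energyDensity u ρ y).trans (energyDensity_le_jetSize_sq u ρ y)) (hF y)
      (Real.exp_pos _).le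
  have hS := integral_add_compl (measurableSet_Iic (a := x)) hi
  rw [compl_Iic] at hS
  have hT' := mul_le_mul_of_nonneg_left hT (Real.exp_pos (-x)).le
  have hT0 : 0 ≤ Real.exp (-x) * ∫ y in Ioi x, Real.exp y * nonlin u ρ y :=
    mul_nonneg (Real.exp_pos _).le
      (integral_nonneg fun y => mul_nonneg (Real.exp_pos _).le (hF y))
  rw [opP_eq h.continuous_nonlin (h.abs_nonlin_le hψ), leftExpMean_eq, expMoment, ← hS]
  rw [abs_le]
  constructor <;> linarith

/-- The local terms are products of two jet entries, of size K²/ψ² = K² e^{-x} (e^{|x|}/ψ²) for x ≥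
0. Only P F contributes at order e^{-x}. -/
theorem DecaysLike.abs_rate_u_sub_le (h : DecaysLike ψ K u ρ) (hψ : IsDecayWeight C ψ) {x : ℝ}
    (hx : 0 ≤ x) :
    |opP (nonlin u ρ) x - u x * deriv u x - Real.exp (-x) * expMoment u ρ| ≤
      2 * K ^ 2 * Real.exp (-x) * tailError ψ x ∧
    |-(ρ x * deriv u x) - u x * deriv ρ x| ≤ 2 * K ^ 2 * Real.exp (-x) * tailError ψ x := by
  obtain ⟨h1, h2, -, h3, h4⟩ := abs_le_jetSize u ρ x
  have hS := jetSize_nonneg u ρ x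
  have hS2 : jetSize u ρ x ^ 2 ≤ K ^ 2 * Real.exp (-x) * (Real.exp |x| / ψ x ^ 2) := by
    have h5 := mul_le_mul_of_nonneg_left (h.exp_mul_jetSize_sq_le hψ x) (Real.exp_pos (-x)).le
    have h6 : Real.exp (-x) * Real.exp |x| = 1 := by
      rw [abs_of_nonneg hx, ← Real.exp_add]; simp
    rw [← mul_assoc, h6, one_mul] at h5
    linarith
  have hp : ∀ a b : ℝ, |a| ≤ jetSize u ρ x → |b| ≤ jetSize u ρ x →
      |a * b| ≤ jetSize u ρ x ^ 2 := fun a b ha hb => by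
    rw [abs_mul, sq]; gcongr
  have e1 := hp _ _ h1 h2
  have e2 := hp _ _ h3 h2
  have e3 := hp _ _ h1 h4
  have e4 := h.abs_opP_sub_le hψ x
  have hI : 0 ≤ K ^ 2 * Real.exp (-x) * ∫ y in Ioi x, Real.exp |y| / ψ y ^ 2 := by
    have : 0 ≤ ∫ y in Ioi x, Real.exp |y| / ψ y ^ 2 := integral_nonneg fun y => by positivity
    positivity
  have hJ : 0 ≤ K ^ 2 * Real.exp (-x) * (Real.exp |x| / ψ x ^ 2) := by positivity
  unfold tailError
  rw [abs_le] at e1 e2 e3 e4 ⊢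
  rw [abs_le]
  constructor <;> constructor <;> linarith

end FixedTime

theorem abs_sub_le_of_hasDerivAt {f f' : ℝ → ℝ} {t B : ℝ} (ht : 0 < t)
    (hf : ContinuousOn f (Icc 0 t)) (hf' : ∀ r ∈ Ioo 0 t, HasDerivAt f (f' r) r)
    (hb : ∀ r ∈ Ioo 0 t, |f' r| ≤ B) : |f t - f 0| ≤ B * t := by
  obtain ⟨c, hc, hcs⟩ := exists_hasDerivAt_eq_slope f f' ht hf hf'
  rw [sub_zero, eq_div_iff ht.ne'] at hcs
  rw [← hcs, abs_mul, abs_of_pos ht]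
  exact mul_le_mul_of_nonneg_right (hb c hc) ht.le

variable {T C : ℝ} {ψ : ℝ → ℝ} {u ρ : ℝ → ℝ → ℝ}

theorem ClassicalSolution.continuousOn_expMoment (h : ClassicalSolution T u ρ)
    {τ K : ℝ} (hτ : τ < T) (hψ : IsDecayWeight C ψ)
    (hK : ∀ t ∈ Icc 0 τ, DecaysLike ψ K (u t) (ρ t)) :
    ContinuousOn (fun t => expMoment (u t) (ρ t)) (Icc 0 τ) :=
  (h.continuousOn_integral_nonlin hτ hψ hK (w := fun x => Real.exp x) (by fun_prop)
    abs_exp_le).div_const 2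

/-- The expansion of the solution at `+∞`, with an explicit error. -/
theorem ClassicalSolution.abs_sub_sub_le (h : ClassicalSolution T u ρ)
    {t K : ℝ} (ht0 : 0 < t) (ht : t < T) (hψ : IsDecayWeight C ψ)
    (hK : ∀ r ∈ Icc 0 t, DecaysLike ψ K (u r) (ρ r)) {x : ℝ} (hx : 0 ≤ x) :
    |u t x - u 0 x - Real.exp (-x) * ∫ r in (0 : ℝ)..t, expMoment (u r) (ρ r)| ≤
      2 * K ^ 2 * Real.exp (-x) * tailError ψ x * t ∧
    |ρ t x - ρ 0 x| ≤ 2 * K ^ 2 * Real.exp (-x) * tailError ψ x * t := by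
  have hmem : ∀ r ∈ Icc 0 t, r ∈ Ico 0 T := fun r hr => ⟨hr.1, hr.2.trans_lt ht⟩
  have hsub : ∀ r ∈ Ioo 0 t, r ∈ Icc 0 t := fun r hr => ⟨hr.1.le, hr.2.le⟩
  have hnhds : ∀ r ∈ Ioo 0 t, Ico 0 T ∈ 𝓝 r := fun r hr => Ico_mem_nhds hr.1 (hr.2.trans ht)
  have hc := h.continuousOn_expMoment ht hψ hK
  have hii : IntervalIntegrable (fun r => expMoment (u r) (ρ r)) volume 0 t := by
    refine ContinuousOn.intervalIntegrable ?_
    rwa [uIcc_of_le ht0.le]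
  have hprim : ContinuousOn (fun s => ∫ r in (0 : ℝ)..s, expMoment (u r) (ρ r)) (Icc 0 t) := by
    have := intervalIntegral.continuousOn_primitive_interval' hii left_mem_uIcc
    rwa [uIcc_of_le ht0.le] at this
  have hprim' : ∀ s ∈ Ioo 0 t, HasDerivAt (fun s => ∫ r in (0 : ℝ)..s, expMoment (u r) (ρ r))
      (expMoment (u s) (ρ s)) s := fun s hs => by
    have hcs : ContinuousOn (fun r => expMoment (u r) (ρ r)) (Ioo 0 t) :=
      hc.mono Ioo_subset_Icc_self
    refine intervalIntegral.integral_hasDerivAt_right (hii.mono_set ?_)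
      (hcs.stronglyMeasurableAtFilter isOpen_Ioo s hs) (hcs.continuousAt (isOpen_Ioo.mem_nhds hs))
    rw [uIcc_of_le ht0.le, uIcc_of_le hs.1.le]
    exact Icc_subset_Icc_right hs.2.le
  have hu : ContinuousOn (fun r => u r x) (Icc 0 t) := fun r hr =>
    ((h.time_deriv_u.hasDerivWithinAt (hmem r hr) x).continuousWithinAt).mono hmem
  have hρ : ContinuousOn (fun r => ρ r x) (Icc 0 t) := fun r hr =>
    ((h.time_deriv_ρ.hasDerivWithinAt (hmem r hr) x).continuousWithinAt).mono hmem
  constructor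
  · have := abs_sub_le_of_hasDerivAt
      (f := fun s => u s x - Real.exp (-x) * ∫ r in (0 : ℝ)..s, expMoment (u r) (ρ r)) ht0 (hu.sub (hprim.const_mul (Real.exp (-x))))
      (fun r hr => ((h.time_deriv_u.hasDerivWithinAt (hmem r (hsub r hr)) x).hasDerivAt
        (hnhds r hr)).sub ((hprim' r hr).const_mul (Real.exp (-x))))
      (fun r hr => ((hK r (hsub r hr)).abs_rate_u_sub_le hψ hx).1)
    simp only [intervalIntegral.integral_same, mul_zero, sub_zero] at this
    convert! this using 2
    ring
  · exact abs_sub_le_of_hasDerivAt ht0 hρ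
      (fun r hr => (h.time_deriv_ρ.hasDerivWithinAt (hmem r (hsub r hr)) x).hasDerivAt
        (hnhds r hr))
      (fun r hr => ((hK r (hsub r hr)).abs_rate_u_sub_le hψ hx).2)

/-- The moment is positive near time 0 and nonnegative afterwards. Its integral from 0 to t thus
stays above a multiple of t, without any lower bound on the moment at later times. -/
theorem ClassicalSolution.exists_le_integral_expMoment (h : ClassicalSolution T u ρ)
    (hT : 0 < T) (hψ : IsDecayWeight C ψ)
    (hdec : ∀ τ ∈ Ico 0 T, ∃ K, ∀ t ∈ Icc 0 τ, DecaysLike ψ K (u t) (ρ t))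
    (hne : u 0 ≠ 0 ∨ ρ 0 ≠ 0) :
    ∃ c, 0 < c ∧ c ≤ expMoment (u 0) (ρ 0) ∧
      ∀ t ∈ Ico 0 T, c * t ≤ ∫ r in (0 : ℝ)..t, expMoment (u r) (ρ r) := by
  have hτ : T / 2 ∈ Ico 0 T := ⟨by linarith, by linarith⟩
  obtain ⟨K, hK⟩ := hdec _ hτ
  set m : ℝ → ℝ := fun t => expMoment (u t) (ρ t) with hm
  have hm0 : 0 < m 0 := (hK 0 ⟨le_rfl, hτ.1⟩).expMoment_pos hψ hne
  have hc := h.continuousOn_expMoment hτ.2 hψ hK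
  have hev : ∀ᶠ r in 𝓝[Icc 0 (T / 2)] 0, m 0 / 2 < m r :=
    (hc 0 ⟨le_rfl, hτ.1⟩).eventually (lt_mem_nhds (by linarith))
  obtain ⟨δ, hδ, hδm⟩ := Metric.mem_nhdsWithin_iff.1 hev
  set a := min (δ / 2) (T / 2) with ha
  have ha0 : 0 < a := lt_min (by linarith) (by linarith)
  have haT : a < T := (min_le_right _ _).trans_lt hτ.2
  have hlow : ∀ r ∈ Icc 0 a, m 0 / 2 ≤ m r := fun r hr => by
    refine (hδm ⟨?_, hr.1, hr.2.trans (min_le_right _ _)⟩ : m 0 / 2 < m r).le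
    rw [Metric.mem_ball, Real.dist_eq, sub_zero, abs_of_nonneg hr.1]
    linarith [hr.2, min_le_left (δ / 2) (T / 2)]
  -- The moment is at least m(0)/2 on [0,a], and min(a,t) ≥ (a/T) t for t in [0,T).
  refine ⟨m 0 / 2 * (a / T), by positivity, ?_, fun t ht => ?_⟩
  · have : a / T ≤ 1 := (div_le_one hT).2 haT.le
    change m 0 / 2 * (a / T) ≤ m 0
    nlinarith
  · obtain ⟨K', hK'⟩ := hdec t ht
    have hct := h.continuousOn_expMoment ht.2 hψ hK'
    set b := min a t with hb
    have hb0 : 0 ≤ b := le_min ha0.le ht.1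
    have hbt : b ≤ t := min_le_right _ _
    have i1 : IntervalIntegrable m volume 0 b := ContinuousOn.intervalIntegrable (by
      rw [uIcc_of_le hb0]; exact hct.mono (Icc_subset_Icc_right hbt))
    have i2 : IntervalIntegrable m volume b t := ContinuousOn.intervalIntegrable (by
      rw [uIcc_of_le hbt]; exact hct.mono (Icc_subset_Icc_left hb0))
    rw [← intervalIntegral.integral_add_adjacent_intervals i1 i2]
    have h1 : m 0 / 2 * b ≤ ∫ r in (0 : ℝ)..b, m r := by
      have := intervalIntegral.integral_mono_on hb0 intervalIntegrable_const i1
        (fun r hr => hlow r ⟨hr.1, hr.2.trans (min_le_left _ _)⟩)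
      rw [intervalIntegral.integral_const, smul_eq_mul, sub_zero] at this
      linarith
    have h2 : 0 ≤ ∫ r in b..t, m r :=
      intervalIntegral.integral_nonneg hbt fun r _ => expMoment_nonneg _ _
    have h3 : a / T * t ≤ b := by
      refine le_min ?_ ?_
      · rw [div_mul_eq_mul_div, div_le_iff₀ hT]
        exact mul_le_mul_of_nonneg_left ht.2.le ha0.le
      · exact mul_le_of_le_one_left ht.1 ((div_le_one hT).2 haT.le)
    have h4 : m 0 / 2 * (a / T * t) ≤ m 0 / 2 * b := by gcongr
    linarith

/-- The asymptotic profile of the solution at `+∞`. -/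
theorem ClassicalSolution.exists_asymptotics (h : ClassicalSolution T u ρ)
    (hT : 0 < T) (hψ : IsDecayWeight C ψ)
    (hdec : ∀ τ ∈ Ico 0 T, ∃ K, ∀ t ∈ Icc 0 τ, DecaysLike ψ K (u t) (ρ t))
    (hne : u 0 ≠ 0 ∨ ρ 0 ≠ 0) :
    ∃ (Φ : ℝ → ℝ) (ε₁ ε₂ : ℝ → ℝ → ℝ),
      (∀ t ∈ Ico 0 T, ∀ x,
        u t x = u 0 x + Real.exp (-x) * t * (Φ t + ε₁ x t) ∧
        ρ t x = ρ 0 x + Real.exp (-x) * t * ε₂ x t) ∧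
      (∀ τ ∈ Ico 0 T, TendstoUniformlyOn ε₁ 0 atTop (Icc 0 τ) ∧
        TendstoUniformlyOn ε₂ 0 atTop (Icc 0 τ)) ∧
      ∃ c₁ c₂ : ℝ, 0 < c₁ ∧ 0 < c₂ ∧ ∀ t ∈ Ico 0 T, c₁ ≤ Φ t ∧ Φ t ≤ c₂ := by
  set m : ℝ → ℝ := fun t => expMoment (u t) (ρ t) with hm
  -- Φ is the mean of m over [0,t]. At t = 0 the factor t leaves the value free, and m(0) respects
  -- the two-sided bounds.
  set Φ : ℝ → ℝ := fun t => if t = 0 then m 0 else t⁻¹ * ∫ r in (0 : ℝ)..t, m r with hΦ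
  set ε₁ : ℝ → ℝ → ℝ := fun x t =>
    if t = 0 then 0 else t⁻¹ * (Real.exp x * (u t x - u 0 x)) - Φ t with hε₁
  set ε₂ : ℝ → ℝ → ℝ := fun x t =>
    if t = 0 then 0 else t⁻¹ * (Real.exp x * (ρ t x - ρ 0 x)) with hε₂
  have hexp : ∀ x : ℝ, Real.exp (-x) * Real.exp x = 1 := fun x => by
    rw [← Real.exp_add]; simp
  refine ⟨Φ, ε₁, ε₂, fun t ht x => ?_, fun τ hτ => ?_, ?_⟩
  · rcases eq_or_ne t 0 with rfl | ht0
    · simp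
    · simp only [hε₁, hε₂, if_neg ht0, add_sub_cancel]
      constructor
      · calc u t x = u 0 x + (Real.exp (-x) * Real.exp x) * (t * t⁻¹) * (u t x - u 0 x) := by
              rw [hexp, mul_inv_cancel₀ ht0]; ring
          _ = _ := by ring
      · calc ρ t x = ρ 0 x + (Real.exp (-x) * Real.exp x) * (t * t⁻¹) * (ρ t x - ρ 0 x) := by
              rw [hexp, mul_inv_cancel₀ ht0]; ring
          _ = _ := by ring
  · obtain ⟨K, hK⟩ := hdec τ hτ
    have hlim : Tendsto (fun x => 2 * K ^ 2 * tailError ψ x) atTop (𝓝 0) := by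
      simpa using hψ.tendsto_tailError.const_mul (2 * K ^ 2)
    have hbound : ∀ t ∈ Icc 0 τ, ∀ x, 0 ≤ x →
        |ε₁ x t| ≤ 2 * K ^ 2 * tailError ψ x ∧ |ε₂ x t| ≤ 2 * K ^ 2 * tailError ψ x := by
      intro t ht x hx
      rcases eq_or_ne t 0 with rfl | ht0
      · have := tailError_nonneg ψ x
        simp only [hε₁, hε₂, if_true, abs_zero]
        constructor <;> positivity
      · have htp : 0 < t := lt_of_le_of_ne ht.1 ht0.symm
        obtain ⟨h1, h2⟩ := h.abs_sub_sub_le htp (ht.2.trans_lt hτ.2) hψ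
          (fun r hr => hK r ⟨hr.1, hr.2.trans ht.2⟩) hx
        have hfac : ∀ a b : ℝ, |a| ≤ 2 * K ^ 2 * Real.exp (-x) * b * t →
            |t⁻¹ * (Real.exp x * a)| ≤ 2 * K ^ 2 * b := fun a b hab => by
          rw [abs_mul, abs_mul, abs_of_pos (inv_pos.2 htp), abs_of_pos (Real.exp_pos x)]
          calc t⁻¹ * (Real.exp x * |a|)
              ≤ t⁻¹ * (Real.exp x * (2 * K ^ 2 * Real.exp (-x) * b * t)) := by gcongr
            _ = (Real.exp (-x) * Real.exp x) * (t * t⁻¹) * (2 * K ^ 2 * b) := by ring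
            _ = _ := by rw [hexp, mul_inv_cancel₀ ht0]; ring
        simp only [hε₁, hε₂, hΦ, if_neg ht0]
        refine ⟨?_, hfac _ _ h2⟩
        have h3 := hfac _ _ h1
        convert! h3 using 2
        linear_combination (t⁻¹ * ∫ r in (0 : ℝ)..t, m r) * hexp x
    have hev : ∀ ε > 0, ∀ᶠ x in atTop, 0 ≤ x ∧ 2 * K ^ 2 * tailError ψ x < ε := fun ε hε =>
      (eventually_ge_atTop 0).and (hlim.eventually (gt_mem_nhds hε))
    constructor <;> rw [Metric.tendstoUniformlyOn_iff] <;> intro ε hε <;>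
      filter_upwards [hev ε hε] with x hx t ht <;>
      rw [dist_comm, Real.dist_eq, Pi.zero_apply, sub_zero]
    · exact (hbound t ht x hx.1).1.trans_lt hx.2
    · exact (hbound t ht x hx.1).2.trans_lt hx.2
  · obtain ⟨c, hc0, hcm, hc⟩ := h.exists_le_integral_expMoment hT hψ hdec hne
    -- The upper bound must be uniform on [0,T), hence the weighted energy is used instead of the
    -- decay constants, which depend on τ.
    obtain ⟨M, hM⟩ := h.exists_integral_exp_mul_energyDensity_le hψ hdec
    have hmM : ∀ t ∈ Ico 0 T, m t ≤ |M| := fun t ht => by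
      obtain ⟨K, hK⟩ := hdec t ht
      have hKt := hK t ⟨ht.1, le_rfl⟩
      have h1 : ∫ x, Real.exp x * nonlin (u t) (ρ t) x ≤ M := by
        refine le_trans ?_ (hM t ht)
        exact integral_mono
          (hKt.integrable_mul_nonlin hψ (w := fun x => Real.exp x) (by fun_prop) abs_exp_le)
          (hKt.integrable_mul_energyDensity hψ (w := fun x => Real.exp x) (by fun_prop)
            abs_exp_le)
          fun x => mul_le_mul_of_nonneg_left (nonlin_le_energyDensity _ _ x) (Real.exp_pos _).le
      simp only [hm, expMoment]
      linarith [le_abs_self M, abs_nonneg M]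
    refine ⟨c, |M| + 1, hc0, by positivity, fun t ht => ?_⟩
    rcases eq_or_ne t 0 with rfl | ht0
    · simp only [hΦ, if_true]
      exact ⟨hcm, (hmM 0 ht).trans (by linarith)⟩
    · have htp : 0 < t := lt_of_le_of_ne ht.1 ht0.symm
      obtain ⟨K, hK⟩ := hdec t ht
      have hii : IntervalIntegrable m volume 0 t := ContinuousOn.intervalIntegrable (by
        rw [uIcc_of_le ht.1]; exact h.continuousOn_expMoment ht.2 hψ hK)
      have hup : ∫ r in (0 : ℝ)..t, m r ≤ |M| * t := by
        have := intervalIntegral.integral_mono_on ht.1 hii intervalIntegrable_const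
          (fun r hr => hmM r ⟨hr.1, hr.2.trans_lt ht.2⟩)
        rw [intervalIntegral.integral_const, smul_eq_mul, sub_zero] at this
        linarith
      simp only [hΦ, if_neg ht0]
      rw [inv_mul_eq_div, le_div_iff₀ htp, div_le_iff₀ htp]
      exact ⟨hc t ht, hup.trans (by nlinarith)⟩

end TwoCH

end

/-! ### Assembly: both ends of the line. -/

theorem corollary2 (d : ℝ) (hd : 1 / 2 < d) (s : ℝ) (hs : 3 < s) (T : ℝ) (hT : 0 < T)
    (u₀ ρ₀ : ℝ → ℝ) (hu₀ : TwoCH.MemH s u₀) (hρ₀ : TwoCH.MemH (s - 1) ρ₀)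
    (hne : u₀ ≠ 0 ∨ ρ₀ ≠ 0)
    (hcond : ∃ K : ℝ, ∀ x : ℝ, TwoCH.weightedSize d u₀ ρ₀ x ≤ K)
    (u ρ : ℝ → ℝ → ℝ) (hsol : TwoCH.IsStrongSolution s T u₀ ρ₀ u ρ) :
    (∀ τ ∈ Set.Ico 0 T, ∃ K : ℝ, ∀ t ∈ Set.Icc 0 τ, ∀ x : ℝ,
      TwoCH.weightedSize d (u t) (ρ t) x ≤ K) ∧
    ∃ (Φp Φm : ℝ → ℝ) (ε₁p ε₂p ε₁m ε₂m : ℝ → ℝ → ℝ),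
      (∀ t ∈ Set.Ico 0 T, ∀ x : ℝ,
        u t x = u₀ x + Real.exp (-x) * t * (Φp t + ε₁p x t) ∧
        ρ t x = ρ₀ x + Real.exp (-x) * t * ε₂p x t ∧
        u t x = u₀ x - Real.exp x * t * (Φm t + ε₁m x t) ∧
        ρ t x = ρ₀ x - Real.exp x * t * ε₂m x t) ∧
      (∀ τ ∈ Set.Ico 0 T,
        TendstoUniformlyOn ε₁p 0 Filter.atTop (Set.Icc 0 τ) ∧
        TendstoUniformlyOn ε₂p 0 Filter.atTop (Set.Icc 0 τ) ∧
        TendstoUniformlyOn ε₁m 0 Filter.atBot (Set.Icc 0 τ) ∧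
        TendstoUniformlyOn ε₂m 0 Filter.atBot (Set.Icc 0 τ)) ∧
      ∃ c₁ c₂ : ℝ, 0 < c₁ ∧ 0 < c₂ ∧ ∀ t ∈ Set.Ico 0 T,
        c₁ ≤ Φp t ∧ Φp t ≤ c₂ ∧ c₁ ≤ Φm t ∧ Φm t ≤ c₂ := by
  obtain ⟨C, hψ⟩ := TwoCH.exists_isDecayWeight_psi hd
  have h := hsol.classicalSolution hs
  have hu0 := hsol.init_u
  have hr0 := hsol.init_ρ
  have hpers : ∀ τ ∈ Ico 0 T, ∃ K, ∀ t ∈ Icc 0 τ, ∀ x,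
      TwoCH.psi d x * TwoCH.jetSize (u t) (ρ t) x ≤ K := fun τ hτ =>
    h.exists_jetSize_bound_of_isModerate hτ hψ.toIsModerate (by rw [hu0, hr0]; exact hcond)
  have hdec : ∀ τ ∈ Ico 0 T, ∃ K, ∀ t ∈ Icc 0 τ,
      TwoCH.DecaysLike (TwoCH.psi d) K (u t) (ρ t) := fun τ hτ => by
    obtain ⟨K, hK⟩ := hpers τ hτ
    have hm : ∀ t ∈ Icc 0 τ, t ∈ Ico 0 T := fun t ht => ⟨ht.1, ht.2.trans_lt hτ.2⟩
    exact ⟨K, fun t ht => ⟨h.contDiff_u t (hm t ht), h.contDiff_ρ t (hm t ht), hK t ht⟩⟩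
  have h' := h.reflect
  have hdec' : ∀ τ ∈ Ico 0 T, ∃ K, ∀ t ∈ Icc 0 τ,
      TwoCH.DecaysLike (TwoCH.psi d) K (fun x => -u t (-x)) fun x => ρ t (-x) := fun τ hτ => by
    obtain ⟨K, hK⟩ := hpers τ hτ
    have hm : ∀ t ∈ Icc 0 τ, t ∈ Ico 0 T := fun t ht => ⟨ht.1, ht.2.trans_lt hτ.2⟩
    refine ⟨K, fun t ht => ⟨h'.contDiff_u t (hm t ht), h'.contDiff_ρ t (hm t ht), fun x => ?_⟩⟩
    rw [TwoCH.jetSize_reflect, ← TwoCH.psi_neg]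
    exact hK t ht (-x)
  have hne0 : u 0 ≠ 0 ∨ ρ 0 ≠ 0 := by rwa [hu0, hr0]
  have hne' : (fun x => -u 0 (-x)) ≠ 0 ∨ (fun x => ρ 0 (-x)) ≠ 0 := by
    refine hne0.imp (fun hn h0 => hn ?_) (fun hn h0 => hn ?_)
    · ext x
      simpa using congrFun h0 (-x)
    · ext x
      simpa using congrFun h0 (-x)
  obtain ⟨Φp, ε₁p, ε₂p, hp, hpε, c₁, c₂, hc₁, hc₂, hpc⟩ :=
    h.exists_asymptotics hT hψ hdec hne0
  obtain ⟨Φm, ε₁m, ε₂m, hm, hmε, c₁', c₂', hc₁', hc₂', hmc⟩ :=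
    h'.exists_asymptotics hT hψ hdec' hne'
  have hrefl : ∀ (ε : ℝ → ℝ → ℝ) (S : Set ℝ), TendstoUniformlyOn ε 0 atTop S →
      TendstoUniformlyOn (fun x t => ε (-x) t) 0 atBot S := fun ε S hε v hv =>
    tendsto_neg_atBot_atTop.eventually (hε v hv)
  -- At -x the reflected velocity is -u(x), which produces the minus sign of the expansion at -∞.
  -- The density is reflected evenly, so its error term must change sign.
  refine ⟨hpers, Φp, Φm, ε₁p, ε₂p, fun x t => ε₁m (-x) t, fun x t => -ε₂m (-x) t,
    fun t ht x => ?_, fun τ hτ => ?_, min c₁ c₁', max c₂ c₂', lt_min hc₁ hc₁', lt_max_of_lt_left hc₂,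
    fun t ht => ?_⟩
  · obtain ⟨e1, e2⟩ := hp t ht x
    obtain ⟨e3, e4⟩ := hm t ht (-x)
    simp only [neg_neg] at e3 e4
    rw [hu0] at e1 e3
    rw [hr0] at e2 e4
    exact ⟨e1, e2, by linarith, by linarith⟩
  · obtain ⟨e1, e2⟩ := hpε τ hτ
    obtain ⟨e3, e4⟩ := hmε τ hτ
    refine ⟨e1, e2, hrefl _ _ e3, ?_⟩
    have := (hrefl _ _ e4).fun_neg
    simpa using! this
  · obtain ⟨e1, e2⟩ := hpc t ht
    obtain ⟨e3, e4⟩ := hmc t ht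
    exact ⟨(min_le_left _ _).trans e1, e2.trans (le_max_left _ _),
      (min_le_right _ _).trans e3, e4.trans (le_max_right _ _)⟩
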